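/- Let $R_0$ be a discrete valuation ring with uniformizer $\pi$ and perfect residue field, and let $(A,\mathfrak n)$ be a regular local ring that is $R_0$-unramified, i.e. $R_0\subset A$ and $\pi\in\mathfrak n\setminus\mathfrak n^2$. Let $\widetilde X=\operatorname{Proj}\bigl(\bigoplus_{i\ge 0}\mathfrak n^iT^i\bigr)$ be the blowup of $X=\operatorname{Spec}A$ along $\mathfrak n$, let $E=\operatorname{Proj}(\operatorname{gr}_{\mathfrak n}A)\subset\widetilde X$ be its exceptional divisor, and let $V(\bar\pi)=\operatorname{Proj}(\operatorname{gr}_{\mathfrak n}A/\bar\pi\operatorname{gr}_{\mathfrak n}A)\subset E$, where $\bar\pi\in\mathfrak n/\mathfrak n^2$ is the class of $\pi$. Let $x\in\widetilde X$ be any point, and let $\widehat{\mathcal O}_{\widetilde X,x}$ be the completion of the local ring $\mathcal O_{\widetilde X,x}$ with respect to its maximal ideal. (a) If $x\notin V(\bar\pi)$, then $\widehat{\mathcal O}_{\widetilde X,x}$ is isomorphic, as a ring, to a power series ring in finitely many (possibly zero) variables over a field or over a discrete valuation ring. (b) If $x\in V(\bar\pi)$, then there exist a complete discrete valuation ring $S$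 and a ring homomorphism $R_0\to S$ such that the image of $\pi$ (again denoted $\pi$) is a uniformizer of $S$, an integer $d\ge 0$, and an isomorphism of $R_0$-algebras $$\widehat{\mathcal O}_{\widetilde X,x}\;\cong\;\bigl(S[[U,V]]/(UV-\pi)\bigr)[[X_1,\dots,X_d]].$$ -/

import Mathlib

open CategoryTheory AlgebraicGeometry IsLocalRing

universe u

/-! ## Graded quotients and the induced closed subschemes of `Proj` -/

section GradedQuotient

variable {B σ : Type u} [CommRing B] [SetLike σ B] [AddSubgroupClass σ B]
  (𝒜 : ℕ → σ) [GradedRing 𝒜] (J : HomogeneousIdeal 𝒜)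

/-- The grading of `B ⧸ J` for a homogeneous ideal `J` of a graded ring `B = ⨁ 𝒜 i`:
the degree `i` part is the image of `𝒜 i`. -/
def quotGrading (i : ℕ) : AddSubgroup (B ⧸ J.toIdeal) :=
  (AddSubgroup.ofClass (𝒜 i)).map (Ideal.Quotient.mk J.toIdeal).toAddMonoidHom

lemma mk_mem_quotGrading {i : ℕ} {b : B} (hb : b ∈ 𝒜 i) :
    Ideal.Quotient.mk J.toIdeal b ∈ quotGrading 𝒜 J i :=
  ⟨b, hb, rfl⟩

instance quotGrading.gradedMonoid : SetLike.GradedMonoid (quotGrading 𝒜 J) where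
  one_mem := ⟨1, SetLike.GradedOne.one_mem, map_one (Ideal.Quotient.mk J.toIdeal)⟩
  mul_mem := by
    rintro i j _ _ ⟨a, ha, rfl⟩ ⟨b, hb, rfl⟩
    exact ⟨a * b, SetLike.GradedMul.mul_mem ha hb, map_mul (Ideal.Quotient.mk J.toIdeal) _ _⟩

/-- The projection from `𝒜 i` to the degree `i` part of `B ⧸ J`. -/
def quotGradingProj (i : ℕ) : 𝒜 i →+ quotGrading 𝒜 J i where
  toFun a := ⟨Ideal.Quotient.mk J.toIdeal a, mk_mem_quotGrading 𝒜 J a.2⟩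
  map_zero' := Subtype.ext (map_zero _)
  map_add' _ _ := Subtype.ext (map_add _ _ _)

/-- The map `B ⟶ ⨁ i, (B ⧸ J) i` that decomposes and then reduces modulo `J`. -/
noncomputable def quotDecomposeAux : B →+ DirectSum ℕ fun i => quotGrading 𝒜 J i :=
  (DirectSum.map (quotGradingProj 𝒜 J)).comp (DirectSum.decomposeAddEquiv 𝒜).toAddMonoidHom

lemma quotDecomposeAux_of_mem {b : B} (hb : b ∈ J.toIdeal) : quotDecomposeAux 𝒜 J b = 0 := by
  refine DFinsupp.ext fun i => ?_
  have h : ((DirectSum.decompose 𝒜 b) i : B) ∈ J.toIdeal := J.isHomogeneous i hb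
  refine Subtype.ext ?_
  exact Ideal.Quotient.eq_zero_iff_mem.mpr h

lemma quotDecomposeAux_of_mem_grading {i : ℕ} {b : B} (hb : b ∈ 𝒜 i) :
    quotDecomposeAux 𝒜 J b =
      DirectSum.of (fun i => quotGrading 𝒜 J i) i ⟨_, mk_mem_quotGrading 𝒜 J hb⟩ := by
  change DirectSum.map (quotGradingProj 𝒜 J) (DirectSum.decompose 𝒜 b) = _
  rw [DirectSum.decompose_of_mem 𝒜 hb, DirectSum.map_of]
  rfl

/-- The decomposition of `B ⧸ J` into its graded pieces. -/
noncomputable def quotDecompose :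
    (B ⧸ J.toIdeal) →+ DirectSum ℕ fun i => quotGrading 𝒜 J i :=
  QuotientAddGroup.lift J.toIdeal.toAddSubgroup (quotDecomposeAux 𝒜 J)
    (fun _ hb => quotDecomposeAux_of_mem 𝒜 J hb)

lemma quotDecompose_mk (b : B) :
    quotDecompose 𝒜 J (Ideal.Quotient.mk J.toIdeal b) = quotDecomposeAux 𝒜 J b := rfl

noncomputable instance quotGrading.gradedRing : GradedRing (quotGrading 𝒜 J) where
  toGradedMonoid := quotGrading.gradedMonoid 𝒜 J
  toDecomposition := DirectSum.Decomposition.ofAddHom (quotGrading 𝒜 J) (quotDecompose 𝒜 J)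
    (by
      ext x
      obtain ⟨b, rfl⟩ := Ideal.Quotient.mk_surjective x
      induction b using DirectSum.Decomposition.inductionOn 𝒜 with
      | zero => simp
      | homogeneous b =>
        simp [quotDecompose_mk, quotDecomposeAux_of_mem_grading 𝒜 J b.2]
      | add a b ha hb => rw [map_add, map_add, ha, hb, map_add])
    (by
      ext i ⟨_, b, hb, rfl⟩ : 2
      simp only [AddMonoidHom.comp_apply, AddMonoidHom.id_apply,
        DirectSum.coeAddMonoidHom_of]
      exact quotDecomposeAux_of_mem_grading 𝒜 J hb)

/-- The quotient map `B ↠ B ⧸ J` as a homomorphism of graded rings. -/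
def quotGradedHom : 𝒜 →+*ᵍ quotGrading 𝒜 J where
  toRingHom := Ideal.Quotient.mk J.toIdeal
  map_mem hb := mk_mem_quotGrading 𝒜 J hb

lemma irrelevant_le_map_quotGradedHom :
    HomogeneousIdeal.irrelevant (quotGrading 𝒜 J) ≤
      (HomogeneousIdeal.irrelevant 𝒜).map (quotGradedHom 𝒜 J) := by
  refine (HomogeneousIdeal.toIdeal_irrelevant_le _).mpr ?_
  rintro i hi _ ⟨b, hb, rfl⟩
  exact Ideal.mem_map_of_mem _ (HomogeneousIdeal.mem_irrelevant_of_mem 𝒜 hi hb)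

/-- The closed immersion `Proj (B ⧸ J) ⟶ Proj B` induced by the surjection `B ↠ B ⧸ J`. -/
noncomputable def projQuotι : Proj (quotGrading 𝒜 J) ⟶ Proj 𝒜 :=
  Proj.map (quotGradedHom 𝒜 J) (irrelevant_le_map_quotGradedHom 𝒜 J)

end GradedQuotient

/-! ## The Rees algebra, the associated graded ring, and the blowup -/

section Blowup

variable {A : Type u} [CommRing A] (I : Ideal A)

/-- The grading of the Rees algebra `A[IT] = ⨁ Iⁱ Tⁱ`: the degree `i` part is `Iⁱ Tⁱ`. -/
noncomputable def reesGrading (i : ℕ) : Submodule A (reesAlgebra I) :=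
  (LinearMap.range (Polynomial.monomial (R := A) i)).comap (reesAlgebra I).val.toLinearMap

lemma mem_reesGrading {i : ℕ} {p : reesAlgebra I} :
    p ∈ reesGrading I i ↔ ∃ a, Polynomial.monomial i a = (p : Polynomial A) := Iff.rfl

instance reesGrading.gradedMonoid : SetLike.GradedMonoid (reesGrading I) where
  one_mem := ⟨1, rfl⟩
  mul_mem := by
    rintro i j p q ⟨a, ha⟩ ⟨b, hb⟩
    refine ⟨a * b, ?_⟩
    rw [← Polynomial.monomial_mul_monomial, ha, hb]
    rfl

/-- The degree `i` component of an element of the Rees algebra. -/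
noncomputable def reesComponent (i : ℕ) : reesAlgebra I →+ reesGrading I i where
  toFun p := ⟨⟨Polynomial.monomial i ((p : Polynomial A).coeff i),
    reesAlgebra.monomial_mem.mpr (p.2 i)⟩, _, rfl⟩
  map_zero' := by ext; simp
  map_add' p q := by ext; simp

lemma coe_reesComponent (i : ℕ) (p : reesAlgebra I) :
    ((reesComponent I i p : reesAlgebra I) : Polynomial A) =
      Polynomial.monomial i ((p : Polynomial A).coeff i) := rfl

/-- The decomposition of an element of the Rees algebra into its components. -/
noncomputable def reesDecompose (p : reesAlgebra I) : DirectSum ℕ fun i => reesGrading I i :=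
  ∑ i ∈ (p : Polynomial A).support, DirectSum.of (fun i => reesGrading I i) i (reesComponent I i p)

lemma reesDecompose_apply (p : reesAlgebra I) (i : ℕ) :
    reesDecompose I p i = reesComponent I i p := by
  classical
  rw [reesDecompose, DFinsupp.finsetSum_apply]
  by_cases hi : i ∈ (p : Polynomial A).support
  · rw [Finset.sum_eq_single_of_mem i hi fun j _ hj => DirectSum.of_eq_of_ne _ _ _ hj.symm]
    exact DirectSum.of_eq_same _ _
  · rw [Finset.sum_eq_zero fun j hj => DirectSum.of_eq_of_ne _ _ _ fun h => hi (by rwa [h])]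
    refine Subtype.ext (Subtype.ext ?_)
    rw [coe_reesComponent, Polynomial.notMem_support_iff.mp hi]
    simp

noncomputable instance reesGrading.gradedAlgebra : GradedAlgebra (reesGrading I) where
  toGradedMonoid := reesGrading.gradedMonoid I
  decompose' := reesDecompose I
  left_inv p := by
    refine Subtype.ext ?_
    rw [reesDecompose, map_sum]
    simp only [DirectSum.coeAddMonoidHom_of]
    rw [AddSubmonoidClass.coe_finsetSum]
    exact (Polynomial.as_sum_support (p : Polynomial A)).symm
  right_inv x := by
    refine DFinsupp.ext fun i => ?_
    rw [reesDecompose_apply]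
    induction x using DirectSum.induction_on with
    | zero => simp
    | of j y =>
      obtain ⟨p, a, ha⟩ := y
      rw [DirectSum.coeAddMonoidHom_of]
      by_cases hij : j = i
      · subst hij
        rw [DirectSum.of_eq_same]
        refine Subtype.ext (Subtype.ext ?_)
        rw [coe_reesComponent]
        change _ = (p : Polynomial A)
        change Polynomial.monomial j a = (p : Polynomial A) at ha
        rw [← ha, Polynomial.coeff_monomial_same]
      · rw [DirectSum.of_eq_of_ne _ _ _ (Ne.symm hij)]
        refine Subtype.ext (Subtype.ext ?_)
        rw [coe_reesComponent]
        change Polynomial.monomial j a = (p : Polynomial A) at ha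
        rw [← ha, Polynomial.coeff_monomial_of_ne _ (Ne.symm hij)]
        simp
    | add x y hx hy => rw [map_add, map_add, hx, hy]; rfl

/-- The blowup of `Spec A` along the ideal `I`, i.e. `Proj` of the Rees algebra `A[IT]`. -/
noncomputable def blowup : Scheme.{u} := Proj (reesGrading I)

/-- The structure morphism of the blowup. -/
noncomputable def blowupMap : blowup I ⟶ Spec (.of A) :=
  Proj.toSpecZero (reesGrading I) ≫
    Spec.map (CommRingCat.ofHom (algebraMap A (reesGrading I 0)))

/-- The canonical ring homomorphism from `A` to the local ring of the blowup at `x`. -/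
noncomputable def blowupToStalk (x : blowup I) : A →+* (blowup I).presheaf.stalk x :=
  ((Scheme.ΓSpecIso (.of A)).inv ≫ (blowupMap I).appTop ≫
    (blowup I).presheaf.germ ⊤ x trivial).hom

/-- The homogeneous ideal `I · A[IT]` of the Rees algebra. -/
noncomputable def exceptionalIdeal : HomogeneousIdeal (reesGrading I) where
  toSubmodule := I.map (algebraMap A (reesAlgebra I))
  is_homogeneous' := by
    refine Ideal.homogeneous_span _ _ ?_
    rintro _ ⟨a, _, rfl⟩
    exact ⟨0, a, rfl⟩

/-- The associated graded ring `gr_I A = ⨁ Iⁱ / Iⁱ⁺¹`, as the quotient `A[IT] / I·A[IT]`. -/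
def assocGraded : Type u := reesAlgebra I ⧸ (exceptionalIdeal I).toIdeal

noncomputable instance assocGraded.commRing : CommRing (assocGraded I) :=
  Ideal.Quotient.commRing (exceptionalIdeal I).toIdeal

/-- The grading of `gr_I A`; its degree `i` part is `Iⁱ / Iⁱ⁺¹`. -/
noncomputable def grGrading : ℕ → AddSubgroup (assocGraded I) :=
  quotGrading (reesGrading I) (exceptionalIdeal I)

noncomputable instance grGrading.gradedRing : GradedRing (grGrading I) :=
  quotGrading.gradedRing (reesGrading I) (exceptionalIdeal I)

/-- The exceptional divisor `E = Proj (gr_I A)` of the blowup. -/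
noncomputable def exceptionalDivisor : Scheme.{u} := Proj (grGrading I)

/-- The inclusion of the exceptional divisor in the blowup. -/
noncomputable def exceptionalDivisorι : exceptionalDivisor I ⟶ blowup I :=
  projQuotι (reesGrading I) (exceptionalIdeal I)

variable {I}

/-- The class in `I / I²`, the degree one part of `gr_I A`, of an element `f ∈ I`. -/
noncomputable def degreeOneClass {f : A} (hf : f ∈ I) : assocGraded I :=
  Ideal.Quotient.mk (exceptionalIdeal I).toIdeal ⟨Polynomial.monomial 1 f,
    reesAlgebra.monomial_mem.mpr (by simpa using hf)⟩

/-- The homogeneous ideal of `gr_I A` generated by the class of `f` in `I / I²`. -/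
noncomputable def hyperplaneIdeal {f : A} (hf : f ∈ I) : HomogeneousIdeal (grGrading I) where
  toSubmodule := Ideal.span {degreeOneClass hf}
  is_homogeneous' := by
    refine Ideal.homogeneous_span _ _ ?_
    rintro _ rfl
    exact ⟨1, mk_mem_quotGrading (reesGrading I) (exceptionalIdeal I) ⟨f, rfl⟩⟩

/-- The closed subscheme of the exceptional divisor given by the class `f̄ ∈ I / I²`, that is,
`Proj (gr_I A / f̄ gr_I A)`. -/
noncomputable def hyperplane {f : A} (hf : f ∈ I) : Scheme.{u} :=
  Proj (quotGrading (grGrading I) (hyperplaneIdeal hf))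

/-- The inclusion in the exceptional divisor, given by `gr_I A ↠ gr_I A / f̄ gr_I A`. -/
noncomputable def hyperplaneι {f : A} (hf : f ∈ I) : hyperplane hf ⟶ exceptionalDivisor I :=
  projQuotι (grGrading I) (hyperplaneIdeal hf)

/-- The set of points of the blowup that lie on `V(f̄)`. -/
def hyperplanePoints {f : A} (hf : f ∈ I) : Set (blowup I) :=
  Set.range (hyperplaneι hf ≫ exceptionalDivisorι I)

end Blowup

/-! ## Unramified regular local rings -/

/-- The regular local ring `(A, 𝔫)` is unramified over the discrete valuation ring `(R₀, π)`:
`R₀ ⊆ A` and `π ∈ 𝔫 ∖ 𝔫²`. -/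
structure IsUnramifiedOver (R₀ A : Type u) [CommRing R₀] [CommRing A] [IsRegularLocalRing A]
    [Algebra R₀ A] (π : R₀) : Prop where
  injective : Function.Injective (algebraMap R₀ A)
  mem : algebraMap R₀ A π ∈ maximalIdeal A
  notMem_sq : algebraMap R₀ A π ∉ maximalIdeal A ^ 2

/-! ## Complete local rings -/

/-- The completed local ring of a scheme at a point. -/
abbrev completedStalk (X : Scheme.{u}) (x : X) : Type u :=
  AdicCompletion (maximalIdeal (X.presheaf.stalk x)) (X.presheaf.stalk x)

/-- The ring `S⟦U, V⟧ / (U V - ϖ)`. -/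
abbrev nodeRing (S : Type u) [CommRing S] (ϖ : S) : Type u :=
  MvPowerSeries (Fin 2) S ⧸
    Ideal.span {(MvPowerSeries.X 0 * MvPowerSeries.X 1 - MvPowerSeries.C ϖ :
      MvPowerSeries (Fin 2) S)}

/-- The composite `S ⟶ S⟦U, V⟧ / (U V - ϖ) ⟶ (S⟦U, V⟧ / (U V - ϖ))⟦X₁, …, X_d⟧`. -/
noncomputable def nodeRing.const (S : Type u) [CommRing S] (ϖ : S) (d : ℕ) :
    S →+* MvPowerSeries (Fin d) (nodeRing S ϖ) :=
  MvPowerSeries.C.comp ((Ideal.Quotient.mk _).comp MvPowerSeries.C)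

/-!
The proof identifies the local ring `𝒪` of the blowup at `x`, shows that it is regular with a known
piece of a regular system of parameters, and then presents its completion.

**Local rings.** A point `x` is a homogeneous prime `P` of the Rees algebra `A[𝔫T]`, and `𝒪` is the
degree zero part of the localization at `P`.
* Off the exceptional divisor, `𝒪 = A_q` with `q = P ∩ A`. It is regular by Serre's theorem that
  regularity localizes (`IsRegularLocalRing.localization_atPrime`). If `π ∈ q`, then the same
  theorem for the regular ring `A / π` shows that `π` is part of a regular system of parameters of
  `A_q`. If `π ∉ q`, then `𝒪` contains the fraction field of `R₀`.
* On the exceptional divisor, choose a regular system `t, x₁, …, xₙ` of `A` such that `tT ∉ P`, and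
  put `yᵢ = xᵢ / t`. Then `𝒪` is the quotient of the localization `B` of `A[Y₁, …, Yₙ]` at a prime
  by the relations `t Yᵢ - xᵢ` (`exists_chart_model`). As `B` is flat over `A` with a regular fibre,
  these relations are part of a regular system of parameters of `B`, and `𝒪` is regular with
  parameter `t` (`exists_isRegularSystem_chart`). If `πT ∉ P` one may take `t = π`. If `πT ∈ P`,
  that is `x ∈ V(π̄)`, one may take `π = xⱼ`; then `π = t u` with `u = yⱼ`, and `t, u` are both part
  of a regular system of parameters of `𝒪`, since the partial derivative of `Yⱼ` by itself is
  nonzero (`exists_isRegularSystem_chart_pair`).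

**Completions.** Extensions of a perfect field are formally smooth
(`formallySmooth_of_perfectField`), so a one-dimensional regular local ring `S` over `R₀` with
uniformizer `π` and with the residue field of `𝒪` maps to the completion of `𝒪`, by lifting through
the powers of the maximal ideal (`exists_lift_adicCompletion`). Such an `S` is obtained by killing
part of a regular system of parameters, in `𝒪` or in `B`, and completing. A homomorphism from a
power series ring, or from `(S⟦U, V⟧ / (UV - π))⟦X₁, …, X_d⟧`, to the completion of `𝒪` that takes the
obvious generators of the maximal ideal to a regular system of parameters is bijective: it is
surjective by completeness, and injective because a regular system of parameters is quasi-regular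
(`IsRegularSystem.bijective_of_isPrecomplete`).
-/


/-! ### Regular systems of parameters -/

/-- A finite family `y` of elements of a local ring is a *regular system of parameters* if it
generates the maximal ideal and has as many members as the Krull dimension of the ring. -/
structure IsRegularSystem {O : Type*} [CommRing O] [IsLocalRing O] {ι : Type*} [Fintype ι]
    (y : ι → O) : Prop where
  span_range : Ideal.span (Set.range y) = maximalIdeal O
  dim_eq : ringKrullDim O = Fintype.card ι

namespace IsRegularSystem

variable {O : Type*} [CommRing O] [IsLocalRing O] {ι κ : Type*} [Fintype ι] [Fintype κ]

lemma mem {y : ι → O} (hy : IsRegularSystem y) (i : ι) : y i ∈ maximalIdeal O :=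
  hy.span_range ▸ Ideal.subset_span ⟨i, rfl⟩

/-- If the maximal ideal is generated by at most `dim O` elements then these form a regular
system of parameters. -/
lemma of_card_le [IsNoetherianRing O] {y : ι → O}
    (hy : Ideal.span (Set.range y) = maximalIdeal O)
    (h : (Fintype.card ι : WithBot ℕ∞) ≤ ringKrullDim O) : IsRegularSystem y := by
  refine ⟨hy, le_antisymm ?_ h⟩
  refine (ringKrullDim_le_spanFinrank_maximalIdeal O).trans ?_
  rw [← hy]
  have h1 := Submodule.spanFinrank_span_le_ncard_of_finite (R := O) (Set.finite_range y)
  have h2 : (Set.range y).ncard ≤ Fintype.card ι := by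
    rw [← Set.image_univ, ← Nat.card_eq_fintype_card, ← Set.ncard_univ]
    exact Set.ncard_image_le Set.finite_univ
  exact_mod_cast h1.trans h2

lemma isRegularLocalRing [IsNoetherianRing O] {y : ι → O} (hy : IsRegularSystem y) :
    IsRegularLocalRing O := by
  refine IsRegularLocalRing.of_spanFinrank_maximalIdeal_le O ?_
  rw [hy.dim_eq, ← hy.span_range]
  have h1 := Submodule.spanFinrank_span_le_ncard_of_finite (R := O) (Set.finite_range y)
  have h2 : (Set.range y).ncard ≤ Fintype.card ι := by
    rw [← Set.image_univ, ← Nat.card_eq_fintype_card, ← Set.ncard_univ]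
    exact Set.ncard_image_le Set.finite_univ
  exact_mod_cast h1.trans h2

/-- Another family with as many members generating the maximal ideal is a regular system. -/
lemma congr {y : ι → O} (hy : IsRegularSystem y) {z : κ → O}
    (hz : Ideal.span (Set.range z) = Ideal.span (Set.range y))
    (hc : Fintype.card κ = Fintype.card ι) : IsRegularSystem z :=
  ⟨hz.trans hy.span_range, by rw [hy.dim_eq, hc]⟩

lemma comp_equiv {y : ι → O} (hy : IsRegularSystem y) (e : κ ≃ ι) :
    IsRegularSystem (y ∘ e) :=
  hy.congr (by rw [e.surjective.range_comp]) (Fintype.card_congr e)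

lemma map_ringEquiv {O' : Type*} [CommRing O'] [IsLocalRing O'] {y : ι → O}
    (hy : IsRegularSystem y) (e : O ≃+* O') : IsRegularSystem (e ∘ y) := by
  refine ⟨?_, by rw [← ringKrullDim_eq_of_ringEquiv e, hy.dim_eq]⟩
  rw [Set.range_comp, ← map_ringEquiv_maximalIdeal e, ← hy.span_range]
  exact (Ideal.map_span (e : O →+* O') _).symm

end IsRegularSystem

lemma IsRegularLocalRing.exists_isRegularSystem (O : Type*) [CommRing O] [IsRegularLocalRing O] :
    ∃ (d : ℕ) (y : Fin d → O), IsRegularSystem y := by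
  have fg := (maximalIdeal O).fg_of_isNoetherianRing
  have hfin := Submodule.FG.finite_generators fg
  have hcard := Submodule.FG.generators_ncard fg
  let e := hfin.fintype
  refine ⟨Fintype.card (maximalIdeal O).generators,
    fun i => ((Fintype.equivFin (maximalIdeal O).generators).symm i : O), ?_, ?_⟩
  · change Ideal.span (Set.range (Subtype.val ∘ _)) = _
    rw [(Equiv.surjective _).range_comp, Subtype.range_coe]
    exact Submodule.span_generators _
  · rw [← IsRegularLocalRing.spanFinrank_maximalIdeal, ← hcard, Fintype.card_fin,
      ← Nat.card_eq_fintype_card, Nat.card_coe_set_eq]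

/-- An element of `𝔪 ∖ 𝔪²` can be completed to a regular system of parameters. -/
lemma IsRegularLocalRing.exists_isRegularSystem_option {O : Type*} [CommRing O]
    [IsRegularLocalRing O] {x : O} (hx : x ∈ maximalIdeal O) (hx2 : x ∉ maximalIdeal O ^ 2) :
    ∃ (d : ℕ) (z : Fin d → O), IsRegularSystem (fun o : Option (Fin d) => o.elim x z) := by
  obtain ⟨d, y, hy⟩ := IsRegularLocalRing.exists_isRegularSystem O
  classical
  -- Write `x = ∑ cᵢ yᵢ`; some `cᵢ` is a unit, and `x` may replace the corresponding `yᵢ`.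
  have hxs := hx
  rw [← hy.span_range, Ideal.mem_span_range_iff_exists_fun] at hxs
  obtain ⟨c, hc⟩ := hxs
  obtain ⟨i, hi⟩ : ∃ i, IsUnit (c i) := by
    by_contra! h
    refine hx2 (hc ▸ Ideal.sum_mem _ fun i _ => ?_)
    rw [pow_two]
    exact Ideal.mul_mem_mul ((mem_maximalIdeal _).2 (h i)) (hy.mem i)
  cases d with
  | zero => exact i.elim0
  | succ d =>
    refine ⟨d, fun j => y (i.succAbove j), hy.congr (le_antisymm ?_ ?_) (by simp)⟩
    · rw [Ideal.span_le, hy.span_range]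
      rintro _ ⟨_ | j, rfl⟩
      · exact hx
      · exact hy.mem _
    · rw [Ideal.span_le]
      set J := Ideal.span (Set.range fun o : Option (Fin d) =>
        o.elim x fun j => y (i.succAbove j)) with hJ
      have h1 : ∀ j, j ≠ i → y j ∈ J := by
        intro j hj
        obtain ⟨k, rfl⟩ := Fin.exists_succAbove_eq hj
        exact Ideal.subset_span ⟨some k, rfl⟩
      rintro _ ⟨j, rfl⟩
      by_cases hj : j = i
      · subst hj
        rw [Fin.sum_univ_succAbove _ j] at hc
        have : c j * y j ∈ J := by
          rw [← eq_sub_iff_add_eq] at hc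
          rw [hc]
          exact J.sub_mem (Ideal.subset_span ⟨none, rfl⟩)
            (Ideal.sum_mem _ fun k _ => J.mul_mem_left _ (h1 _ (Fin.succAbove_ne _ _)))
        exact (Ideal.unit_mul_mem_iff_mem J hi).1 this
      · exact h1 j hj

namespace IsRegularSystem

variable {O : Type*} [CommRing O] [IsLocalRing O] {ι κ : Type*} [Fintype ι] [Fintype κ]

lemma isLocalRing_quotient {I : Ideal O} (hI : I ≤ maximalIdeal O) : IsLocalRing (O ⧸ I) :=
  have : Nontrivial (O ⧸ I) := Ideal.Quotient.nontrivial_iff.2 fun h =>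
    (maximalIdeal.isMaximal O).ne_top (top_le_iff.1 (h ▸ hI))
  .of_surjective' _ Ideal.Quotient.mk_surjective

lemma map_maximalIdeal_quotient {I : Ideal O} [IsLocalRing (O ⧸ I)] :
    (maximalIdeal O).map (Ideal.Quotient.mk I) = maximalIdeal (O ⧸ I) :=
  have := IsLocalHom.of_surjective _ (Ideal.Quotient.mk_surjective (I := I))
  ((local_hom_TFAE (Ideal.Quotient.mk I)).out 0 4).1 this ▸
    Ideal.map_comap_of_surjective _ Ideal.Quotient.mk_surjective _

lemma span_le_maximalIdeal {a : ι → O} {b : κ → O} (h : IsRegularSystem (Sum.elim a b)) :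
    Ideal.span (Set.range a) ≤ maximalIdeal O := by
  rw [Ideal.span_le]
  rintro _ ⟨i, rfl⟩
  exact h.mem (Sum.inl i)

/-- Dividing by part of a regular system leaves the rest as a regular system. -/
lemma quotient [IsNoetherianRing O] {a : ι → O} {b : κ → O}
    (h : IsRegularSystem (Sum.elim a b)) [IsLocalRing (O ⧸ Ideal.span (Set.range a))] :
    IsRegularSystem (fun k => Ideal.Quotient.mk (Ideal.span (Set.range a)) (b k)) := by
  apply of_card_le
  · rw [← map_maximalIdeal_quotient, ← h.span_range, Set.Sum.elim_range, Ideal.span_union,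
      Ideal.map_sup, Ideal.map_quotient_self, bot_sup_eq, Ideal.map_span, ← Set.range_comp]
    rfl
  · have h1 := ringKrullDim_le_ringKrullDim_quotient_add_spanFinrank (Ideal.span (Set.range a))
      (by rw [IsLocalRing.ringJacobson_eq_maximalIdeal]; exact h.span_le_maximalIdeal)
    have h2 : (Ideal.span (Set.range a)).spanFinrank ≤ Fintype.card ι := by
      refine (Submodule.spanFinrank_span_le_ncard_of_finite (R := O) (Set.finite_range a)).trans ?_
      rw [← Set.image_univ, ← Nat.card_eq_fintype_card, ← Set.ncard_univ]
      exact Set.ncard_image_le Set.finite_univ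
    rw [h.dim_eq, Fintype.card_sum, add_comm (Fintype.card ι), Nat.cast_add] at h1
    refine ENat.WithBot.add_le_add_natCast_right_iff.1 (h1.trans (add_le_add_right ?_ _))
    exact_mod_cast h2

/-- Dividing by one member of a regular system leaves the rest as a regular system. -/
lemma quotient_singleton [IsNoetherianRing O] {x : O} {b : κ → O}
    (h : IsRegularSystem (fun o : Option κ => o.elim x b))
    [IsLocalRing (O ⧸ Ideal.span {x})] :
    IsRegularSystem (fun k => Ideal.Quotient.mk (Ideal.span {x}) (b k)) := by
  have e : Set.range (fun _ : Unit => x) = {x} := Set.range_const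
  have h' : IsRegularSystem (Sum.elim (fun _ : Unit => x) b) :=
    h.congr (by
      congr 1
      ext z
      simp [Option.exists, eq_comm]) (by simp [add_comm])
  revert ‹IsLocalRing (O ⧸ Ideal.span {x})›
  rw [← e]
  intro _
  exact h'.quotient

end IsRegularSystem

/-- In a Noetherian local ring with `𝔪 ≠ 0`, prime avoidance gives an element of `𝔪 ∖ 𝔪²` outside
any finite set of primes different from `𝔪`. -/
lemma exists_mem_maximalIdeal_notMem_sq {O : Type*} [CommRing O] [IsLocalRing O]
    [IsNoetherianRing O] (h0 : maximalIdeal O ≠ ⊥) {s : Set (Ideal O)} (hs : s.Finite)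
    (hp : ∀ p ∈ s, p.IsPrime) (hm : ∀ p ∈ s, p ≠ maximalIdeal O) :
    ∃ x ∈ maximalIdeal O, x ∉ maximalIdeal O ^ 2 ∧ ∀ p ∈ s, x ∉ p := by
  classical
  by_contra! hcon
  have hsub : (maximalIdeal O : Set O) ⊆
      ⋃ i ∈ (↑(insert (maximalIdeal O ^ 2) hs.toFinset : Finset (Ideal O)) : Set (Ideal O)),
        (i : Set O) := by
    intro x hx
    by_cases h2 : x ∈ maximalIdeal O ^ 2
    · exact Set.mem_biUnion (x := maximalIdeal O ^ 2) (by simp) h2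
    · obtain ⟨p, hps, hxp⟩ := hcon x hx h2
      exact Set.mem_biUnion (x := p) (by simp [hps]) hxp
  rw [Ideal.subset_union_prime (f := fun i => i) (maximalIdeal O ^ 2) (maximalIdeal O ^ 2)] at hsub
  · obtain ⟨i, hi, hle⟩ := hsub
    simp only [Finset.mem_insert, Set.Finite.mem_toFinset] at hi
    rcases hi with rfl | hi
    · refine h0 (Submodule.eq_bot_of_le_smul_of_le_jacobson_bot (maximalIdeal O) _
        (maximalIdeal O).fg_of_isNoetherianRing ?_ (maximalIdeal_le_jacobson _))
      rwa [smul_eq_mul, ← pow_two]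
    · have := hp i hi
      exact hm i hi (le_antisymm (le_maximalIdeal this.ne_top) hle)
  · intro i hi h1 _
    simp only [Finset.mem_insert, Set.Finite.mem_toFinset] at hi
    rcases hi with rfl | hi
    · exact absurd rfl h1
    · exact hp i hi

/-- A regular local ring is a domain: for `x ∈ 𝔪 ∖ 𝔪²` outside the minimal primes the quotient by
`x` is regular of smaller dimension, so `(x)` is prime, and a minimal prime `p ⊆ (x)` satisfies
`p = x p`. -/
theorem IsRegularLocalRing.isDomain (O : Type*) [CommRing O] [IsRegularLocalRing O] :
    IsDomain O := by
  obtain ⟨d, y, hy⟩ := IsRegularLocalRing.exists_isRegularSystem O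
  have hd := hy.dim_eq
  rw [Fintype.card_fin] at hd
  clear hy y
  induction d generalizing O with
  | zero =>
    obtain ⟨d, y, hy⟩ := IsRegularLocalRing.exists_isRegularSystem O
    have h := hy.dim_eq
    rw [hd, Fintype.card_fin] at h
    obtain rfl : d = 0 := by exact_mod_cast h.symm
    have h0 : maximalIdeal O = ⊥ := by rw [← hy.span_range]; simp
    exact (isField_iff_maximalIdeal_eq.2 h0).isDomain
  | succ d ih =>
    have hdim0 : ringKrullDim O ≠ 0 := by
      rw [hd]; exact_mod_cast Nat.succ_ne_zero d
    have hht : ∀ p ∈ minimalPrimes O, p ≠ maximalIdeal O := by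
      rintro p hp rfl
      refine hdim0 ?_
      rw [← maximalIdeal_height_eq_ringKrullDim]
      exact_mod_cast Ideal.height_eq_zero_iff.2 hp
    have h0 : maximalIdeal O ≠ ⊥ := by
      intro h
      exact hdim0 (ringKrullDim_eq_zero_of_isField (isField_iff_maximalIdeal_eq.2 h))
    obtain ⟨x, hx, hx2, hxp⟩ := exists_mem_maximalIdeal_notMem_sq h0
      (minimalPrimes.finite_of_isNoetherianRing O) (fun p hp => hp.1.1) hht
    obtain ⟨e, z, hz⟩ := IsRegularLocalRing.exists_isRegularSystem_option hx hx2
    have hloc : IsLocalRing (O ⧸ Ideal.span {x}) :=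
      IsRegularSystem.isLocalRing_quotient ((Ideal.span_singleton_le_iff_mem _).2 hx)
    have hz' := hz.quotient_singleton
    have hreg := hz'.isRegularLocalRing
    have he : e = d := by
      have := hz.dim_eq
      rw [hd] at this
      simp only [Fintype.card_option, Fintype.card_fin] at this
      have h3 : d + 1 = e + 1 := by exact_mod_cast this
      omega
    have hdom := ih (O ⧸ Ideal.span {x}) (by rw [hz'.dim_eq, Fintype.card_fin, he])
    have hprime : (Ideal.span {x}).IsPrime := (Ideal.Quotient.isDomain_iff_prime _).1 hdom
    obtain ⟨p, hp, hpx⟩ := Ideal.exists_minimalPrimes_le (I := ⊥) (J := Ideal.span {x}) bot_le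
    have hpprime : p.IsPrime := hp.1.1
    have hpbot : p = ⊥ := by
      refine Submodule.eq_bot_of_le_smul_of_le_jacobson_bot (maximalIdeal O) _
        p.fg_of_isNoetherianRing ?_ (maximalIdeal_le_jacobson _)
      intro a ha
      obtain ⟨b, rfl⟩ := Ideal.mem_span_singleton'.1 (hpx ha)
      have hb : b ∈ p := (hpprime.mem_or_mem ha).resolve_right (hxp p hp)
      rw [mul_comm]
      exact Submodule.smul_mem_smul hx hb
    exact IsDomain.of_bot_isPrime O (hbp := hpbot ▸ hpprime)

namespace IsRegularSystem

variable {O : Type*} [CommRing O] [IsLocalRing O] [IsNoetherianRing O] {ι κ : Type*}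
  [Fintype ι] [Fintype κ]

lemma isDomain {y : ι → O} (hy : IsRegularSystem y) : IsDomain O :=
  have := hy.isRegularLocalRing
  IsRegularLocalRing.isDomain O

lemma ne_zero_option {x : O} {b : κ → O}
    (h : IsRegularSystem (fun o : Option κ => o.elim x b)) : x ≠ 0 := by
  intro hx
  have hloc : IsLocalRing (O ⧸ Ideal.span {x}) :=
    isLocalRing_quotient ((Ideal.span_singleton_le_iff_mem _).2 (h.mem none))
  have h1 := h.quotient_singleton.dim_eq
  have h2 := ringKrullDim_eq_of_ringEquiv
    (Ideal.quotEquivOfEq (show Ideal.span {x} = ⊥ by simp [hx]))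
  rw [ringKrullDim_eq_of_ringEquiv (RingEquiv.quotientBot O), h1, h.dim_eq] at h2
  have : Fintype.card κ = Fintype.card (Option κ) := by exact_mod_cast h2
  simp at this

/-- If `x` is regular and `b` lifts a regular system of `O ⧸ x`, then `x, b` is a regular
system. -/
lemma option_of_quotient {x : O} (hx : x ∈ nonZeroDivisors O) (hxm : x ∈ maximalIdeal O)
    {b : κ → O} [IsLocalRing (O ⧸ Ideal.span {x})]
    (h : IsRegularSystem (fun k => Ideal.Quotient.mk (Ideal.span {x}) (b k))) :
    IsRegularSystem (fun o : Option κ => o.elim x b) := by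
  have hb : ∀ k, b k ∈ maximalIdeal O := fun k => by
    have := h.mem k
    have hl := IsLocalHom.of_surjective _ (Ideal.Quotient.mk_surjective (I := Ideal.span {x}))
    exact ((mem_maximalIdeal _).2 fun hu => (mem_maximalIdeal _).1 this (hu.map _))
  refine of_card_le (le_antisymm ?_ ?_) ?_
  · rw [Ideal.span_le]
    rintro _ ⟨_ | k, rfl⟩
    exacts [hxm, hb k]
  · intro a ha
    have h1 : Ideal.Quotient.mk (Ideal.span {x}) a ∈
        Ideal.span (Set.range fun k => Ideal.Quotient.mk (Ideal.span {x}) (b k)) := by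
      rw [h.span_range, ← map_maximalIdeal_quotient]
      exact Ideal.mem_map_of_mem _ ha
    rw [Ideal.mem_span_range_iff_exists_fun] at h1
    obtain ⟨c, hc⟩ := h1
    choose c' hc' using fun k => Ideal.Quotient.mk_surjective (c k)
    have h2 : Ideal.Quotient.mk (Ideal.span {x}) (∑ k, c' k * b k) =
        Ideal.Quotient.mk (Ideal.span {x}) a := by
      rw [← hc, map_sum]
      simp [hc']
    rw [Ideal.Quotient.eq, Ideal.mem_span_singleton'] at h2
    obtain ⟨r, hr⟩ := h2
    have : a = ∑ k, c' k * b k - r * x := by rw [hr]; ring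
    rw [this]
    refine Ideal.sub_mem _ (Ideal.sum_mem _ fun k _ => Ideal.mul_mem_left _ _ ?_)
      (Ideal.mul_mem_left _ _ (Ideal.subset_span ⟨none, rfl⟩))
    exact Ideal.subset_span ⟨some k, rfl⟩
  · have h1 := ringKrullDim_quotient_succ_le_of_nonZeroDivisor hx
    rw [h.dim_eq] at h1
    rw [Fintype.card_option]
    exact_mod_cast h1

end IsRegularSystem

/-! ### Regular systems of parameters are quasi-regular -/

section QuasiRegular

open MvPolynomial

/-- The value of a form of degree `n` with coefficients in `I` at a point with coordinates in `J`
lies in `I Jⁿ`. -/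
lemma MvPolynomial.IsHomogeneous.eval_mem {R ι : Type*} [CommRing R] {F : MvPolynomial ι R} {n : ℕ}
    (hF : F.IsHomogeneous n) {I J : Ideal R} (hI : ∀ e, F.coeff e ∈ I) {y : ι → R}
    (hy : ∀ i, y i ∈ J) : eval y F ∈ I * J ^ n := by
  rw [eval_eq]
  refine Ideal.sum_mem _ fun e he => Ideal.mul_mem_mul (hI e) ?_
  have hdeg : e.degree = n := by
    by_contra h
    exact (mem_support_iff.1 he) (hF.coeff_eq_zero h)
  have h1 : ∏ i ∈ e.support, y i ^ e i ∈ ∏ i ∈ e.support, J ^ e i :=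
    Ideal.prod_mem_prod fun i _ => Ideal.pow_mem_pow (hy i) _
  rwa [Finset.prod_pow_eq_pow_sum, ← Finsupp.degree_apply, hdeg] at h1

/-- Splitting off the multiples of `X i` from a form. -/
lemma MvPolynomial.IsHomogeneous.exists_eq_X_mul_add {R ι : Type*} [CommRing R] [DecidableEq ι]
    {F : MvPolynomial ι R} {n : ℕ} (hF : F.IsHomogeneous (n + 1)) {i : ι} {s : Finset ι}
    (hs : ∀ e, (∃ j ∉ insert i s, e j ≠ 0) → F.coeff e = 0) :
    ∃ G H : MvPolynomial ι R, F = X i * H + G ∧ G.IsHomogeneous (n + 1) ∧ H.IsHomogeneous n ∧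
      (∀ e, (∃ j ∉ s, e j ≠ 0) → G.coeff e = 0) ∧
      (∀ e, (∃ j ∉ insert i s, e j ≠ 0) → H.coeff e = 0) ∧
      (∀ e, G.coeff e = 0 ∨ G.coeff e = F.coeff e) ∧
      (∀ e, F.coeff e = G.coeff e ∨ ∃ e', F.coeff e = H.coeff e') := by
  refine ⟨F.modMonomial (Finsupp.single i 1), F.divMonomial (Finsupp.single i 1),
    (divMonomial_add_modMonomial_single F i).symm, ?_, ?_, ?_, ?_, ?_, ?_⟩
  · intro e he
    by_cases hle : Finsupp.single i 1 ≤ e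
    · exact absurd (coeff_modMonomial_of_le _ hle) he
    · rw [coeff_modMonomial_of_not_le _ hle] at he
      exact hF he
  · intro e he
    rw [coeff_divMonomial] at he
    have := hF he
    simp only [map_add] at this
    simp [Finsupp.weight_single] at this
    omega
  · rintro e ⟨j, hj, hej⟩
    by_cases hle : Finsupp.single i 1 ≤ e
    · exact coeff_modMonomial_of_le _ hle
    · rw [coeff_modMonomial_of_not_le _ hle]
      by_cases hji : j = i
      · subst hji
        exact absurd (by simpa [Finsupp.single_le_iff] using Nat.one_le_iff_ne_zero.2 hej) hle
      · exact hs e ⟨j, by simp [hji, hj], hej⟩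
  · rintro e ⟨j, hj, hej⟩
    rw [coeff_divMonomial]
    exact hs _ ⟨j, hj, by simp [hej]⟩
  · intro e
    by_cases hle : Finsupp.single i 1 ≤ e
    · exact Or.inl (coeff_modMonomial_of_le _ hle)
    · exact Or.inr (coeff_modMonomial_of_not_le _ hle)
  · intro e
    by_cases hle : Finsupp.single i 1 ≤ e
    · refine Or.inr ⟨e - Finsupp.single i 1, ?_⟩
      rw [coeff_divMonomial, add_tsub_cancel_of_le hle]
    · exact Or.inl (coeff_modMonomial_of_not_le _ hle).symm

/-- Elements of `Iⁿ` are values of forms of degree `n`, for `I` generated by a subfamily. -/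
lemma exists_form_of_mem_span_pow {R ι : Type*} [CommRing R] {s : Finset ι} {y : ι → R} {n : ℕ}
    {a : R} (ha : a ∈ Ideal.span (Set.range fun i : s => y i) ^ n) :
    ∃ F : MvPolynomial ι R, F.IsHomogeneous n ∧ (∀ e, (∃ j ∉ s, e j ≠ 0) → F.coeff e = 0) ∧
      eval y F = a := by
  classical
  rw [Ideal.mem_span_pow_iff_exists_isHomogeneous] at ha
  obtain ⟨p, hp, rfl⟩ := ha
  refine ⟨rename Subtype.val p, hp.rename_isHomogeneous, ?_, by rw [eval_rename]; rfl⟩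
  rintro e ⟨j, hj, hej⟩
  by_contra h
  obtain ⟨u, hu, -⟩ := coeff_rename_ne_zero _ _ _ h
  refine hej ?_
  rw [← hu, Finsupp.mapDomain_of_notMem_range]
  simpa using hj

/-- If forms in the parameters `s` are quasi-regular modulo the first parameter `x`, then
multiplication by `x` raises the order by exactly one: this is the step where the Krull
intersection theorem enters. -/
lemma mem_pow_of_mul_mem_pow {O ι : Type*} [CommRing O] [IsLocalRing O] [IsNoetherianRing O]
    [IsDomain O] [DecidableEq ι] {i : ι} {s : Finset ι} {y : ι → O} (hxne : y i ≠ 0)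
    (hspan : Ideal.span (Set.range fun j : (insert i s : Finset ι) => y j) = maximalIdeal O)
    (hy : ∀ j, y j ∈ maximalIdeal O)
    (ih : ∀ (n : ℕ) (G : MvPolynomial ι O), G.IsHomogeneous n →
      (∀ e, (∃ j ∉ s, e j ≠ 0) → G.coeff e = 0) → eval y G ∈ Ideal.span {y i} →
      ∀ e, G.coeff e ∈ maximalIdeal O)
    {n : ℕ} {z : O} (hz : y i * z ∈ maximalIdeal O ^ (n + 1)) : z ∈ maximalIdeal O ^ n := by
  have key : ∀ N, ∃ h ∈ maximalIdeal O ^ n,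
      y i * z - y i * h ∈ maximalIdeal O ^ (n + 1 + N) := by
    intro N
    induction N with
    | zero => exact ⟨0, zero_mem _, by simpa using hz⟩
    | succ N IH =>
      obtain ⟨h, hh, hw⟩ := IH
      rw [← hspan] at hw
      obtain ⟨F, hF, hFs, hFe⟩ := exists_form_of_mem_span_pow hw
      rw [show n + 1 + N = (n + N) + 1 by ring] at hF
      obtain ⟨G, H, hFGH, hG, hH, hGs, -, -, -⟩ := hF.exists_eq_X_mul_add hFs
      have hHe : eval y H ∈ maximalIdeal O ^ n := by
        have := hH.eval_mem (I := ⊤) (fun _ => trivial) hy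
        rw [Ideal.top_mul] at this
        exact Ideal.pow_le_pow_right (Nat.le_add_right _ _) this
      refine ⟨h + eval y H, Ideal.add_mem _ hh hHe, ?_⟩
      have h1 : y i * z - y i * (h + eval y H) = eval y G := by
        rw [hFGH] at hFe
        simp only [map_add, map_mul, eval_X] at hFe
        linear_combination -hFe
      rw [h1]
      have h2 : eval y G ∈ Ideal.span {y i} := by
        rw [← h1, Ideal.mem_span_singleton']
        exact ⟨z - (h + eval y H), by ring⟩
      have := hG.eval_mem (ih _ G hG hGs h2) hy
      rw [← pow_succ'] at this
      convert this using 2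
      ring
  have hmem : y i * z ∈ Ideal.span {y i} * maximalIdeal O ^ n := by
    rw [← Ideal.Quotient.eq_zero_iff_mem]
    refine (inferInstance : IsHausdorff (maximalIdeal O)
      (O ⧸ (Ideal.span {y i} * maximalIdeal O ^ n))).haus _ fun N => ?_
    obtain ⟨h, hh, hw⟩ := key N
    rw [SModEq.zero]
    have h1 : (Ideal.Quotient.mk (Ideal.span {y i} * maximalIdeal O ^ n)) (y i * z) =
        (y i * z - y i * h) • 1 := by
      have h2 : y i * h ∈ Ideal.span {y i} * maximalIdeal O ^ n :=
        Ideal.mul_mem_mul (Ideal.mem_span_singleton_self _) hh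
      rw [Algebra.smul_def, mul_one, Ideal.Quotient.algebraMap_eq, map_sub,
        Ideal.Quotient.eq_zero_iff_mem.2 h2, sub_zero]
    rw [h1]
    exact Submodule.smul_mem_smul (Ideal.pow_le_pow_right (by omega) hw) trivial
  rw [Ideal.mem_span_singleton_mul] at hmem
  obtain ⟨h, hh, heq⟩ := hmem
  rwa [← mul_left_cancel₀ hxne heq]

/-- Quasi-regularity for a family `y` whose members in `s` form a regular system of parameters;
the induction on `s` divides by one parameter at a time and keeps the index type fixed. -/
lemma coeff_mem_maximalIdeal_of_eval_mem_aux {ι : Type*} [DecidableEq ι] (s : Finset ι) :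
    ∀ {O : Type u} [CommRing O] [IsLocalRing O] [IsNoetherianRing O] {y : ι → O},
      IsRegularSystem (fun i : s => y i) → (∀ i, y i ∈ maximalIdeal O) →
      ∀ (n : ℕ) (F : MvPolynomial ι O), F.IsHomogeneous n →
        (∀ e, (∃ j ∉ s, e j ≠ 0) → F.coeff e = 0) → eval y F ∈ maximalIdeal O ^ (n + 1) →
        ∀ e, F.coeff e ∈ maximalIdeal O := by
  induction s using Finset.induction_on with
  | empty =>
    intro O _ _ _ y _ hym n F hF hFs hFe e
    have hF0 : ∀ e, e ≠ 0 → F.coeff e = 0 := fun e he => by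
      obtain ⟨j, hj⟩ := Finsupp.ne_iff.1 he
      exact hFs e ⟨j, by simp, by simpa using hj⟩
    by_cases he : e = 0
    · subst he
      have : F = C (F.coeff 0) := by
        ext e'
        rw [coeff_C]
        split_ifs with h
        · rw [h]
        · exact hF0 e' (Ne.symm h)
      rw [this, eval_C] at hFe
      exact Ideal.pow_le_self (Nat.succ_ne_zero n) hFe
    · rw [hF0 e he]
      exact zero_mem _
  | insert i s hi ih =>
    intro O _ _ _ y hy hym n
    have hdom := hy.isDomain
    have hy' : IsRegularSystem (fun o : Option s => o.elim (y i) fun j => y j) := by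
      refine (hy.comp_equiv (Finset.subtypeInsertEquivOption hi).symm).congr ?_ rfl
      congr 2
      ext o
      cases o <;> rfl
    have hxm : Ideal.span {y i} ≤ maximalIdeal O :=
      (Ideal.span_singleton_le_iff_mem _).2 (hym i)
    have hloc : IsLocalRing (O ⧸ Ideal.span {y i}) := IsRegularSystem.isLocalRing_quotient hxm
    have hmap : (maximalIdeal O).map (Ideal.Quotient.mk (Ideal.span {y i})) =
        maximalIdeal (O ⧸ Ideal.span {y i}) := IsRegularSystem.map_maximalIdeal_quotient
    have hq := hy'.quotient_singleton
    -- quasi-regularity of the parameters in `s` modulo `y i`, read in `O`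
    have ihO : ∀ (n : ℕ) (G : MvPolynomial ι O), G.IsHomogeneous n →
        (∀ e, (∃ j ∉ s, e j ≠ 0) → G.coeff e = 0) →
        Ideal.Quotient.mk (Ideal.span {y i}) (eval y G) ∈
          maximalIdeal (O ⧸ Ideal.span {y i}) ^ (n + 1) →
        ∀ e, G.coeff e ∈ maximalIdeal O := by
      intro n G hG hGs hGe e
      have h1 := ih (y := fun j => Ideal.Quotient.mk (Ideal.span {y i}) (y j)) hq
        (fun j => hmap ▸ Ideal.mem_map_of_mem _ (hym j)) n
        (G.map (Ideal.Quotient.mk (Ideal.span {y i}))) (hG.map _)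
        (fun e he => by rw [coeff_map, hGs e he, map_zero]) (by
          rw [MvPolynomial.eval_map]
          convert hGe using 1
          exact (eval₂_comp _ _ _).symm) e
      rw [coeff_map] at h1
      exact (mem_maximalIdeal _).2 fun hu => (mem_maximalIdeal _).1 h1 (hu.map _)
    induction n with
    | zero =>
      intro F hF hFs hFe e
      have hF0 := totalDegree_eq_zero_iff_eq_C.1 (Nat.le_zero.1 hF.totalDegree_le)
      rw [hF0, eval_C, zero_add, pow_one] at hFe
      rw [hF0, coeff_C]
      split_ifs
      exacts [hFe, zero_mem _]
    | succ n IH =>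
      intro F hF hFs hFe
      obtain ⟨G, H, hFGH, hG, hH, hGs, hHs, hGF, hFc⟩ := hF.exists_eq_X_mul_add hFs
      have hev : eval y F = y i * eval y H + eval y G := by
        conv_lhs => rw [hFGH]
        simp
      have hGm : ∀ e, G.coeff e ∈ maximalIdeal O := by
        refine ihO (n + 1) G hG hGs ?_
        have h1 : Ideal.Quotient.mk (Ideal.span {y i}) (eval y G) =
            Ideal.Quotient.mk (Ideal.span {y i}) (eval y F) := by
          rw [Ideal.Quotient.eq, hev, Ideal.mem_span_singleton']
          exact ⟨-eval y H, by ring⟩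
        rw [h1, ← hmap, ← Ideal.map_pow]
        exact Ideal.mem_map_of_mem _ hFe
      have hGe : eval y G ∈ maximalIdeal O ^ (n + 1 + 1) := by
        have := hG.eval_mem hGm hym
        rwa [← pow_succ'] at this
      have hHe : eval y H ∈ maximalIdeal O ^ (n + 1) := by
        refine mem_pow_of_mul_mem_pow hy'.ne_zero_option hy.span_range hym ?_
          (z := eval y H) (n := n + 1) ?_
        · intro n G hG hGs hGe
          refine ihO n G hG hGs ?_
          rw [Ideal.Quotient.eq_zero_iff_mem.2 hGe]
          exact zero_mem _
        · rw [eq_sub_of_add_eq hev.symm]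
          exact Ideal.sub_mem _ hFe hGe
      have hHm := IH H hH hHs hHe
      intro e
      rcases hFc e with h | ⟨e', h⟩
      · exact h ▸ hGm e
      · exact h ▸ hHm e'

/-- A regular system of parameters is quasi-regular: a form of degree `n` whose value lies in
`𝔪ⁿ⁺¹` has all its coefficients in `𝔪`, so that `gr_𝔪 O` is a polynomial ring over `O ⧸ 𝔪`. -/
theorem IsRegularSystem.coeff_mem_maximalIdeal {O : Type u} [CommRing O] [IsLocalRing O]
    [IsNoetherianRing O] {ι : Type*} [Fintype ι] {y : ι → O} (hy : IsRegularSystem y) {n : ℕ}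
    {F : MvPolynomial ι O} (hF : F.IsHomogeneous n)
    (hFe : eval y F ∈ maximalIdeal O ^ (n + 1)) (e : ι →₀ ℕ) :
    F.coeff e ∈ maximalIdeal O := by
  classical
  exact coeff_mem_maximalIdeal_of_eval_mem_aux Finset.univ
    (hy.comp_equiv (Equiv.subtypeUnivEquiv fun _ => Finset.mem_univ _)) hy.mem n F hF
    (fun e ⟨j, hj, _⟩ => absurd (Finset.mem_univ j) hj) hFe e

end QuasiRegular

/-! ### Projective dimension and the localization of regular local rings -/

section ProjectiveDimension

open TensorProduct

variable {R : Type u} [CommRing R]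

/-- The `R`-module `M` has projective dimension at most `n`. -/
abbrev PdLE (R : Type u) [CommRing R] (M : Type u) [AddCommGroup M] [Module R M] (n : ℕ) : Prop :=
  HasProjectiveDimensionLE (ModuleCat.of R M) n

variable {M N : Type u} [AddCommGroup M] [Module R M] [AddCommGroup N] [Module R N]

lemma PdLE.of_linearEquiv {n : ℕ} (h : PdLE R M n) (e : M ≃ₗ[R] N) : PdLE R N n :=
  hasProjectiveDimensionLT_of_iso e.toModuleIso (n + 1)

lemma pdLE_zero_iff : PdLE R M 0 ↔ Module.Projective R M := by
  rw [PdLE, ← projective_iff_hasProjectiveDimensionLE_zero, ← IsProjective.iff_projective]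

lemma PdLE.mono {m n : ℕ} (h : PdLE R M m) (hmn : m ≤ n) : PdLE R M n :=
  hasProjectiveDimensionLT_of_ge _ (m + 1) (n + 1) (by omega)

lemma PdLE.of_retract {n : ℕ} (h : PdLE R N n) (i : M →ₗ[R] N) (r : N →ₗ[R] M)
    (hri : r ∘ₗ i = LinearMap.id) : PdLE R M n :=
  Retract.hasProjectiveDimensionLT (Y := ModuleCat.of R N)
    ⟨ModuleCat.ofHom i, ModuleCat.ofHom r, by rw [← ModuleCat.ofHom_comp, hri]; rfl⟩ (n + 1)

lemma pdLE_succ_iff_ker {n : ℕ} {f : N →ₗ[R] M} (hf : Function.Surjective f)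
    [Module.Projective R N] : PdLE R M (n + 1) ↔ PdLE R (LinearMap.ker f) n :=
  (LinearMap.shortExact_shortComplexKer hf).hasProjectiveDimensionLT_X₃_iff n
    ((IsProjective.iff_projective _).1 inferInstance)

lemma PdLE.of_exact {n : ℕ} {M₁ M₂ M₃ : Type u} [AddCommGroup M₁] [AddCommGroup M₂]
    [AddCommGroup M₃] [Module R M₁] [Module R M₂] [Module R M₃] {f : M₁ →ₗ[R] M₂}
    {g : M₂ →ₗ[R] M₃} (hf : Function.Injective f) (hg : Function.Surjective g)
    (hfg : Function.Exact f g) (h₁ : PdLE R M₁ n) (h₃ : PdLE R M₃ n) : PdLE R M₂ n :=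
  (ShortComplex.ShortExact.mk' (ModuleCat.shortComplex_exact
      (ModuleCat.shortComplexOfCompEqZero f g hfg.linearMap_comp_eq_zero) hfg)
    ((ModuleCat.mono_iff_injective _).2 hf)
    ((ModuleCat.epi_iff_surjective _).2 hg)).hasProjectiveDimensionLT_X₂ (n + 1) h₁ h₃

/-- Dividing by a regular element raises the projective dimension by at most one. -/
lemma PdLE.quotSMulTop {n : ℕ} {x : R} (hx : IsSMulRegular M x) (h : PdLE R M n) :
    PdLE R (QuotSMulTop x M) (n + 1) :=
  (hx.smulShortComplex_shortExact (M := ModuleCat.of R M)).hasProjectiveDimensionLT_X₃ (n + 1) h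
    (PdLE.mono h (Nat.le_succ n))

lemma PdLE.of_quotSMulTop [IsLocalRing R] [IsNoetherianRing R] [Module.Finite R M] {n : ℕ} {x : R}
    (hx : IsSMulRegular M x) (hxm : x ∈ maximalIdeal R) (h : PdLE R (QuotSMulTop x M) n) :
    PdLE R M n := by
  have h1 := ModuleCat.projectiveDimension_quotSMulTop_eq_succ_of_isSMulRegular (ModuleCat.of R M)
    x hx hxm
  have h2 := (projectiveDimension_le_iff _ n).2 h
  rw [h1] at h2
  exact (projectiveDimension_le_iff _ n).1 (le_trans (le_add_of_nonneg_right zero_le_one) h2)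

/-- The quotient of `R ⧸ I` by `x` is the quotient of `R` by `I + (x)`. -/
lemma nonempty_quotSMulTop_quotient_equiv (x : R) (I : Ideal R) :
    Nonempty ((R ⧸ (I ⊔ Ideal.span {x})) ≃ₗ[R] QuotSMulTop x (R ⧸ I)) := by
  let f : R →ₗ[R] QuotSMulTop x (R ⧸ I) := (Submodule.mkQ _).comp (Submodule.mkQ I)
  have hf : Function.Surjective f :=
    (Submodule.mkQ_surjective _).comp (Submodule.mkQ_surjective _)
  have hk : LinearMap.ker f = I ⊔ Ideal.span {x} := by
    ext a
    rw [LinearMap.mem_ker, LinearMap.comp_apply, Submodule.mkQ_apply, Submodule.Quotient.mk_eq_zero,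
      Submodule.mem_smul_pointwise_iff_exists, Submodule.mem_sup]
    constructor
    · rintro ⟨b, -, hb⟩
      obtain ⟨b, rfl⟩ := Submodule.mkQ_surjective I b
      rw [← map_smul, ← sub_eq_zero, ← map_sub, Submodule.mkQ_apply,
        Submodule.Quotient.mk_eq_zero] at hb
      refine ⟨a - x • b, by simpa using neg_mem hb, x • b, ?_, by ring⟩
      exact Ideal.mul_mem_right _ _ (Ideal.mem_span_singleton_self x)
    · rintro ⟨c, hc, d, hd, rfl⟩
      obtain ⟨b, rfl⟩ := Ideal.mem_span_singleton'.1 hd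
      refine ⟨Submodule.mkQ I b, trivial, ?_⟩
      rw [map_add, Submodule.mkQ_apply I c, (Submodule.Quotient.mk_eq_zero I).2 hc, zero_add,
        ← map_smul, smul_eq_mul, mul_comm]
  exact ⟨Submodule.quotEquivOfEq _ _ hk.symm ≪≫ₗ f.quotKerEquivOfSurjective hf⟩

/-- The quotient by a subset of a regular system has projective dimension at most the size of the
subset. -/
lemma IsRegularSystem.pdLE_quotient [IsLocalRing R] [IsNoetherianRing R] {ι : Type*} [Fintype ι]
    [DecidableEq ι] {y : ι → R} (hy : IsRegularSystem y) (s : Finset ι) :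
    PdLE R (R ⧸ Ideal.span (y '' s)) s.card := by
  induction s using Finset.induction_on with
  | empty =>
    refine (pdLE_zero_iff.2 (inferInstance : Module.Projective R R)).of_linearEquiv ?_
    exact (Submodule.quotEquivOfEqBot _ (by simp)).symm
  | insert i s hi ih =>
    rw [Finset.card_insert_of_notMem hi]
    -- `y i` belongs to a regular system of the domain `R ⧸ (y j : j ∈ s)`
    have hsys : IsRegularSystem (Sum.elim (fun j : s => y j)
        (fun o : Option {j // j ∉ insert i s} => o.elim (y i) fun j => y j)) := by
      let e : (s ⊕ Option {j // j ∉ insert i s}) ≃ ι := by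
        refine Equiv.ofBijective (Sum.elim (fun j => j.1) fun o => o.elim i fun j => j.1) ⟨?_, ?_⟩
        · rintro (⟨a, ha⟩ | _ | ⟨a, ha⟩) (⟨b, hb⟩ | _ | ⟨b, hb⟩) h <;>
            simp only [Sum.elim_inl, Sum.elim_inr, Option.elim] at h <;> grind
        · intro j
          by_cases h1 : j ∈ s
          · exact ⟨Sum.inl ⟨j, h1⟩, rfl⟩
          · by_cases h2 : j = i
            · exact ⟨Sum.inr none, h2.symm⟩
            · exact ⟨Sum.inr (some ⟨j, by simp [h1, h2]⟩), rfl⟩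
      refine (hy.comp_equiv e).congr ?_ rfl
      congr 2
      ext o
      rcases o with o | _ | o <;> rfl
    have hloc : IsLocalRing (R ⧸ Ideal.span (Set.range fun j : s => y j)) :=
      IsRegularSystem.isLocalRing_quotient hsys.span_le_maximalIdeal
    have hq' := hsys.quotient
    have hq : IsRegularSystem (fun o : Option {j // j ∉ insert i s} =>
        o.elim (Ideal.Quotient.mk (Ideal.span (Set.range fun j : s => y j)) (y i))
          fun j => Ideal.Quotient.mk _ (y j)) := by
      refine hq'.congr ?_ rfl
      congr 2
      ext o
      cases o <;> rfl
    have hdom := hq.isDomain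
    have hne := hq.ne_zero_option
    have e1 : (Set.range fun j : s => y j) = y '' s := by
      rw [Set.image_eq_range]; rfl
    rw [e1] at hdom hne
    have hreg : IsSMulRegular (R ⧸ Ideal.span (y '' s)) (y i) := by
      intro a b hab
      simp only [Algebra.smul_def] at hab
      exact mul_left_cancel₀ hne hab
    obtain ⟨e⟩ := nonempty_quotSMulTop_quotient_equiv (y i) (Ideal.span (y '' s))
    refine (ih.quotSMulTop hreg).of_linearEquiv (e.symm ≪≫ₗ Submodule.quotEquivOfEq _ _ ?_)
    rw [Finset.coe_insert, Set.image_insert_eq, Ideal.span_insert, sup_comm]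

/-- Finitely generated modules over a regular local ring of dimension `d` have projective dimension
at most `d`. By filtration it suffices to treat `R ⧸ p`; if `x ∈ 𝔪 ∖ p` then `R ⧸ (p + (x))` is
known by Noetherian induction, and dividing by `x` raises the projective dimension of `R ⧸ p`. -/
theorem IsRegularSystem.pdLE_of_finite [IsLocalRing R] [IsNoetherianRing R] {ι : Type*} [Fintype ι]
    {y : ι → R} (hy : IsRegularSystem y) [hM : Module.Finite R M] :
    PdLE R M (Fintype.card ι) := by
  classical
  suffices H : ∀ I : Ideal R, ∀ (M : Type u) [AddCommGroup M] [Module R M] [Module.Finite R M],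
      (∀ a ∈ I, ∀ m : M, a • m = 0) → PdLE R M (Fintype.card ι) from
    H ⊥ M fun a ha m => by rw [(Submodule.mem_bot R).1 ha, zero_smul]
  intro I
  induction I using IsNoetherian.induction with
  | hgt I ih =>
  intro M _ _ hM
  induction hM using IsNoetherianRing.induction_on_isQuotientEquivQuotientPrime R with
  | subsingleton N =>
    intro _
    exact (pdLE_zero_iff.2 inferInstance).mono (Nat.zero_le _)
  | exact N₁ N₂ N₃ f g hf hg hfg h₁ h₃ =>
    intro hN
    refine .of_exact hf hg hfg (h₁ fun a ha m => hf ?_) (h₃ fun a ha m => ?_)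
    · rw [map_smul, hN a ha, map_zero]
    · obtain ⟨m, rfl⟩ := hg m
      rw [← map_smul, hN a ha, map_zero]
  | quotient N p e =>
    intro hN
    have hIp : I ≤ p.1 := by
      intro a ha
      have := hN a ha (e.symm 1)
      rw [← map_smul, map_eq_zero_iff _ e.symm.injective, Algebra.smul_def, mul_one] at this
      exact Ideal.Quotient.eq_zero_iff_mem.1 this
    refine PdLE.of_linearEquiv ?_ e.symm
    have hkill : ∀ J : Ideal R, ∀ a ∈ J, ∀ m : R ⧸ J, a • m = 0 := by
      intro J a ha m
      rw [Algebra.smul_def, Ideal.Quotient.algebraMap_eq, Ideal.Quotient.eq_zero_iff_mem.2 ha,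
        zero_mul]
    by_cases hp : p.1 = maximalIdeal R
    · have := hy.pdLE_quotient Finset.univ
      rwa [Finset.coe_univ, Set.image_univ, hy.span_range, ← hp, Finset.card_univ] at this
    · obtain ⟨x, hxm, hxp⟩ := SetLike.exists_of_lt
        (lt_of_le_of_ne (le_maximalIdeal p.2.ne_top) hp)
      have hreg : IsSMulRegular (R ⧸ p.1) x := by
        have := p.2
        intro a b hab
        simp only [Algebra.smul_def] at hab
        refine mul_left_cancel₀ ?_ hab
        rwa [Ne, Ideal.Quotient.algebraMap_eq, Ideal.Quotient.eq_zero_iff_mem]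
      obtain ⟨e'⟩ := nonempty_quotSMulTop_quotient_equiv x p.1
      refine PdLE.of_quotSMulTop hreg hxm ?_
      refine PdLE.of_linearEquiv ?_ e'
      refine ih (p.1 ⊔ Ideal.span {x}) ?_ _ (hkill _)
      refine lt_of_le_of_lt hIp (lt_of_le_of_ne le_sup_left fun h => hxp ?_)
      rw [h]
      exact Ideal.mem_sup_right (Ideal.mem_span_singleton_self x)

end ProjectiveDimension

section SerreCriterion

open TensorProduct

variable {R : Type u} [CommRing R] {M N : Type u} [AddCommGroup M] [Module R M] [AddCommGroup N]
  [Module R N]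

lemma one_tmul_quotient_eq_zero_iff {I : Ideal R} {v : M} :
    (1 : R ⧸ I) ⊗ₜ[R] v = 0 ↔ v ∈ I • (⊤ : Submodule R M) := by
  rw [← map_eq_zero_iff _ (TensorProduct.quotTensorEquivQuotSMul M I).injective,
    TensorProduct.quotTensorEquivQuotSMul_mk_one_tmul, Submodule.Quotient.mk_eq_zero]

lemma exists_one_tmul_quotient_eq {I : Ideal R} (t : (R ⧸ I) ⊗[R] M) :
    ∃ v : M, (1 : R ⧸ I) ⊗ₜ[R] v = t := by
  obtain ⟨v, hv⟩ := Submodule.Quotient.mk_surjective _ (TensorProduct.quotTensorEquivQuotSMul M I t)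
  refine ⟨v, (TensorProduct.quotTensorEquivQuotSMul M I).injective ?_⟩
  rw [TensorProduct.quotTensorEquivQuotSMul_mk_one_tmul, hv]

/-- Over a local ring of depth zero finitely generated modules of finite projective dimension are
free: a nonzero `s` with `s 𝔪 = 0` shows that an inclusion of free modules stays injective
modulo `𝔪`, hence splits. -/
lemma PdLE.projective_of_depth_zero [IsLocalRing R] [IsNoetherianRing R] {s : R} (hs : s ≠ 0)
    (hsm : ∀ a ∈ maximalIdeal R, s * a = 0) {n : ℕ} [Module.Finite R M] (h : PdLE R M n) :
    Module.Projective R M := by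
  induction n generalizing M with
  | zero => exact pdLE_zero_iff.1 h
  | succ n ih =>
    obtain ⟨k, f, hf⟩ := Module.Finite.exists_fin' R M
    have hK : PdLE R (LinearMap.ker f) n := (pdLE_succ_iff_ker hf).1 h
    have hKp : Module.Projective R (LinearMap.ker f) := ih hK
    have hKf : Module.Free R (LinearMap.ker f) := Module.free_of_flat_of_isLocalRing
    obtain ⟨r, hr⟩ := (split_injective_iff_lTensor_residueField_injective
      (LinearMap.ker f).subtype).2 (by
        rw [injective_iff_map_eq_zero]
        intro t ht
        obtain ⟨v, rfl⟩ := exists_one_tmul_quotient_eq (I := maximalIdeal R) t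
        have ht' : (1 : R ⧸ maximalIdeal R) ⊗ₜ[R] (v : Fin k → R) = 0 := ht
        rw [one_tmul_quotient_eq_zero_iff] at ht'
        have hsv : s • v = 0 := by
          refine Subtype.ext ?_
          have : ∀ w ∈ maximalIdeal R • (⊤ : Submodule R (Fin k → R)), s • w = 0 := by
            intro w hw
            refine Submodule.smul_induction_on hw (fun a ha w _ => ?_) fun a b ha hb => ?_
            · rw [smul_smul, hsm a ha, zero_smul]
            · rw [smul_add, ha, hb, add_zero]
          exact this _ ht'
        refine one_tmul_quotient_eq_zero_iff.2 ?_
        let b := Module.Free.chooseBasis R (LinearMap.ker f)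
        rw [← b.sum_repr v]
        refine Submodule.sum_mem _ fun i _ => Submodule.smul_mem_smul ?_ trivial
        rw [mem_maximalIdeal]
        intro hu
        have h1 : s * b.repr v i = 0 := by
          have := congrArg (fun w => b.repr w i) hsv
          simpa using this
        exact hs ((hu.mul_left_eq_zero).1 h1))
    -- the splitting of the kernel gives a section of `f`
    have hsec : ∃ g : M →ₗ[R] (Fin k → R), f ∘ₗ g = LinearMap.id := by
      have hex : Function.Exact (LinearMap.ker f).subtype f := LinearMap.exact_subtype_ker_map f
      have h01 := (hex.split_tfae (Submodule.injective_subtype _) hf).out 0 1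
      exact h01.2 ⟨r, hr⟩
    obtain ⟨g, hg⟩ := hsec
    exact Module.Projective.of_split g f hg

/-- Dividing by an element regular on `R` and on `M` does not raise the projective dimension over
the quotient ring. -/
lemma PdLE.quotient_tensor [IsNoetherianRing R] {x : R} (hx : x ∈ nonZeroDivisors R)
    {n : ℕ} [Module.Finite R M] (hxM : IsSMulRegular M x) (h : PdLE R M n) :
    PdLE (R ⧸ Ideal.span {x}) ((R ⧸ Ideal.span {x}) ⊗[R] M) n := by
  induction n generalizing M with
  | zero =>
    have := pdLE_zero_iff.1 h
    exact pdLE_zero_iff.2 inferInstance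
  | succ n ih =>
    obtain ⟨k, f, hf⟩ := Module.Finite.exists_fin' R M
    have hK : PdLE R (LinearMap.ker f) n := (pdLE_succ_iff_ker hf).1 h
    have hxF : IsSMulRegular (Fin k → R) x := by
      intro a b hab
      funext i
      have h1 : x * a i = x * b i := congrFun hab i
      rw [← sub_eq_zero, ← mul_sub] at h1
      exact sub_eq_zero.1 ((mem_nonZeroDivisors_iff.1 hx).1 _ h1)
    have hxK : IsSMulRegular (LinearMap.ker f) x := fun a b hab =>
      Subtype.ext (hxF (congrArg Subtype.val hab))
    have hsurj : Function.Surjective (f.baseChange (R ⧸ Ideal.span {x})) :=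
      LinearMap.lTensor_surjective _ hf
    have hinj : Function.Injective ((LinearMap.ker f).subtype.baseChange (R ⧸ Ideal.span {x})) := by
      rw [injective_iff_map_eq_zero]
      intro t ht
      obtain ⟨v, rfl⟩ := exists_one_tmul_quotient_eq t
      rw [LinearMap.baseChange_tmul, one_tmul_quotient_eq_zero_iff,
        Submodule.ideal_span_singleton_smul, Submodule.mem_smul_pointwise_iff_exists] at ht
      obtain ⟨w, -, hw⟩ := ht
      have hfw : f w = 0 := by
        refine hxM ?_
        change x • f w = x • 0
        rw [smul_zero, ← map_smul, hw]
        exact v.2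
      rw [one_tmul_quotient_eq_zero_iff, Submodule.ideal_span_singleton_smul,
        Submodule.mem_smul_pointwise_iff_exists]
      exact ⟨⟨w, hfw⟩, trivial, Subtype.ext hw⟩
    have hex : Function.Exact ((LinearMap.ker f).subtype.baseChange (R ⧸ Ideal.span {x}))
        (f.baseChange (R ⧸ Ideal.span {x})) :=
      lTensor_exact _ (LinearMap.exact_subtype_ker_map f) hf
    refine (pdLE_succ_iff_ker hsurj).2 ((ih hxK hK).of_linearEquiv ?_)
    exact LinearEquiv.ofInjective _ hinj ≪≫ₗ
      LinearEquiv.ofEq _ _ (LinearMap.exact_iff.1 hex).symm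

/-- If `x ∈ 𝔪 ∖ 𝔪²`, then the residue field is a direct summand of `𝔪 ⧸ x 𝔪` over `R ⧸ x`: the
class of `x` spans a copy of it, split off by a functional on `𝔪 ⧸ 𝔪²`. -/
lemma pdLE_residueField_quotient [IsLocalRing R] {x : R} (hxm : x ∈ maximalIdeal R)
    (hx2 : x ∉ maximalIdeal R ^ 2) [IsLocalRing (R ⧸ Ideal.span {x})] {n : ℕ}
    (h : PdLE (R ⧸ Ideal.span {x}) ((R ⧸ Ideal.span {x}) ⊗[R] maximalIdeal R) n) :
    PdLE (R ⧸ Ideal.span {x}) (ResidueField (R ⧸ Ideal.span {x})) n := by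
  let R' := R ⧸ Ideal.span {x}
  let x' : maximalIdeal R := ⟨x, hxm⟩
  have hloc : IsLocalHom (Ideal.Quotient.mk (Ideal.span {x})) :=
    IsLocalHom.of_surjective _ Ideal.Quotient.mk_surjective
  have hx0 : (maximalIdeal R).toCotangent x' ≠ 0 := by
    rwa [Ne, Ideal.toCotangent_eq_zero]
  obtain ⟨φ, hφ⟩ := Module.Projective.exists_dual_eq_one (ResidueField R)
    (V := CotangentSpace R) hx0
  -- the functional on `𝔪`, with values in the residue field of the quotient
  let ψ : maximalIdeal R →ₗ[R] ResidueField R' :=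
    { toFun := fun a => ResidueField.map (Ideal.Quotient.mk (Ideal.span {x}))
        (φ ((maximalIdeal R).toCotangent a))
      map_add' := fun a b => by simp only [map_add]
      map_smul' := fun r a => by
        rw [map_smul, ← IsScalarTower.algebraMap_smul (ResidueField R) r
          ((maximalIdeal R).toCotangent a : CotangentSpace R), map_smul, smul_eq_mul, map_mul,
          RingHom.id_apply, Algebra.smul_def]
        rfl }
  have hψ : ψ x' = 1 := by
    change ResidueField.map _ (φ ((maximalIdeal R).toCotangent x')) = 1
    rw [hφ, map_one]
  let r : R' ⊗[R] maximalIdeal R →ₗ[R'] ResidueField R' := LinearMap.liftBaseChange R' ψ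
  let i₀ : R' →ₗ[R'] R' ⊗[R] maximalIdeal R := LinearMap.toSpanSingleton R' _ (1 ⊗ₜ[R] x')
  have hi₀ : maximalIdeal R' ≤ LinearMap.ker i₀ := by
    intro a ha
    obtain ⟨a, rfl⟩ := Ideal.Quotient.mk_surjective a
    have ham : a ∈ maximalIdeal R :=
      (mem_maximalIdeal _).2 fun hu => (mem_maximalIdeal _).1 ha (hu.map _)
    rw [LinearMap.mem_ker, LinearMap.toSpanSingleton_apply]
    have h1 : (Ideal.Quotient.mk (Ideal.span {x}) a) • ((1 : R') ⊗ₜ[R] x') =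
        (1 : R') ⊗ₜ[R] (a • x') := by
      rw [TensorProduct.tmul_smul]
      exact algebraMap_smul R' a _
    have h2 : a • x' = x • (⟨a, ham⟩ : maximalIdeal R) := Subtype.ext (mul_comm a x)
    rw [h1, h2, one_tmul_quotient_eq_zero_iff]
    exact Submodule.smul_mem_smul (Ideal.mem_span_singleton_self x) trivial
  let i : ResidueField R' →ₗ[R'] R' ⊗[R] maximalIdeal R := Submodule.liftQ _ i₀ hi₀
  refine h.of_retract i r ?_
  refine LinearMap.ext fun t => ?_
  obtain ⟨t, rfl⟩ := residue_surjective t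
  change r (i₀ t) = _
  rw [LinearMap.toSpanSingleton_apply, map_smul, LinearMap.liftBaseChange_tmul, hψ, one_smul,
    LinearMap.id_apply, Algebra.smul_def, mul_one]
  rfl

lemma exists_ringKrullDim_eq_natCast (R : Type*) [CommRing R] [IsLocalRing R]
    [IsNoetherianRing R] : ∃ d : ℕ, ringKrullDim R = d := by
  obtain ⟨e, he⟩ := WithBot.ne_bot_iff_exists.1 (ringKrullDim_ne_bot (R := R))
  have hne : e ≠ ⊤ := by
    rintro rfl
    exact ringKrullDim_ne_top he.symm
  obtain ⟨d, rfl⟩ := ENat.ne_top_iff_exists.1 hne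
  exact ⟨d, he.symm⟩

lemma maximalIdeal_eq_bot_of_projective_residueField [IsLocalRing R] [IsNoetherianRing R]
    (h : Module.Projective R (ResidueField R)) : maximalIdeal R = ⊥ := by
  have hfin : Module.Finite R (ResidueField R) :=
    .of_surjective (Algebra.linearMap R (ResidueField R)) residue_surjective
  have hfree : Module.Free R (ResidueField R) := Module.free_of_flat_of_isLocalRing
  refine eq_bot_iff.2 fun a ha => ?_
  rw [← Module.annihilator_eq_bot.2 (inferInstance : FaithfulSMul R (ResidueField R)),
    Module.mem_annihilator]
  intro t
  rw [Algebra.smul_def, ResidueField.algebraMap_eq, (residue_eq_zero_iff a).2 ha, zero_mul]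

/-- A Noetherian local ring whose residue field has finite projective dimension is regular. -/
theorem isRegularLocalRing_of_pdLE_residueField [IsLocalRing R] [IsNoetherianRing R] {n : ℕ}
    (h : PdLE R (ResidueField R) n) : IsRegularLocalRing R := by
  obtain ⟨d, hd⟩ : ∃ d : ℕ, ringKrullDim R = d :=
    exists_ringKrullDim_eq_natCast _
  induction d using Nat.strong_induction_on generalizing R with
  | h d ih =>
  by_cases h0 : maximalIdeal R = ⊥
  · have hy : IsRegularSystem (Fin.elim0 : Fin 0 → R) :=
      .of_card_le (by rw [h0]; simp) (by simpa using ringKrullDim_nonneg_of_nontrivial)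
    exact hy.isRegularLocalRing
  -- `𝔪` is not an associated prime of `R`, for otherwise the residue field would be free
  have hass : ∀ p ∈ associatedPrimes R R, p ≠ maximalIdeal R := by
    rintro p hp rfl
    obtain ⟨-, s, hs⟩ := isAssociatedPrime_iff.1 (AssociatedPrimes.mem_iff.1 hp)
    have hs0 : s ≠ 0 := by
      rintro rfl
      refine (maximalIdeal.isMaximal R).ne_top ?_
      rw [hs, Ideal.eq_top_iff_one, Submodule.mem_colon_singleton]
      simp
    have hproj : Module.Projective R (ResidueField R) :=
      h.projective_of_depth_zero hs0 (fun a ha => by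
        rw [hs, Submodule.mem_colon_singleton, smul_eq_mul, Submodule.mem_bot] at ha
        rwa [mul_comm])
    exact h0 (maximalIdeal_eq_bot_of_projective_residueField hproj)
  obtain ⟨x, hxm, hx2, hxp⟩ := exists_mem_maximalIdeal_notMem_sq h0
    (associatedPrimes.finite R R) (fun p hp => hp.1) hass
  have hxr : x ∈ nonZeroDivisors R := by
    by_contra hx
    have : x ∈ ((nonZeroDivisors R : Set R))ᶜ := hx
    rw [← biUnion_associatedPrimes_eq_compl_nonZeroDivisors R] at this
    obtain ⟨p, hp, hxp'⟩ := Set.mem_iUnion₂.1 this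
    exact hxp p hp hxp'
  have hloc : IsLocalRing (R ⧸ Ideal.span {x}) :=
    IsRegularSystem.isLocalRing_quotient ((Ideal.span_singleton_le_iff_mem _).2 hxm)
  have hpm : PdLE R (maximalIdeal R) n := by
    have := (pdLE_succ_iff_ker (f := Submodule.mkQ (maximalIdeal R))
      (Submodule.mkQ_surjective _)).1 (h.mono n.le_succ)
    exact this.of_linearEquiv (LinearEquiv.ofEq _ _ (Submodule.ker_mkQ _))
  have hxreg : IsSMulRegular (maximalIdeal R) x := by
    intro a b hab
    refine Subtype.ext ?_
    have h1 : x * a.1 = x * b.1 := congrArg Subtype.val hab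
    rw [← sub_eq_zero, ← mul_sub] at h1
    exact sub_eq_zero.1 ((mem_nonZeroDivisors_iff.1 hxr).1 _ h1)
  have hpk := pdLE_residueField_quotient hxm hx2 (hpm.quotient_tensor hxr hxreg)
  obtain ⟨d', hd'⟩ : ∃ d' : ℕ, ringKrullDim (R ⧸ Ideal.span {x}) = d' :=
    exists_ringKrullDim_eq_natCast _
  have hlt : d' < d := by
    have := ringKrullDim_quotient_succ_le_of_nonZeroDivisor hxr
    rw [hd, hd'] at this
    have h3 : d' + 1 ≤ d := by exact_mod_cast this
    omega
  have hreg := ih d' hlt hpk hd'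
  obtain ⟨e, z, hz⟩ := IsRegularLocalRing.exists_isRegularSystem (R ⧸ Ideal.span {x})
  choose b hb using fun k => Ideal.Quotient.mk_surjective (z k)
  have hz' : IsRegularSystem fun k => Ideal.Quotient.mk (Ideal.span {x}) (b k) := by
    simpa only [hb] using hz
  exact (IsRegularSystem.option_of_quotient hxr hxm hz').isRegularLocalRing

/-- The localization of a regular local ring at a prime is regular. -/
theorem IsRegularLocalRing.localization_atPrime [IsRegularLocalRing R] (p : Ideal R) [p.IsPrime] :
    IsRegularLocalRing (Localization.AtPrime p) := by
  obtain ⟨d, y, hy⟩ := IsRegularLocalRing.exists_isRegularSystem R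
  have h1 : PdLE R (R ⧸ p) (Fintype.card (Fin d)) := hy.pdLE_of_finite
  have h2 := ModuleCat.localizedModule_hasProjectiveDimensionLE (Fintype.card (Fin d))
    p.primeCompl (ModuleCat.of R (R ⧸ p))
  let κ := p.ResidueField
  let f : (R ⧸ p) →ₗ[R] κ := (IsScalarTower.toAlgHom R (R ⧸ p) κ).toLinearMap
  have hf : IsLocalizedModule p.primeCompl f := by
    have : IsLocalization (Algebra.algebraMapSubmonoid (R ⧸ p) p.primeCompl) κ := by
      have hM : Algebra.algebraMapSubmonoid (R ⧸ p) p.primeCompl = nonZeroDivisors (R ⧸ p) := by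
        ext a
        obtain ⟨a, rfl⟩ := Ideal.Quotient.mk_surjective a
        rw [mem_nonZeroDivisors_iff_ne_zero, Ne, Ideal.Quotient.eq_zero_iff_mem]
        constructor
        · rintro ⟨b, hb, hba⟩ ha
          refine hb ?_
          have := sub_mem ha (Ideal.Quotient.eq.1 hba.symm)
          simpa using this
        · exact fun ha => ⟨a, ha, rfl⟩
      rw [hM]
      exact (inferInstance : IsFractionRing (R ⧸ p) p.ResidueField)
    exact isLocalizedModule_iff_isLocalization.2 this
  have hg := ModuleCat.localizedModule_isLocalizedModule (ModuleCat.of R (R ⧸ p)) p.primeCompl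
  let e := IsLocalizedModule.linearEquiv p.primeCompl
    ((ModuleCat.of R (R ⧸ p)).localizedModuleMkLinearMap p.primeCompl) f
  let e' := LinearEquiv.extendScalarsOfIsLocalization p.primeCompl (Localization.AtPrime p) e
  exact isRegularLocalRing_of_pdLE_residueField (PdLE.of_linearEquiv h2 e')

end SerreCriterion

/-! ### Formal smoothness of field extensions of a perfect field -/

universe v

/-- The vanishing of the first homology of the cotangent complex in elementary terms: a polynomial
relation between elements of `L` all of whose partial derivatives vanish is in the square of the
ideal of relations. -/
lemma subsingleton_h1Cotangent_iff_pderiv (k : Type v) (L : Type u) [CommRing k] [CommRing L]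
    [Algebra k L] :
    Subsingleton (Algebra.H1Cotangent k L) ↔
      ∀ f : MvPolynomial L k, f ∈ RingHom.ker (MvPolynomial.aeval (R := k) (id : L → L)) →
        (∀ i, MvPolynomial.aeval (id : L → L) (MvPolynomial.pderiv i f) = 0) →
          f ∈ RingHom.ker (MvPolynomial.aeval (R := k) (id : L → L)) ^ 2 := by
  let P := Algebra.Generators.self k L
  have h0 (x : P.ker) :
      P.toExtension.cotangentComplex (Algebra.Extension.Cotangent.mk x) = 0 ↔
        ∀ i, MvPolynomial.aeval (id : L → L) (MvPolynomial.pderiv i x.1) = 0 := by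
    rw [← P.cotangentSpaceBasis.repr.map_eq_zero_iff, Finsupp.ext_iff]
    refine forall_congr' fun i => ?_
    have := congrFun (Algebra.Generators.cotangentRestrict_mk P (u := id)
      Function.injective_id x) i
    rw [Finsupp.zero_apply]
    exact Eq.congr_left this
  have h1 (x : P.ker) : Algebra.Extension.Cotangent.mk (P := P.toExtension) x = 0 ↔
      x.1 ∈ RingHom.ker (MvPolynomial.aeval (R := k) (id : L → L)) ^ 2 := by
    exact Ideal.toCotangent_eq_zero P.toExtension.ker x
  have : Algebra.FormallySmooth k P.toExtension.Ring :=
    Algebra.instFormallySmoothMvPolynomial L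
  rw [← P.toExtension.cotangentComplex_injective_iff, injective_iff_map_eq_zero]
  constructor
  · intro H f hf hd
    exact (h1 ⟨f, hf⟩).mp (H _ ((h0 ⟨f, hf⟩).mpr hd))
  · intro H y hy
    obtain ⟨x, rfl⟩ := Algebra.Extension.Cotangent.mk_surjective y
    exact (h1 x).mpr (H _ x.2 ((h0 x).mp hy))

/-- Every extension of a perfect field is formally smooth. A relation involves finitely many
elements, so the criterion reduces to finitely generated extensions. -/
theorem formallySmooth_of_perfectField (k : Type v) (L : Type u) [Field k] [Field L]
    [Algebra k L] [PerfectField k] : Algebra.FormallySmooth k L := by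
  refine ⟨inferInstance, (subsingleton_h1Cotangent_iff_pderiv k L).mpr fun f hf hd => ?_⟩
  let L' := IntermediateField.adjoin k (f.vars : Set L)
  have : Algebra.EssFiniteType k L' :=
    IntermediateField.essFiniteType_iff.mpr (IntermediateField.fg_adjoin_finset f.vars)
  have hs : Algebra.FormallySmooth k L' := Algebra.FormallySmooth.of_perfectField
  have hinj : Function.Injective ((↑) : L' → L) := Subtype.val_injective
  obtain ⟨g, hgf⟩ := MvPolynomial.exists_rename_eq_of_vars_subset_range f ((↑) : L' → L) hinj
    (fun x hx => ⟨⟨x, IntermediateField.subset_adjoin k _ hx⟩, rfl⟩)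
  rw [← hgf] at hf hd ⊢
  have hval (p : MvPolynomial L' k) : MvPolynomial.aeval (id : L → L)
      (MvPolynomial.rename ((↑) : L' → L) p) =
        ((MvPolynomial.aeval (id : L' → L') p : L') : L) := by
    rw [MvPolynomial.aeval_rename]
    have := MvPolynomial.aeval_algebraMap_apply (A := L') L (id : L' → L') p
    exact this
  have hg := (subsingleton_h1Cotangent_iff_pderiv k L').mp hs.2 g
    (by
      rw [RingHom.mem_ker] at hf ⊢
      rw [hval] at hf
      exact hinj hf)
    (fun i => by
      have := hd i
      rw [MvPolynomial.pderiv_rename hinj, hval] at this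
      exact hinj this)
  have hle : (RingHom.ker (MvPolynomial.aeval (R := k) (id : L' → L'))) ≤
      (RingHom.ker (MvPolynomial.aeval (R := k) (id : L → L))).comap
        (MvPolynomial.rename ((↑) : L' → L)) := by
    intro p hp
    rw [RingHom.mem_ker] at hp
    rw [Ideal.mem_comap, RingHom.mem_ker, hval, hp]
    rfl
  exact (Ideal.pow_right_mono hle 2).trans (Ideal.le_comap_pow _ 2) hg

/-! ### Lifting homomorphisms to complete local rings -/

/-- Lifting of a homomorphism from a ring `S` with `π` a nonzerodivisor and `S ⧸ π` formally smooth
over the residue field `k` of `R₀`, along a square-zero extension whose kernel is killed by `π`.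
The fibre product `F` of `S` and `T` over `T'` maps onto `S` with kernel killed by `π`; a section of
`F ⧸ π → S ⧸ π` singles out a subring of `F` that maps isomorphically onto `S`. -/
lemma exists_lift_of_sq_zero {R₀ S T T' κ : Type u} [CommRing R₀] [IsLocalRing R₀] [CommRing S]
    [CommRing T] [CommRing T'] [CommRing κ] [Algebra (ResidueField R₀) κ]
    [Algebra.FormallySmooth (ResidueField R₀) κ] {π : R₀} (hπ : maximalIdeal R₀ = Ideal.span {π})
    (ρ : R₀ →+* S) (τ : R₀ →+* T) (q : T →+* T') (hq : Function.Surjective q) (f : S →+* T')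
    (hf : ∀ r, f (ρ r) = q (τ r)) (hnz : ρ π ∈ nonZeroDivisors S)
    (hJ : ∀ j, q j = 0 → τ π * j = 0) (hJ2 : ∀ j j', q j = 0 → q j' = 0 → j * j' = 0)
    (p : S →+* κ) (hp : Function.Surjective p) (hker : ∀ s, p s = 0 ↔ ρ π ∣ s)
    (hcomp : ∀ r, p (ρ r) = algebraMap (ResidueField R₀) κ (residue R₀ r)) :
    ∃ g : S →+* T, (∀ s, q (g s) = f s) ∧ ∀ r, g (ρ r) = τ r := by
  let F : Subring (S × T) := RingHom.eqLocus (f.comp (RingHom.fst S T)) (q.comp (RingHom.snd S T))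
  let pr : F →+* S := (RingHom.fst S T).comp F.subtype
  let pT : F →+* T := (RingHom.snd S T).comp F.subtype
  have hF (x : F) : f (pr x) = q (pT x) := x.2
  have hext (x y : F) (h1 : pr x = pr y) (h2 : pT x = pT y) : x = y :=
    Subtype.ext (Prod.ext h1 h2)
  have hpr : Function.Surjective pr := fun s => by
    obtain ⟨t, ht⟩ := hq (f s)
    exact ⟨⟨(s, t), ht.symm⟩, rfl⟩
  let ι : R₀ →+* F := (ρ.prod τ).codRestrict F hf
  have hιpr (r) : pr (ι r) = ρ r := rfl
  have hιT (r) : pT (ι r) = τ r := rfl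
  have hkerπ (x : F) (hx : pr x = 0) : ι π * x = 0 := by
    refine hext _ _ ?_ ?_
    · rw [map_mul, hx, mul_zero, map_zero]
    · rw [map_mul, hιT, map_zero, hJ]
      rw [← hF, hx, map_zero]
  have hkersq (x y : F) (hx : pr x = 0) (hy : pr y = 0) : x * y = 0 := by
    refine hext _ _ ?_ ?_
    · rw [map_mul, hx, zero_mul, map_zero]
    · rw [map_mul, map_zero, hJ2]
      · rw [← hF, hx, map_zero]
      · rw [← hF, hy, map_zero]
  let I : Ideal F := Ideal.span {ι π}
  let F₁ := F ⧸ I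
  let c : R₀ ⧸ maximalIdeal R₀ →+* F₁ := Ideal.Quotient.lift _ ((Ideal.Quotient.mk I).comp ι) (by
    intro a ha
    rw [hπ, Ideal.mem_span_singleton] at ha
    obtain ⟨b, rfl⟩ := ha
    rw [RingHom.comp_apply, map_mul, Ideal.Quotient.eq_zero_iff_mem]
    exact Ideal.mul_mem_right _ _ (Ideal.mem_span_singleton_self _))
  let _ : Algebra (ResidueField R₀) F₁ := RingHom.toAlgebra c
  have halg (r : R₀) : algebraMap (ResidueField R₀) F₁ (residue R₀ r) =
    Ideal.Quotient.mk I (ι r) := rfl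
  let p₁ : F₁ →+* κ := Ideal.Quotient.lift I (p.comp pr) (by
    intro a ha
    obtain ⟨b, rfl⟩ := Ideal.mem_span_singleton.mp ha
    rw [RingHom.comp_apply, hker, map_mul]
    exact dvd_mul_right _ _)
  have hp₁ (x : F) : p₁ (Ideal.Quotient.mk I x) = p (pr x) := rfl
  let P₁ : F₁ →ₐ[ResidueField R₀] κ := { p₁ with
    commutes' := by
      intro a
      obtain ⟨r, rfl⟩ := residue_surjective a
      exact (hcomp r) }
  -- the kernel of `F ⧸ π → S ⧸ π` is the image of the kernel of `F → S`
  have hkerP (y : F₁) (hy : P₁ y = 0) : ∃ j : F, pr j = 0 ∧ Ideal.Quotient.mk I j = y := by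
    obtain ⟨x, rfl⟩ := Ideal.Quotient.mk_surjective y
    obtain ⟨s, hs⟩ := (hker _).mp (show p (pr x) = 0 from hy)
    obtain ⟨z, rfl⟩ := hpr s
    refine ⟨x - ι π * z, ?_, ?_⟩
    · rw [map_sub, map_mul, hιpr, hs, sub_self]
    · rw [map_sub, sub_eq_self, Ideal.Quotient.eq_zero_iff_mem]
      exact Ideal.mul_mem_right _ _ (Ideal.mem_span_singleton_self _)
  have hP₁ : Function.Surjective P₁ := fun a => by
    obtain ⟨s, rfl⟩ := hp a
    obtain ⟨x, rfl⟩ := hpr s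
    exact ⟨Ideal.Quotient.mk I x, rfl⟩
  have hsq : (RingHom.ker P₁) ^ 2 = ⊥ := by
    rw [eq_bot_iff, pow_two, Ideal.mul_le]
    intro a ha b hb
    obtain ⟨a, ha', rfl⟩ := hkerP a ha
    obtain ⟨b, hb', rfl⟩ := hkerP b hb
    rw [← map_mul, hkersq a b ha' hb', map_zero]
    exact zero_mem _
  let σ : κ →ₐ[ResidueField R₀] F₁ :=
    Algebra.FormallySmooth.liftOfSurjective (AlgHom.id _ κ) P₁ hP₁ ⟨2, hsq⟩
  have hσ (a : κ) : P₁ (σ a) = a :=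
    Algebra.FormallySmooth.liftOfSurjective_apply (AlgHom.id _ κ) P₁ hP₁ ⟨2, hsq⟩ a
  let G : Subring F := RingHom.eqLocus (Ideal.Quotient.mk I)
    ((σ : κ →+* F₁).comp (p.comp pr))
  have hG (x : F) : x ∈ G ↔ Ideal.Quotient.mk I x = σ (p (pr x)) := Iff.rfl
  have hinj : Function.Injective (pr.comp G.subtype) := by
    rw [injective_iff_map_eq_zero]
    rintro ⟨x, hx⟩ h0
    replace h0 : pr x = 0 := h0
    rw [hG, h0, map_zero, map_zero, Ideal.Quotient.eq_zero_iff_mem] at hx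
    obtain ⟨y, rfl⟩ := Ideal.mem_span_singleton.mp hx
    rw [map_mul, hιpr, mul_comm] at h0
    exact Subtype.ext (hkerπ y ((mul_right_mem_nonZeroDivisors_eq_zero_iff hnz).mp h0))
  have hsurj : Function.Surjective (pr.comp G.subtype) := by
    intro s
    obtain ⟨x, rfl⟩ := hpr s
    obtain ⟨j, hj, hj'⟩ := hkerP (Ideal.Quotient.mk I x - σ (p (pr x))) (by
      rw [map_sub, hσ, sub_eq_zero]
      rfl)
    refine ⟨⟨x - j, ?_⟩, ?_⟩
    · rw [hG, map_sub, hj', map_sub, hj, sub_zero, sub_sub_cancel]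
    · change pr (x - j) = pr x
      rw [map_sub, hj, sub_zero]
  let e : G ≃+* S := RingEquiv.ofBijective _ ⟨hinj, hsurj⟩
  refine ⟨(pT.comp G.subtype).comp e.symm, fun s => ?_, fun r => ?_⟩
  · change q (pT (e.symm s : G).1) = f s
    rw [← hF]
    congr 1
    exact e.apply_symm_apply s
  · have hr : ι r ∈ G := by
      rw [hG, hιpr, hcomp, AlgHom.commutes, halg]
    have : e.symm (ρ r) = ⟨ι r, hr⟩ := by
      rw [RingEquiv.symm_apply_eq]
      rfl
    change pT (e.symm (ρ r) : G).1 = τ r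
    rw [this]
    rfl

open Ideal.Quotient in
/-- A homomorphism `S → O ⧸ 𝔪` that can be lifted from `O ⧸ 𝔪ⁿ` to `O ⧸ 𝔪ⁿ⁺¹` for every `n ≥ 1`
lifts to the completion. -/
lemma exists_lift_adicCompletion_of_step {R₀ S O : Type u} [CommRing R₀] [CommRing S] [CommRing O]
    (m : Ideal O) (ρ : R₀ →+* S) (τ : R₀ →+* O) (f : S →+* O ⧸ m) (hf : ∀ r, f (ρ r) = mk m (τ r))
    (step : ∀ (n : ℕ) (g : S →+* O ⧸ m ^ (n + 1)), (∀ r, g (ρ r) = mk _ (τ r)) →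
      (∀ s, factor (Ideal.pow_le_self n.succ_ne_zero) (g s) = f s) →
      ∃ h : S →+* O ⧸ m ^ (n + 2), (∀ r, h (ρ r) = mk _ (τ r)) ∧
        ∀ s, factor (Ideal.pow_le_pow_right (n + 1).le_succ) (h s) = g s) :
    ∃ g : S →+* AdicCompletion m O, (∀ s, AdicCompletion.evalOneₐ m (g s) = f s) ∧
      ∀ r, g (ρ r) = algebraMap O (AdicCompletion m O) (τ r) := by
  let D (n : ℕ) := {g : S →+* O ⧸ m ^ (n + 1) // (∀ r, g (ρ r) = mk _ (τ r)) ∧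
      (∀ s, factor (Ideal.pow_le_self n.succ_ne_zero) (g s) = f s)}
  have hfac {a b c : Ideal O} (h1 : a ≤ b) (h2 : b ≤ c) (x : O ⧸ a) :
      factor h2 (factor h1 x) = factor (h1.trans h2) x := by
    obtain ⟨x, rfl⟩ := mk_surjective x
    rfl
  have step' (n : ℕ) (g : D n) : ∃ h : D (n + 1),
      ∀ s, factor (Ideal.pow_le_pow_right (n + 1).le_succ) (h.1 s) = g.1 s := by
    obtain ⟨h, h1, h2⟩ := step n g.1 g.2.1 g.2.2
    refine ⟨⟨h, h1, fun s => ?_⟩, h2⟩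
    rw [← g.2.2 s, ← h2 s, hfac]
  choose nxt hnxt using step'
  have h01 : m ≤ m ^ (0 + 1) := by simp
  have D0 : D 0 := ⟨(factor h01).comp f, fun r => by rw [RingHom.comp_apply, hf]; rfl, fun s => by
    obtain ⟨x, hx⟩ := mk_surjective (f s)
    rw [RingHom.comp_apply, ← hx]
    rfl⟩
  obtain ⟨seq, hseq⟩ : ∃ seq : ∀ n, D n, ∀ n s,
      factor (Ideal.pow_le_pow_right (n + 1).le_succ) ((seq (n + 1)).1 s) = (seq n).1 s :=
    ⟨fun n => Nat.rec D0 nxt n, fun n s => hnxt n _ s⟩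
  have hseq' (n k : ℕ) (h : m ^ (n + k + 1) ≤ m ^ (n + 1)) (s : S) :
      factor h ((seq (n + k)).1 s) = (seq n).1 s := by
    induction k with
    | zero =>
      obtain ⟨x, hx⟩ := mk_surjective ((seq n).1 s)
      change factor h ((seq n).1 s) = _
      rw [← hx]
      rfl
    | succ k ih =>
      rw [← ih (Ideal.pow_le_pow_right (by omega)), ← hseq (n + k) s, hfac]
      rfl
  let F (n : ℕ) : S →+* O ⧸ m ^ n := (factor (Ideal.pow_le_pow_right n.le_succ)).comp (seq n).1
  have hF {i j : ℕ} (hle : i ≤ j) :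
      (factorPow m hle).comp (F j) = F i := by
    obtain ⟨k, rfl⟩ := Nat.exists_eq_add_of_le hle
    refine RingHom.ext fun s => ?_
    change factor (Ideal.pow_le_pow_right hle)
      (factor (Ideal.pow_le_pow_right (i + k).le_succ) ((seq (i + k)).1 s)) =
        factor (Ideal.pow_le_pow_right i.le_succ) ((seq i).1 s)
    rw [← hseq' i k (Ideal.pow_le_pow_right (by omega)) s, hfac, hfac]
  refine ⟨AdicCompletion.liftRingHom m F hF, fun s => ?_, fun r => ?_⟩
  · have h1 := AdicCompletion.evalₐ_liftRingHom m F hF 1 s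
    have h2 : AdicCompletion.evalOneₐ m (AdicCompletion.liftRingHom m F hF s) =
        factor (Ideal.pow_le_self one_ne_zero)
          (AdicCompletion.evalₐ m 1 (AdicCompletion.liftRingHom m F hF s)) :=
      (AdicCompletion.factorₐ_evalₐ_one m _).symm
    have h3 : (seq 0).1 s = F 1 s := (hseq 0 s).symm
    rw [h2, h1, ← h3]
    exact (seq 0).2.2 s
  · refine AdicCompletion.ext_evalₐ fun n => ?_
    rw [AdicCompletion.evalₐ_liftRingHom]
    change factor (Ideal.pow_le_pow_right n.le_succ) ((seq n).1 (ρ r)) = _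
    rw [(seq n).2.1, factor_mk, AdicCompletion.algebraMap_apply, AdicCompletion.evalₐ_of,
      Algebra.algebraMap_self_apply]

open Ideal.Quotient in
/-- If `π` is a nonzerodivisor in `S` and `S ⧸ π` is the residue field of `O`, then `S` maps to the
completion of `O` over `R₀`, provided the residue field of `R₀` is perfect. -/
theorem exists_lift_adicCompletion {R₀ S O : Type u} [CommRing R₀] [IsLocalRing R₀]
    [PerfectField (ResidueField R₀)] [CommRing S] [CommRing O] [IsLocalRing O] {π : R₀}
    (hπ : maximalIdeal R₀ = Ideal.span {π}) (ρ : R₀ →+* S) (τ : R₀ →+* O)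
    (hτ : τ π ∈ maximalIdeal O) (hnz : ρ π ∈ nonZeroDivisors S) (f : S →+* O ⧸ maximalIdeal O)
    (hf : ∀ r, f (ρ r) = mk _ (τ r)) (hfs : Function.Surjective f)
    (hker : ∀ s, f s = 0 ↔ ρ π ∣ s) :
    ∃ g : S →+* AdicCompletion (maximalIdeal O) O,
      (∀ s, AdicCompletion.evalOneₐ (maximalIdeal O) (g s) = f s) ∧
      ∀ r, g (ρ r) = algebraMap O _ (τ r) := by
  let c : R₀ ⧸ maximalIdeal R₀ →+* O ⧸ maximalIdeal O :=
    Ideal.Quotient.lift _ ((mk (maximalIdeal O)).comp τ) (by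
      intro a ha
      rw [hπ, Ideal.mem_span_singleton] at ha
      obtain ⟨b, rfl⟩ := ha
      rw [RingHom.comp_apply, map_mul, eq_zero_iff_mem]
      exact Ideal.mul_mem_right _ _ hτ)
  let _ : Algebra (ResidueField R₀) (ResidueField O) := RingHom.toAlgebra c
  have : Algebra.FormallySmooth (ResidueField R₀) (ResidueField O) :=
    formallySmooth_of_perfectField _ _
  refine exists_lift_adicCompletion_of_step (maximalIdeal O) ρ τ f hf fun n g hg1 hg2 => ?_
  have hq0 (j : O ⧸ maximalIdeal O ^ (n + 2))
      (hj : factor (Ideal.pow_le_pow_right (n + 1).le_succ) j = 0) :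
      ∃ x ∈ maximalIdeal O ^ (n + 1), mk _ x = j := by
    obtain ⟨x, rfl⟩ := mk_surjective j
    exact ⟨x, eq_zero_iff_mem.mp hj, rfl⟩
  obtain ⟨h, h1, h2⟩ := exists_lift_of_sq_zero (κ := ResidueField O) hπ ρ
    ((mk (maximalIdeal O ^ (n + 2))).comp τ)
    (factor (Ideal.pow_le_pow_right (n + 1).le_succ)) (factor_surjective _) g
    (fun r => by rw [hg1]; rfl) hnz
    (fun j hj => by
      obtain ⟨x, hx, rfl⟩ := hq0 j hj
      rw [RingHom.comp_apply, ← map_mul, eq_zero_iff_mem, pow_succ']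
      exact Ideal.mul_mem_mul hτ hx)
    (fun j j' hj hj' => by
      obtain ⟨x, hx, rfl⟩ := hq0 j hj
      obtain ⟨x', hx', rfl⟩ := hq0 j' hj'
      rw [← map_mul, eq_zero_iff_mem, pow_succ]
      exact Ideal.mul_mem_mul hx (Ideal.pow_le_self n.succ_ne_zero hx'))
    f hfs hker (fun r => hf r)
  exact ⟨h, h2, h1⟩

/-- The completion of a local ring that contains a field contains a coefficient field. -/
theorem exists_residueField_lift_adicCompletion {F : Type u} {O : Type u} [Field F] [CommRing O]
    [IsLocalRing O] (i : F →+* O) :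
    ∃ g : ResidueField O →+* AdicCompletion (maximalIdeal O) O,
      ∀ a, AdicCompletion.evalOneₐ (maximalIdeal O) (g a) = a := by
  suffices H : ∃ (k : Type) (_ : Field k) (_ : PerfectField k), Nonempty (k →+* O) by
    obtain ⟨k, _, _, ⟨j⟩⟩ := H
    let _ : Algebra k O := j.toAlgebra
    have : Algebra.FormallySmooth k (ResidueField O) := formallySmooth_of_perfectField _ _
    obtain ⟨g, hg⟩ := Algebra.FormallySmooth.exists_adicCompletionEvalOneₐ_comp_eq
      (R := k) (S := O) (I := maximalIdeal O) (A := ResidueField O) (AlgHom.id k (ResidueField O))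
    exact ⟨g, fun a => congr($hg a)⟩
  obtain ⟨p, hp⟩ := CharP.exists F
  rcases CharP.char_is_prime_or_zero F p with hp' | rfl
  · have : Fact p.Prime := ⟨hp'⟩
    exact ⟨ZMod p, inferInstance, inferInstance, ⟨i.comp (ZMod.castHom dvd_rfl F)⟩⟩
  · have : CharZero F := CharP.charP_to_charZero F
    exact ⟨ℚ, inferInstance, inferInstance, ⟨i.comp (algebraMap ℚ F)⟩⟩

/-! ### Power series rings as complete rings -/

lemma AdicCompletion.factorPow_evalₐ {O : Type u} [CommRing O] (m : Ideal O) {k l : ℕ} (h : k ≤ l)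
    (x : AdicCompletion m O) :
    Ideal.Quotient.factorPow m h (AdicCompletion.evalₐ m l x) = AdicCompletion.evalₐ m k x := by
  induction x using AdicCompletion.induction_on with
  | _ a =>
    rw [AdicCompletion.evalₐ_mk, AdicCompletion.evalₐ_mk]
    exact AdicCompletion.Ideal.mk_eq_mk m h a

namespace MvPowerSeries

variable {σ : Type*} {N : Type u} [CommRing N]

/-- The power series whose coefficient at a monomial of degree `k` lies in `I ^ (n - k)`. -/
def filtration (σ : Type*) (I : Ideal N) (n : ℕ) : Ideal (MvPowerSeries σ N) where
  carrier := {f | ∀ e, coeff e f ∈ I ^ (n - e.degree)}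
  zero_mem' e := by simp
  add_mem' hf hg e := by
    rw [map_add]
    exact add_mem (hf e) (hg e)
  smul_mem' g f hf e := by
    classical
    rw [smul_eq_mul, coeff_mul]
    refine sum_mem fun p hp => Ideal.mul_mem_left _ _ ?_
    rw [Finset.HasAntidiagonal.mem_antidiagonal] at hp
    refine Ideal.pow_le_pow_right ?_ (hf p.2)
    have : e.degree = p.1.degree + p.2.degree := by rw [← hp, map_add]
    omega

lemma filtration_mul_le (I : Ideal N) (a b : ℕ) :
    filtration σ I a * filtration σ I b ≤ filtration σ I (a + b) := by
  classical
  rw [Ideal.mul_le]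
  intro f hf g hg e
  rw [coeff_mul]
  refine sum_mem fun p hp => ?_
  rw [Finset.HasAntidiagonal.mem_antidiagonal] at hp
  have : e.degree = p.1.degree + p.2.degree := by rw [← hp, map_add]
  refine Ideal.pow_le_pow_right ?_ (pow_add I _ _ ▸ Ideal.mul_mem_mul (hf p.1) (hg p.2))
  omega

/-- The ideal of the power series ring generated by `I` and the variables. -/
noncomputable def extendedIdeal (σ : Type*) (I : Ideal N) : Ideal (MvPowerSeries σ N) :=
  I.map C ⊔ Ideal.span (Set.range X)

lemma extendedIdeal_pow_le_filtration (I : Ideal N) (n : ℕ) :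
    extendedIdeal σ I ^ n ≤ filtration σ I n := by
  classical
  have h1 : extendedIdeal σ I ≤ filtration σ I 1 := by
    refine sup_le (Ideal.map_le_iff_le_comap.mpr fun a ha e => ?_) (Ideal.span_le.mpr ?_)
    · rw [coeff_C]
      split_ifs with h
      · simpa [h] using ha
      · exact zero_mem _
    · rintro _ ⟨i, rfl⟩ e
      rw [coeff_X]
      split_ifs with h
      · simp [h]
      · exact zero_mem _
  induction n with
  | zero =>
    intro f _ e
    simp
  | succ n ih =>
    rw [pow_succ]
    exact (Ideal.mul_mono ih h1).trans (filtration_mul_le I n 1)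

lemma coeff_eq_zero_of_mem_span_X_pow {n : ℕ} {f : MvPowerSeries σ N}
    (hf : f ∈ Ideal.span (Set.range X) ^ n) {e : σ →₀ ℕ} (he : e.degree < n) : coeff e f = 0 := by
  have h := extendedIdeal_pow_le_filtration (⊥ : Ideal N) n
    (Ideal.pow_right_mono le_sup_right n hf) e
  rwa [← Ideal.zero_eq_bot, zero_pow (by omega)] at h

variable [Finite σ]

lemma mem_span_X_pow {n : ℕ} {f : MvPowerSeries σ N} (hf : ∀ e : σ →₀ ℕ, e.degree < n →
    coeff e f = 0) : f ∈ Ideal.span (Set.range X) ^ n := by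
  have key {k l : ℕ} (h : k ≤ l) : ((truncTotal k f : MvPolynomial σ N) : MvPowerSeries σ N) -
      (truncTotal l f : MvPolynomial σ N) ∈
      (Ideal.span (Set.range X) : Ideal (MvPowerSeries σ N)) ^ k := by
    have h1 := truncTotal_sub_truncTotal_mem_pow_idealOfVars le_rfl h f
    have h2 := Ideal.mem_map_of_mem (MvPolynomial.coeToMvPowerSeries.ringHom (R := N) (σ := σ)) h1
    rw [Ideal.map_pow, Ideal.map_span, ← Set.range_comp, map_sub] at h2
    have h3 : (MvPolynomial.coeToMvPowerSeries.ringHom (R := N) (σ := σ)) ∘ MvPolynomial.X = X :=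
      funext fun i => MvPolynomial.coe_X i
    rwa [h3] at h2
  obtain ⟨L, hL⟩ := IsPrecomplete.prec
    (I := (Ideal.span (Set.range X) : Ideal (MvPowerSeries σ N)))
    (inferInstance : IsPrecomplete _ (MvPowerSeries σ N))
    (f := fun k => ((truncTotal k f : MvPolynomial σ N) : MvPowerSeries σ N))
    (fun {k l} h => by
      rw [SModEq.sub_mem, smul_eq_mul, Ideal.mul_top]
      exact key h)
  have hLf : L = f := by
    ext e
    have h := hL (e.degree + 1)
    rw [SModEq.sub_mem, smul_eq_mul, Ideal.mul_top] at h
    have h' := coeff_eq_zero_of_mem_span_X_pow h (Nat.lt_succ_self _)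
    rw [map_sub, MvPolynomial.coeff_coe, coeff_truncTotal _ (Nat.lt_succ_self _), sub_eq_zero] at h'
    exact h'.symm
  have h := hL n
  have h0 : truncTotal n f = 0 := by
    ext e
    by_cases he : e.degree < n
    · rw [coeff_truncTotal _ he, hf e he, MvPolynomial.coeff_zero]
    · rw [coeff_truncTotal_eq_zero _ (not_lt.mp he), MvPolynomial.coeff_zero]
  rw [SModEq.sub_mem, smul_eq_mul, Ideal.mul_top, hLf, h0, MvPolynomial.coe_zero, zero_sub,
    neg_mem_iff] at h
  exact h

lemma sub_truncTotal_mem_span_X_pow (n : ℕ) (f : MvPowerSeries σ N) :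
    f - (truncTotal n f : MvPolynomial σ N) ∈
      (Ideal.span (Set.range X) : Ideal (MvPowerSeries σ N)) ^ n := by
  refine mem_span_X_pow fun e he => ?_
  rw [map_sub, MvPolynomial.coeff_coe, coeff_truncTotal _ he, sub_self]

lemma monomial_mem_extendedIdeal_pow (I : Ideal N) (n : ℕ) (e : σ →₀ ℕ) {a : N}
    (ha : a ∈ I ^ (n - e.degree)) : monomial e a ∈ extendedIdeal σ I ^ n := by
  have h1 : (monomial e a : MvPowerSeries σ N) = C a * monomial e 1 := by
    rw [← smul_eq_C_mul, ← map_smul, smul_eq_mul, mul_one]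
  have h2 : (monomial e 1 : MvPowerSeries σ N) ∈ extendedIdeal σ I ^ e.degree := by
    refine Ideal.pow_right_mono le_sup_right _ (mem_span_X_pow fun e' he' => ?_)
    classical
    rw [coeff_monomial, if_neg]
    rintro rfl
    exact lt_irrefl _ he'
  have h3 : (C a : MvPowerSeries σ N) ∈ extendedIdeal σ I ^ (n - e.degree) := by
    refine Ideal.pow_right_mono le_sup_left _ ?_
    rw [← Ideal.map_pow]
    exact Ideal.mem_map_of_mem _ ha
  rw [h1]
  refine Ideal.pow_le_pow_right ?_ (pow_add (extendedIdeal σ I) _ _ ▸ Ideal.mul_mem_mul h3 h2)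
  omega

lemma filtration_le_extendedIdeal_pow (I : Ideal N) (n : ℕ) :
    filtration σ I n ≤ extendedIdeal σ I ^ n := by
  intro f hf
  have h1 := Ideal.pow_right_mono (le_sup_right : _ ≤ extendedIdeal σ I) n
    (sub_truncTotal_mem_span_X_pow n f)
  rw [← sub_add_cancel f (truncTotal n f : MvPolynomial σ N)]
  refine add_mem h1 ?_
  rw [MvPolynomial.as_sum (truncTotal n f)]
  change MvPolynomial.coeToMvPowerSeries.ringHom _ ∈ _
  rw [map_sum]
  refine sum_mem fun e he => ?_
  change ((MvPolynomial.monomial e _ : MvPolynomial σ N) : MvPowerSeries σ N) ∈ _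
  rw [MvPolynomial.coe_monomial]
  refine monomial_mem_extendedIdeal_pow I n e ?_
  have hlt : e.degree < n := by
    by_contra h
    exact (MvPolynomial.mem_support_iff.mp he) (coeff_truncTotal_eq_zero _ (not_lt.mp h))
  rw [coeff_truncTotal _ hlt]
  exact hf e

lemma extendedIdeal_pow_eq (I : Ideal N) (n : ℕ) :
    extendedIdeal σ I ^ n = filtration σ I n :=
  le_antisymm (extendedIdeal_pow_le_filtration I n) (filtration_le_extendedIdeal_pow I n)

/-- Power series over a precomplete ring: the limit is taken coefficient by coefficient. -/
lemma isPrecomplete_extendedIdeal (I : Ideal N) [hI : IsPrecomplete I N] :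
    IsPrecomplete (extendedIdeal σ I) (MvPowerSeries σ N) := by
  refine ⟨fun f hf => ?_⟩
  have hf' {k l : ℕ} (h : k ≤ l) (e) : coeff e (f k - f l) ∈ I ^ (k - e.degree) := by
    have := hf h
    rw [SModEq.sub_mem, smul_eq_mul, Ideal.mul_top, extendedIdeal_pow_eq] at this
    exact this e
  have H (e : σ →₀ ℕ) : ∃ c : N, ∀ k, coeff e (f (k + e.degree)) - c ∈ I ^ k := by
    obtain ⟨c, hc⟩ := hI.prec (f := fun k => coeff e (f (k + e.degree))) (fun {k l} h => by
      rw [SModEq.sub_mem, smul_eq_mul, Ideal.mul_top, ← map_sub]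
      have := hf' (Nat.add_le_add_right h e.degree) e
      rwa [Nat.add_sub_cancel] at this)
    refine ⟨c, fun k => ?_⟩
    have := hc k
    rwa [SModEq.sub_mem, smul_eq_mul, Ideal.mul_top] at this
  choose c hc using H
  let L : MvPowerSeries σ N := fun e => c e
  refine ⟨L, fun n => ?_⟩
  rw [SModEq.sub_mem, smul_eq_mul, Ideal.mul_top, extendedIdeal_pow_eq]
  intro e
  rw [map_sub]
  change coeff e (f n) - c e ∈ _
  by_cases h : e.degree ≤ n
  · have := hc e (n - e.degree)
    rwa [Nat.sub_add_cancel h] at this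
  · rw [Nat.sub_eq_zero_of_le (not_le.mp h).le, pow_zero, Ideal.one_eq_top]
    exact Submodule.mem_top

lemma maximalIdeal_eq_extendedIdeal [IsLocalRing N] :
    maximalIdeal (MvPowerSeries σ N) = extendedIdeal σ (maximalIdeal N) := by
  have h : extendedIdeal σ (maximalIdeal N) = filtration σ (maximalIdeal N) 1 := by
    rw [← extendedIdeal_pow_eq, pow_one]
  refine le_antisymm (fun f hf => ?_) ?_
  · rw [h]
    intro e
    by_cases he : e = 0
    · subst he
      rw [map_zero, Nat.sub_zero, pow_one, mem_maximalIdeal, mem_nonunits_iff]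
      rw [mem_maximalIdeal, mem_nonunits_iff, isUnit_iff_constantCoeff] at hf
      exact hf
    · have : 1 ≤ e.degree := by
        rw [Nat.one_le_iff_ne_zero]
        exact fun h => he ((Finsupp.degree_eq_zero_iff e).mp h)
      rw [Nat.sub_eq_zero_of_le this, pow_zero, Ideal.one_eq_top]
      exact Submodule.mem_top
  · rw [h]
    intro f hf
    have h0 := hf 0
    rw [map_zero, Nat.sub_zero, pow_one, mem_maximalIdeal, mem_nonunits_iff] at h0
    rw [mem_maximalIdeal, mem_nonunits_iff, isUnit_iff_constantCoeff]
    exact h0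

lemma maximalIdeal_eq_span [IsLocalRing N] {τ : Type*} {a : τ → N}
    (ha : Ideal.span (Set.range a) = maximalIdeal N) :
    Ideal.span (Set.range (Sum.elim (fun i => C (a i)) X)) = maximalIdeal (MvPowerSeries σ N) := by
  rw [maximalIdeal_eq_extendedIdeal, extendedIdeal, ← ha, Ideal.map_span, ← Set.range_comp,
    Set.Sum.elim_range, Ideal.span_union]
  rfl

instance isPrecomplete_maximalIdeal [IsLocalRing N] [IsPrecomplete (maximalIdeal N) N] :
    IsPrecomplete (maximalIdeal (MvPowerSeries σ N)) (MvPowerSeries σ N) := by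
  rw [maximalIdeal_eq_extendedIdeal]
  exact isPrecomplete_extendedIdeal _

/-- Evaluation of power series over `N` at elements `y` of an ideal `m`, with values in the
`m`-adic completion. -/
lemma exists_eval_adicCompletion {O : Type u} [CommRing O] (m : Ideal O)
    (φ : N →+* AdicCompletion m O) (y : σ → O) (hy : ∀ i, y i ∈ m) :
    ∃ ψ : MvPowerSeries σ N →+* AdicCompletion m O,
      (∀ a, ψ (C a) = φ a) ∧ ∀ i, ψ (X i) = algebraMap O _ (y i) := by
  let ev (n : ℕ) : MvPolynomial σ N →+* O ⧸ m ^ n :=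
    MvPolynomial.eval₂Hom ((AdicCompletion.evalₐ m n : _ →+* _).comp φ)
      (fun i => Ideal.Quotient.mk _ (y i))
  have hev (n : ℕ) (p) (hp : p ∈ MvPolynomial.idealOfVars σ N ^ n) : ev n p = 0 := by
    have hle : MvPolynomial.idealOfVars σ N ≤ (m.map (Ideal.Quotient.mk (m ^ n))).comap (ev n) := by
      rw [MvPolynomial.idealOfVars, Ideal.span_le]
      rintro _ ⟨i, rfl⟩
      change ev n (MvPolynomial.X i) ∈ m.map (Ideal.Quotient.mk (m ^ n))
      rw [MvPolynomial.eval₂Hom_X']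
      exact Ideal.mem_map_of_mem _ (hy i)
    have h := ((Ideal.pow_right_mono hle n).trans (Ideal.le_comap_pow _ n)) hp
    rwa [← Ideal.map_pow, Ideal.map_quotient_self, Ideal.mem_comap, Ideal.mem_bot] at h
  let F (n : ℕ) : MvPowerSeries σ N →+* O ⧸ m ^ n :=
    (Ideal.Quotient.lift _ (ev n) (hev n)).comp (truncTotalAlgHom σ N n).toRingHom
  have hF (n : ℕ) (f : MvPowerSeries σ N) : F n f = ev n (truncTotal n f) := rfl
  have hcompat {k l : ℕ} (h : k ≤ l) : (Ideal.Quotient.factorPow m h).comp (ev l) = ev k := by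
    refine MvPolynomial.ringHom_ext (fun a => ?_) (fun i => ?_)
    · rw [RingHom.comp_apply, MvPolynomial.eval₂Hom_C, MvPolynomial.eval₂Hom_C]
      exact AdicCompletion.factorPow_evalₐ m h (φ a)
    · rw [RingHom.comp_apply, MvPolynomial.eval₂Hom_X', MvPolynomial.eval₂Hom_X']
      rfl
  have hFc {k l : ℕ} (h : k ≤ l) : (Ideal.Quotient.factorPow m h).comp (F l) = F k := by
    refine RingHom.ext fun f => ?_
    rw [RingHom.comp_apply, hF, hF, ← RingHom.comp_apply, hcompat h, ← sub_eq_zero, ← map_sub]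
    exact hev k _ (truncTotal_sub_truncTotal_mem_pow_idealOfVars h le_rfl f)
  have hFp (n : ℕ) (p : MvPolynomial σ N) : F n p = ev n p := by
    rw [hF, ← sub_eq_zero, ← map_sub]
    refine hev n _ ((MvPolynomial.mem_pow_idealOfVars_iff' _ _).mpr fun e he => ?_)
    rw [MvPolynomial.coeff_sub, coeff_truncTotal _ he, MvPolynomial.coeff_coe, sub_self]
  refine ⟨AdicCompletion.liftRingHom m F hFc, fun a => ?_, fun i => ?_⟩
  · refine AdicCompletion.ext_evalₐ fun n => ?_
    rw [AdicCompletion.evalₐ_liftRingHom, ← MvPolynomial.coe_C, hFp, MvPolynomial.eval₂Hom_C]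
    rfl
  · refine AdicCompletion.ext_evalₐ fun n => ?_
    rw [AdicCompletion.evalₐ_liftRingHom, ← MvPolynomial.coe_X, hFp, MvPolynomial.eval₂Hom_X',
      AdicCompletion.algebraMap_apply, AdicCompletion.evalₐ_of, Algebra.algebraMap_self_apply]

end MvPowerSeries

/-! ### Presentations of complete regular local rings -/

lemma AdicCompletion.maximalIdeal_eq_span {O : Type u} [CommRing O] [IsLocalRing O]
    [IsNoetherianRing O] {ι : Type*} {y : ι → O}
    (hy : Ideal.span (Set.range y) = maximalIdeal O) :
    maximalIdeal (AdicCompletion (maximalIdeal O) O) =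
      Ideal.span (Set.range fun i => algebraMap O (AdicCompletion (maximalIdeal O) O) (y i)) := by
  have h := congrArg (Ideal.map (algebraMap O (AdicCompletion (maximalIdeal O) O))) hy
  rw [AdicCompletion.maximalIdeal_eq_map, ← h, Ideal.map_span, ← Set.range_comp]
  rfl

lemma AdicCompletion.evalOneₐ_eq_zero_iff {O : Type u} [CommRing O] [IsLocalRing O]
    [IsNoetherianRing O] {x : AdicCompletion (maximalIdeal O) O} :
    AdicCompletion.evalOneₐ (maximalIdeal O) x = 0 ↔
      x ∈ maximalIdeal (AdicCompletion (maximalIdeal O) O) := by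
  rw [AdicCompletion.maximalIdeal_eq_map,
    ← AdicCompletion.ker_evalOneₐ_eq_map (maximalIdeal O) (IsNoetherian.noetherian _)]
  rfl

/-- A complete Noetherian local ring `Q` whose maximal ideal is generated by elements `z`
maps isomorphically onto the completion of a regular local ring `O` if `z` goes to a regular system
of parameters and the residue fields agree: surjectivity holds by completeness, and injectivity
because a regular system of parameters is quasi-regular. -/
theorem IsRegularSystem.bijective_of_isPrecomplete {O Q : Type u} [CommRing O] [IsLocalRing O]
    [IsNoetherianRing O] {ι : Type*} [Fintype ι] {y : ι → O} (hy : IsRegularSystem y)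
    [CommRing Q] [IsLocalRing Q] [IsNoetherianRing Q] [IsPrecomplete (maximalIdeal Q) Q]
    {z : ι → Q} (hz : Ideal.span (Set.range z) = maximalIdeal Q)
    (ψ : Q →+* AdicCompletion (maximalIdeal O) O) (hψ : ∀ i, ψ (z i) = algebraMap O _ (y i))
    (hs : ∀ a, ∃ q, AdicCompletion.evalOneₐ (maximalIdeal O) (ψ q) = a) :
    Function.Bijective ψ := by
  have hmap : (maximalIdeal Q).map ψ = maximalIdeal (AdicCompletion (maximalIdeal O) O) := by
    rw [AdicCompletion.maximalIdeal_eq_span hy.span_range, ← hz, Ideal.map_span, ← Set.range_comp]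
    congr 2
    exact funext hψ
  constructor
  · rw [injective_iff_map_eq_zero]
    intro f hf
    have key (n : ℕ) : f ∈ maximalIdeal Q ^ n := by
      induction n with
      | zero => simp
      | succ n ih =>
        rw [← hz] at ih
        obtain ⟨F, hF, hFf⟩ :=
          (Ideal.mem_span_pow_iff_exists_isHomogeneous ..).mp ih
        let θ : Q →+* O ⧸ maximalIdeal O ^ (n + 1) :=
          (AdicCompletion.evalₐ (maximalIdeal O) (n + 1) : _ →+* _).comp ψ
        choose s hs' using Ideal.Quotient.mk_surjective (I := maximalIdeal O ^ (n + 1))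
        -- a form over `O` with the same values modulo `𝔪ⁿ⁺¹` as `F`
        let G : MvPolynomial ι O :=
          ∑ e ∈ F.support, MvPolynomial.monomial e (s (θ (F.coeff e)))
        have hG : G.IsHomogeneous n := by
          refine MvPolynomial.IsHomogeneous.sum _ _ _ fun e he => ?_
          refine MvPolynomial.isHomogeneous_monomial _ ?_
          by_contra hne
          exact MvPolynomial.mem_support_iff.mp he (hF.coeff_eq_zero hne)
        have hGF : MvPolynomial.map (Ideal.Quotient.mk _) G = MvPolynomial.map θ F := by
          conv_rhs => rw [F.as_sum]
          rw [map_sum, map_sum]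
          refine Finset.sum_congr rfl fun e _ => ?_
          rw [MvPolynomial.map_monomial, MvPolynomial.map_monomial, hs']
        have hGe : MvPolynomial.eval y G ∈ maximalIdeal O ^ (n + 1) := by
          have h1 : (Ideal.Quotient.mk (maximalIdeal O ^ (n + 1)) ∘ y) = θ ∘ z := by
            funext i
            rw [Function.comp_apply, Function.comp_apply, RingHom.comp_apply, hψ,
              AdicCompletion.algebraMap_apply]
            exact (AdicCompletion.evalₐ_of _ _ _).symm
          rw [← Ideal.Quotient.eq_zero_iff_mem, MvPolynomial.map_eval, hGF, h1,
            ← MvPolynomial.map_eval, hFf, RingHom.comp_apply, hf, map_zero]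
        have hc (e) : F.coeff e ∈ maximalIdeal Q := by
          by_contra hu
          have hu' : IsUnit (F.coeff e) := by
            by_contra h
            exact hu h
          have h1 := congrArg (MvPolynomial.coeff e) hGF
          rw [MvPolynomial.coeff_map, MvPolynomial.coeff_map] at h1
          have h2 : ¬ IsUnit (θ (F.coeff e)) := by
            rw [← h1]
            intro h
            have h3 : Ideal.Quotient.factor (Ideal.pow_le_self n.succ_ne_zero)
                (Ideal.Quotient.mk (maximalIdeal O ^ (n + 1)) (G.coeff e)) = 0 := by
              rw [Ideal.Quotient.factor_mk, Ideal.Quotient.eq_zero_iff_mem]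
              exact hy.coeff_mem_maximalIdeal hG hGe e
            exact (h.map (Ideal.Quotient.factor (Ideal.pow_le_self n.succ_ne_zero))).ne_zero h3
          exact h2 (hu'.map θ)
        have := hF.eval_mem hc (J := maximalIdeal Q) (y := z) fun i => by
          rw [← hz]
          exact Ideal.subset_span ⟨i, rfl⟩
        rwa [hFf, ← pow_succ'] at this
    refine (inferInstance : IsHausdorff (maximalIdeal Q) Q).haus f fun n => ?_
    rw [SModEq.zero, smul_eq_mul, Ideal.mul_top]
    exact key n
  · have : IsHausdorff ((maximalIdeal Q).map ψ) (AdicCompletion (maximalIdeal O) O) := by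
      rw [hmap]
      infer_instance
    refine surjective_of_mk_map_comp_surjective (I := maximalIdeal Q) ψ fun a => ?_
    obtain ⟨x, rfl⟩ := Ideal.Quotient.mk_surjective a
    obtain ⟨q, hq⟩ := hs (AdicCompletion.evalOneₐ (maximalIdeal O) x)
    refine ⟨q, ?_⟩
    rw [RingHom.comp_apply, Ideal.Quotient.eq, hmap]
    exact AdicCompletion.evalOneₐ_eq_zero_iff.mp (by rw [map_sub, hq, sub_self])

/-- The completion of a regular local ring is a power series ring over a complete Noetherian local
ring `N` whose maximal ideal is generated by part of a regular system of parameters. -/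
theorem IsRegularSystem.exists_equiv_mvPowerSeries {O N : Type u} [CommRing O] [IsLocalRing O]
    [IsNoetherianRing O] {κ : Type*} [Fintype κ] {d : ℕ} {w : κ → O} {z : Fin d → O}
    (h : IsRegularSystem (Sum.elim w z)) [CommRing N] [IsLocalRing N] [IsNoetherianRing N]
    [IsPrecomplete (maximalIdeal N) N] {a : κ → N}
    (ha : Ideal.span (Set.range a) = maximalIdeal N)
    (φ : N →+* AdicCompletion (maximalIdeal O) O) (hφ : ∀ i, φ (a i) = algebraMap O _ (w i))
    (hs : ∀ c, ∃ q, AdicCompletion.evalOneₐ (maximalIdeal O) (φ q) = c) :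
    ∃ e : AdicCompletion (maximalIdeal O) O ≃+* MvPowerSeries (Fin d) N,
      ∀ c, e (φ c) = MvPowerSeries.C c := by
  obtain ⟨ψ, hψC, hψX⟩ := MvPowerSeries.exists_eval_adicCompletion (maximalIdeal O) φ z
    (fun i => h.mem (Sum.inr i))
  have hb := h.bijective_of_isPrecomplete (MvPowerSeries.maximalIdeal_eq_span (σ := Fin d) ha) ψ
    (by
      rintro (i | i)
      · exact (hψC _).trans (hφ i)
      · exact hψX i)
    (fun c => by
      obtain ⟨q, hq⟩ := hs c
      exact ⟨MvPowerSeries.C q, by rw [hψC, hq]⟩)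
  refine ⟨(RingEquiv.ofBijective ψ hb).symm, fun c => ?_⟩
  rw [RingEquiv.symm_apply_eq]
  exact (hψC c).symm

/-- A regular local ring that contains a field has a power series ring as its completion. -/
theorem IsRegularLocalRing.exists_equiv_mvPowerSeries_field {F O : Type u} [Field F] [CommRing O]
    [IsRegularLocalRing O] (i : F →+* O) :
    ∃ (K : Type u) (_ : Field K) (d : ℕ),
      Nonempty (AdicCompletion (maximalIdeal O) O ≃+* MvPowerSeries (Fin d) K) := by
  obtain ⟨d, y, hy⟩ := IsRegularLocalRing.exists_isRegularSystem O
  obtain ⟨g, hg⟩ := exists_residueField_lift_adicCompletion i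
  have h : IsRegularSystem (Sum.elim (fun i : Empty => i.elim) y) := by
    have := hy.comp_equiv (Equiv.emptySum Empty (Fin d))
    convert this using 1
    funext i
    rcases i with i | i
    · exact i.elim
    · rfl
  have hbot : maximalIdeal (ResidueField O) = ⊥ := IsLocalRing.maximalIdeal_eq_bot
  have : IsPrecomplete (maximalIdeal (ResidueField O)) (ResidueField O) := by
    rw [hbot]
    infer_instance
  obtain ⟨e, -⟩ := h.exists_equiv_mvPowerSeries (N := ResidueField O)
    (a := fun i : Empty => i.elim) (by rw [hbot, Set.range_eq_empty, Ideal.span_empty]) g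
    (fun i => i.elim) (fun c => ⟨c, hg c⟩)
  exact ⟨_, inferInstance, d, ⟨e⟩⟩

/-- The completion of a one-dimensional regular local ring is a discrete valuation ring. -/
theorem IsRegularSystem.isDiscreteValuationRing_adicCompletion {S₀ : Type u} [CommRing S₀]
    [IsLocalRing S₀] [IsNoetherianRing S₀] {ϖ : S₀} (h : IsRegularSystem (fun _ : Unit => ϖ)) :
    ∃ _ : IsDomain (AdicCompletion (maximalIdeal S₀) S₀),
      IsDiscreteValuationRing (AdicCompletion (maximalIdeal S₀) S₀) ∧
      Irreducible (algebraMap S₀ (AdicCompletion (maximalIdeal S₀) S₀) ϖ) ∧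
      maximalIdeal (AdicCompletion (maximalIdeal S₀) S₀) =
        Ideal.span {algebraMap S₀ (AdicCompletion (maximalIdeal S₀) S₀) ϖ} := by
  have hspan : maximalIdeal S₀ = Ideal.span {ϖ} := by
    rw [← h.span_range, Set.range_const]
  have := h.isDomain
  have h0 : ϖ ≠ 0 := by
    have h' : IsRegularSystem (fun o : Option Empty => o.elim ϖ (fun i => i.elim)) := by
      have := h.comp_equiv (Equiv.ofUnique (Option Empty) Unit)
      convert this using 1
      funext o
      rcases o with _ | i
      · rfl
      · exact i.elim
    exact h'.ne_zero_option
  have hnu : ¬ IsUnit ϖ := (mem_maximalIdeal _).mp (h.mem ())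
  let S := AdicCompletion (maximalIdeal S₀) S₀
  let p : S := algebraMap S₀ S ϖ
  have hm : maximalIdeal S = Ideal.span {p} := by
    rw [AdicCompletion.maximalIdeal_eq_span h.span_range, Set.range_const]
  have hpow (n : ℕ) : p ^ n ≠ 0 := by
    intro hp
    have h1 : AdicCompletion.evalₐ (maximalIdeal S₀) (n + 1) (p ^ n) =
        Ideal.Quotient.mk _ (ϖ ^ n) := by
      rw [← map_pow, AdicCompletion.algebraMap_apply, AdicCompletion.evalₐ_of]
      rfl
    rw [hp, map_zero, eq_comm, Ideal.Quotient.eq_zero_iff_mem, hspan, Ideal.span_singleton_pow,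
      Ideal.mem_span_singleton] at h1
    obtain ⟨c, hc⟩ := h1
    rw [pow_succ, mul_assoc] at hc
    exact hnu (IsUnit.of_mul_eq_one c (mul_left_cancel₀ (pow_ne_zero n h0) (by rw [mul_one, ← hc])))
  have hfac (x : S) (hx : x ≠ 0) : ∃ n : ℕ, Associated (p ^ n) x := by
    classical
    have hex : ∃ n, x ∉ maximalIdeal S ^ n := by
      by_contra! hall
      refine hx ((inferInstance : IsHausdorff (maximalIdeal S) S).haus x fun n => ?_)
      rw [SModEq.zero, smul_eq_mul, Ideal.mul_top]
      exact hall n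
    obtain ⟨n, hn⟩ : ∃ n, Nat.find hex = n + 1 := by
      refine Nat.exists_eq_succ_of_ne_zero fun h => ?_
      have := Nat.find_spec hex
      rw [h, pow_zero, Ideal.one_eq_top] at this
      exact this Submodule.mem_top
    have h1 : x ∈ maximalIdeal S ^ n := by
      by_contra h
      exact Nat.find_min hex (by omega) h
    have h2 : x ∉ maximalIdeal S ^ (n + 1) := hn ▸ Nat.find_spec hex
    rw [hm, Ideal.span_singleton_pow, Ideal.mem_span_singleton] at h1
    obtain ⟨c, rfl⟩ := h1
    have hc : IsUnit c := by
      by_contra hc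
      refine h2 ?_
      have : c ∈ maximalIdeal S := hc
      rw [pow_succ]
      refine Ideal.mul_mem_mul (Ideal.pow_mem_pow ?_ n) this
      rw [hm]
      exact Ideal.mem_span_singleton_self p
    exact ⟨n, hc.unit, rfl⟩
  have hdom : IsDomain S := by
    have : NoZeroDivisors S := ⟨fun {a b} hab => by
      by_contra! hne
      obtain ⟨n, u, hu⟩ := hfac a hne.1
      obtain ⟨k, v, hv⟩ := hfac b hne.2
      refine hpow (n + k) ?_
      rw [← hu, ← hv] at hab
      have h1 : p ^ (n + k) * ((u * v : Sˣ) : S) = 0 := by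
        rw [← hab, Units.val_mul]
        ring
      exact (Units.mul_left_eq_zero _).mp h1⟩
    exact NoZeroDivisors.to_isDomain S
  have hirr : Irreducible p := by
    have hp : Prime p := by
      rw [← Ideal.span_singleton_prime (by simpa using hpow 1), ← hm]
      infer_instance
    exact hp.irreducible
  exact ⟨hdom, IsDiscreteValuationRing.ofHasUnitMulPowIrreducibleFactorization ⟨p, hirr,
    fun {x} hx => hfac x hx⟩, hirr, hm⟩

/-! ### The structure of completions of regular local rings -/

/-- A discrete valuation ring `S`, complete and unramified over `R₀`, that maps to the completion
of `O` and has the same residue field: the completion of a one-dimensional regular local ring with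
parameter `π` and the residue field of `O`. -/
theorem exists_coefficient_dvr {R₀ S₀ O : Type u} [CommRing R₀] [IsLocalRing R₀]
    [PerfectField (ResidueField R₀)] {π : R₀} (hπ : maximalIdeal R₀ = Ideal.span {π})
    [CommRing S₀] [IsLocalRing S₀] [IsNoetherianRing S₀] [CommRing O] [IsLocalRing O]
    (ρ₀ : R₀ →+* S₀) (hS₀ : IsRegularSystem (fun _ : Unit => ρ₀ π)) (τ : R₀ →+* O)
    (hτ : τ π ∈ maximalIdeal O) (f₀ : S₀ →+* O ⧸ maximalIdeal O)
    (hf₀ : ∀ r, f₀ (ρ₀ r) = Ideal.Quotient.mk _ (τ r)) (hf₀s : Function.Surjective f₀) :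
    ∃ (S : Type u) (_ : CommRing S) (_ : IsDomain S) (_ : IsDiscreteValuationRing S)
      (ρ : R₀ →+* S) (φ : S →+* AdicCompletion (maximalIdeal O) O),
      IsAdicComplete (maximalIdeal S) S ∧ Irreducible (ρ π) ∧
        (∀ r, φ (ρ r) = algebraMap O _ (τ r)) ∧
        ∀ c, ∃ q, AdicCompletion.evalOneₐ (maximalIdeal O) (φ q) = c := by
  obtain ⟨hdom, hdvr, hirr, hm⟩ := hS₀.isDiscreteValuationRing_adicCompletion
  have hm₀ (a : S₀) (ha : a ∈ maximalIdeal S₀) : f₀ a = 0 := by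
    rw [← hS₀.span_range, Set.range_const, Ideal.mem_span_singleton] at ha
    obtain ⟨b, rfl⟩ := ha
    rw [map_mul, hf₀, Ideal.Quotient.eq_zero_iff_mem.mpr hτ, zero_mul]
  let f₁ : ResidueField S₀ →+* O ⧸ maximalIdeal O := Ideal.Quotient.lift _ f₀ hm₀
  have hf₁ (a : S₀) : f₁ (Ideal.Quotient.mk _ a) = f₀ a := rfl
  have hf₁i : Function.Injective f₁ := f₁.injective
  let ρ : R₀ →+* AdicCompletion (maximalIdeal S₀) S₀ := (algebraMap S₀ _).comp ρ₀
  let f : AdicCompletion (maximalIdeal S₀) S₀ →+* O ⧸ maximalIdeal O :=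
    f₁.comp (AdicCompletion.evalOneₐ (maximalIdeal S₀) : _ →+* S₀ ⧸ maximalIdeal S₀)
  have hfs : Function.Surjective f := fun c => by
    obtain ⟨a, rfl⟩ := hf₀s c
    exact ⟨algebraMap S₀ _ a, rfl⟩
  have hker (s) : f s = 0 ↔ ρ π ∣ s := by
    rw [← Ideal.mem_span_singleton]
    change f₁ (AdicCompletion.evalOneₐ (maximalIdeal S₀) s) = 0 ↔ s ∈ Ideal.span
      {algebraMap S₀ (AdicCompletion (maximalIdeal S₀) S₀) (ρ₀ π)}
    rw [← hm, ← AdicCompletion.evalOneₐ_eq_zero_iff]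
    exact map_eq_zero_iff f₁ hf₁i
  obtain ⟨φ, hφ1, hφ2⟩ := exists_lift_adicCompletion hπ ρ τ hτ
    (mem_nonZeroDivisors_of_ne_zero hirr.ne_zero) f (fun r => hf₀ r) hfs hker
  exact ⟨AdicCompletion (maximalIdeal S₀) S₀, inferInstance, hdom, hdvr, ρ, φ, inferInstance, hirr,
    hφ2, fun c => (hfs c).imp fun q hq => (hφ1 q).trans hq⟩

/-- The completion of a regular local ring with `π` among its parameters is a power series ring
over a discrete valuation ring. -/
theorem IsRegularSystem.exists_equiv_mvPowerSeries_dvr {R₀ O : Type u} [CommRing R₀]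
    [IsLocalRing R₀] [PerfectField (ResidueField R₀)] {π : R₀}
    (hπ : maximalIdeal R₀ = Ideal.span {π}) [CommRing O] [IsLocalRing O] [IsNoetherianRing O]
    (τ : R₀ →+* O) {d : ℕ} {z : Fin d → O}
    (h : IsRegularSystem (fun o : Option (Fin d) => o.elim (τ π) z)) :
    ∃ (S : Type u) (_ : CommRing S) (_ : IsDomain S) (_ : IsDiscreteValuationRing S) (d : ℕ),
      Nonempty (AdicCompletion (maximalIdeal O) O ≃+* MvPowerSeries (Fin d) S) := by
  have h1 : IsRegularSystem (Sum.elim (fun _ : Unit => τ π) z) := by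
    have := h.comp_equiv ((Equiv.sumComm Unit (Fin d)).trans
      (Equiv.optionEquivSumPUnit (Fin d)).symm)
    convert this using 1
    funext i
    rcases i with i | i <;> rfl
  have h2 : IsRegularSystem (Sum.elim z (fun _ : Unit => τ π)) := by
    have := h1.comp_equiv (Equiv.sumComm (Fin d) Unit)
    convert this using 1
    funext i
    rcases i with i | i <;> rfl
  let J := Ideal.span (Set.range z)
  have hJ : J ≤ maximalIdeal O := h2.span_le_maximalIdeal
  have : IsLocalRing (O ⧸ J) := IsRegularSystem.isLocalRing_quotient hJ
  obtain ⟨S, _, _, _, ρ, φ, hS, hirr, hφ, hs⟩ := exists_coefficient_dvr hπ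
    ((Ideal.Quotient.mk J).comp τ) h2.quotient τ (h.mem none) (Ideal.Quotient.factor hJ)
    (fun r => rfl) (Ideal.Quotient.factor_surjective hJ)
  obtain ⟨e, -⟩ := h1.exists_equiv_mvPowerSeries (N := S) (a := fun _ => ρ π)
    (by rw [Set.range_const, hirr.maximalIdeal_eq]) φ (fun _ => hφ π) hs
  exact ⟨S, _, ‹_›, ‹_›, d, ⟨e⟩⟩

lemma isPrecomplete_maximalIdeal_quotient {Q : Type u} [CommRing Q] [IsLocalRing Q]
    [IsPrecomplete (maximalIdeal Q) Q] (J : Ideal Q) [IsLocalRing (Q ⧸ J)] :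
    IsPrecomplete (maximalIdeal (Q ⧸ J)) (Q ⧸ J) := by
  have h1 : IsPrecomplete (maximalIdeal Q) (Q ⧸ J) := by
    rw [← AdicCompletion.of_surjective_iff]
    let f : Q →ₗ[Q] Q ⧸ J := J.mkQ
    have hf : Function.Surjective f := J.mkQ_surjective
    intro y
    obtain ⟨x, rfl⟩ := AdicCompletion.map_surjective (maximalIdeal Q) hf y
    obtain ⟨q, rfl⟩ := AdicCompletion.of_surjective (maximalIdeal Q) Q x
    exact ⟨f q, (AdicCompletion.map_of ..).symm⟩
  have h2 : maximalIdeal (Q ⧸ J) = (maximalIdeal Q).map (algebraMap Q (Q ⧸ J)) :=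
    IsRegularSystem.map_maximalIdeal_quotient.symm
  rw [h2, IsPrecomplete.map_algebraMap_iff]
  exact h1

section NodeRing

variable {S : Type u} [CommRing S] [IsLocalRing S] {ϖ : S}

lemma nodeRing.relation_le_maximalIdeal (hϖ : ϖ ∈ maximalIdeal S) :
    Ideal.span {(MvPowerSeries.X 0 * MvPowerSeries.X 1 - MvPowerSeries.C ϖ :
      MvPowerSeries (Fin 2) S)} ≤ maximalIdeal _ := by
  rw [Ideal.span_singleton_le_iff_mem, mem_maximalIdeal, mem_nonunits_iff,
    MvPowerSeries.isUnit_iff_constantCoeff]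
  simpa using hϖ

lemma nodeRing.isLocalRing (hϖ : ϖ ∈ maximalIdeal S) : IsLocalRing (nodeRing S ϖ) :=
  IsRegularSystem.isLocalRing_quotient (relation_le_maximalIdeal hϖ)

lemma nodeRing.span_eq_maximalIdeal (hϖ : maximalIdeal S = Ideal.span {ϖ})
    [IsLocalRing (nodeRing S ϖ)] :
    Ideal.span (Set.range fun i : Fin 2 => (Ideal.Quotient.mk _ (MvPowerSeries.X i) :
      nodeRing S ϖ)) = maximalIdeal (nodeRing S ϖ) := by
  have h1 := MvPowerSeries.maximalIdeal_eq_span (σ := Fin 2) (a := fun _ : Unit => ϖ)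
    (by rw [Set.range_const, hϖ])
  rw [← IsRegularSystem.map_maximalIdeal_quotient, ← h1,
    Ideal.map_span]
  refine le_antisymm (Ideal.span_mono ?_) (Ideal.span_le.mpr ?_)
  · rintro _ ⟨i, rfl⟩
    exact ⟨_, ⟨Sum.inr i, rfl⟩, rfl⟩
  · rintro _ ⟨_, ⟨i | i, rfl⟩, rfl⟩
    · have : (Ideal.Quotient.mk _ (MvPowerSeries.C ϖ) : nodeRing S ϖ) =
          Ideal.Quotient.mk _ (MvPowerSeries.X 0) * Ideal.Quotient.mk _ (MvPowerSeries.X 1) := by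
        rw [← map_mul, eq_comm, Ideal.Quotient.eq]
        exact Ideal.mem_span_singleton_self _
      change (Ideal.Quotient.mk _ (MvPowerSeries.C ϖ) : nodeRing S ϖ) ∈ _
      rw [this]
      exact Ideal.mul_mem_right _ _ (Ideal.subset_span ⟨0, rfl⟩)
    · exact Ideal.subset_span ⟨i, rfl⟩

end NodeRing

/-- If `π = t u` for two members `t` and `u` of a regular system of parameters, then the completion
is a power series ring over `S⟦U, V⟧ / (U V - π)`. The ring `S₀` is a one-dimensional regular local
ring over `R₀` with parameter `π` and the same residue field. -/
theorem IsRegularSystem.exists_equiv_mvPowerSeries_nodeRing {R₀ S₀ O : Type u} [CommRing R₀]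
    [IsLocalRing R₀] [PerfectField (ResidueField R₀)] {π : R₀}
    (hπ : maximalIdeal R₀ = Ideal.span {π}) [CommRing S₀] [IsLocalRing S₀] [IsNoetherianRing S₀]
    [CommRing O] [IsLocalRing O] [IsNoetherianRing O] (ρ₀ : R₀ →+* S₀)
    (hS₀ : IsRegularSystem (fun _ : Unit => ρ₀ π)) (τ : R₀ →+* O)
    (f₀ : S₀ →+* O ⧸ maximalIdeal O) (hf₀ : ∀ r, f₀ (ρ₀ r) = Ideal.Quotient.mk _ (τ r))
    (hf₀s : Function.Surjective f₀) {d : ℕ} {w : Fin 2 → O} {z : Fin d → O}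
    (h : IsRegularSystem (Sum.elim w z)) (hw : τ π = w 0 * w 1) :
    ∃ (S : Type u) (_ : CommRing S) (_ : IsDomain S) (_ : IsDiscreteValuationRing S)
      (ρ : R₀ →+* S) (d : ℕ)
      (e : AdicCompletion (maximalIdeal O) O ≃+* MvPowerSeries (Fin d) (nodeRing S (ρ π))),
      IsAdicComplete (maximalIdeal S) S ∧ Irreducible (ρ π) ∧
        ∀ r : R₀, e (algebraMap _ _ (τ r)) = nodeRing.const S (ρ π) d (ρ r) := by
  have hτ : τ π ∈ maximalIdeal O := hw ▸ Ideal.mul_mem_right _ _ (h.mem (Sum.inl 0))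
  obtain ⟨S, _, _, _, ρ, φ, hS, hirr, hφ, hs⟩ :=
    exists_coefficient_dvr hπ ρ₀ hS₀ τ hτ f₀ hf₀ hf₀s
  have hm : maximalIdeal S = Ideal.span {ρ π} := hirr.maximalIdeal_eq
  have hmem : ρ π ∈ maximalIdeal S := hm ▸ Ideal.mem_span_singleton_self _
  have : IsLocalRing (nodeRing S (ρ π)) := nodeRing.isLocalRing hmem
  have : IsPrecomplete (maximalIdeal (nodeRing S (ρ π))) (nodeRing S (ρ π)) :=
    isPrecomplete_maximalIdeal_quotient _
  obtain ⟨ψ, hψC, hψX⟩ := MvPowerSeries.exists_eval_adicCompletion (maximalIdeal O) φ w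
    (fun i => h.mem (Sum.inl i))
  let χ : nodeRing S (ρ π) →+* AdicCompletion (maximalIdeal O) O := Ideal.Quotient.lift _ ψ (by
    intro a ha
    obtain ⟨b, rfl⟩ := Ideal.mem_span_singleton.mp ha
    rw [map_mul, map_sub, map_mul, hψX, hψX, hψC, hφ, hw, map_mul, sub_self, zero_mul])
  have hχ (a) : χ (Ideal.Quotient.mk _ a) = ψ a := rfl
  obtain ⟨e, he⟩ := h.exists_equiv_mvPowerSeries (nodeRing.span_eq_maximalIdeal hm) χ
    (fun i => (hχ _).trans (hψX i)) (fun c => by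
      obtain ⟨q, hq⟩ := hs c
      exact ⟨Ideal.Quotient.mk _ (MvPowerSeries.C q), by rw [hχ, hψC, hq]⟩)
  refine ⟨S, _, ‹_›, ‹_›, ρ, d, e, hS, hirr, fun r => ?_⟩
  have h1 : χ (Ideal.Quotient.mk _ (MvPowerSeries.C (ρ r))) = algebraMap O _ (τ r) := by
    rw [hχ, hψC, hφ]
  rw [← h1, he]
  rfl

/-! ### Regularity of the charts of the blowup -/

/-- For a flat local homomorphism `A → B` with fibre `C`, regular systems of `A` and `C` combine to
one of `B`. -/
theorem IsRegularSystem.sumElim_of_flat {A B C : Type u} [CommRing A] [IsLocalRing A]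
    [IsNoetherianRing A] [CommRing B] [IsLocalRing B] [IsNoetherianRing B] [CommRing C]
    [IsLocalRing C] [Algebra A B] [Module.Flat A B] [IsLocalHom (algebraMap A B)]
    {ι κ : Type*} [Fintype ι] [Fintype κ] {x : ι → A} (hx : IsRegularSystem x) (q : B →+* C)
    (hq : Function.Surjective q)
    (hker : RingHom.ker q = (maximalIdeal A).map (algebraMap A B)) {z : κ → B}
    (hz : IsRegularSystem (fun i => q (z i))) :
    IsRegularSystem (Sum.elim (fun i => algebraMap A B (x i)) z) := by
  have hqloc : IsLocalHom q := IsLocalHom.of_surjective q hq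
  refine .of_card_le ?_ ?_
  · rw [Set.Sum.elim_range, Ideal.span_union]
    have h1 : Ideal.span (Set.range fun i => algebraMap A B (x i)) = RingHom.ker q := by
      rw [hker, ← hx.span_range, Ideal.map_span, ← Set.range_comp]
      rfl
    have h2 : (Ideal.span (Set.range z)).map q = maximalIdeal C := by
      rw [Ideal.map_span, ← Set.range_comp, ← hz.span_range]
      rfl
    rw [h1, sup_comm, RingHom.ker, ← Ideal.comap_map_of_surjective q hq, h2]
    exact maximalIdeal_comap q
  · have hover : (maximalIdeal B).LiesOver (maximalIdeal A) :=
      ⟨(maximalIdeal_comap (algebraMap A B)).symm⟩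
    have hht := Ideal.height_eq_height_add_of_liesOver_of_hasGoingDown
      (maximalIdeal A) (maximalIdeal B)
    have hle : (maximalIdeal A).map (algebraMap A B) ≤ maximalIdeal B :=
      ((local_hom_TFAE (algebraMap A B)).out 0 2).mp ‹IsLocalHom (algebraMap A B)›
    have : IsLocalRing (B ⧸ (maximalIdeal A).map (algebraMap A B)) :=
      IsRegularSystem.isLocalRing_quotient hle
    rw [IsRegularSystem.map_maximalIdeal_quotient] at hht
    let e : B ⧸ (maximalIdeal A).map (algebraMap A B) ≃+* C :=
      (Ideal.quotEquivOfEq hker.symm).trans (RingHom.quotientKerEquivOfSurjective hq)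
    have hC : ((maximalIdeal (B ⧸ (maximalIdeal A).map (algebraMap A B))).height : WithBot ℕ∞) =
        Fintype.card κ := by
      rw [maximalIdeal_height_eq_ringKrullDim, ringKrullDim_eq_of_ringEquiv e, hz.dim_eq]
    have hA : ((maximalIdeal A).height : WithBot ℕ∞) = Fintype.card ι := by
      rw [maximalIdeal_height_eq_ringKrullDim, hx.dim_eq]
    rw [← maximalIdeal_height_eq_ringKrullDim, hht, WithBot.coe_add, hC, hA, Fintype.card_sum]
    exact_mod_cast le_rfl

/-- A variable does not vanish to second order at any point of affine space over a field, because
its partial derivative is `1`. -/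
lemma MvPolynomial.algebraMap_X_notMem_maximalIdeal_sq {k : Type u} {ι : Type} [Field k]
    (p : Ideal (MvPolynomial ι k)) [p.IsPrime] (i : ι) :
    algebraMap (MvPolynomial ι k) (Localization.AtPrime p) (X i) ∉
      maximalIdeal (Localization.AtPrime p) ^ 2 := by
  intro h
  rw [← Localization.AtPrime.map_eq_maximalIdeal, ← Ideal.map_pow,
    IsLocalization.algebraMap_mem_map_algebraMap_iff p.primeCompl] at h
  obtain ⟨s, hs, h⟩ := h
  have hD (f : MvPolynomial ι k) (hf : f ∈ p ^ 2) : pderiv i f ∈ p := by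
    rw [pow_two] at hf
    refine Submodule.mul_induction_on hf (fun a ha b hb => ?_) fun a b ha hb => ?_
    · rw [Derivation.leibniz]
      exact add_mem (Ideal.mul_mem_right _ _ ha) (Ideal.mul_mem_right _ _ hb)
    · rw [map_add]
      exact add_mem ha hb
  have h1 := hD _ h
  rw [Derivation.leibniz, pderiv_X_self, smul_eq_mul, smul_eq_mul, mul_one] at h1
  have hX : X i ∈ p := by
    have := Ideal.pow_le_self two_ne_zero h
    exact (Ideal.IsPrime.mem_or_mem inferInstance this).resolve_left hs
  exact hs ((Submodule.add_mem_iff_left _ (Ideal.mul_mem_right _ _ hX)).mp h1)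

/-- Clearing denominators: modulo the relations `t Yᵢ = xᵢ`, a multiple of a polynomial in the `Yᵢ`
by a power of `t` is a constant. -/
lemma MvPolynomial.exists_pow_mul_sub_C_mem {A ι : Type*} [CommRing A] (t : A) (x : ι → A)
    (P : MvPolynomial ι A) : ∃ (n : ℕ) (a : A), C t ^ n * P - C a ∈
      Ideal.span (Set.range fun i => C t * X i - C (x i)) := by
  set J := Ideal.span (Set.range fun i => (C t * X i - C (x i) : MvPolynomial ι A)) with hJ
  induction P using MvPolynomial.induction_on with
  | C a => exact ⟨0, a, by simp⟩
  | add p q hp hq =>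
    obtain ⟨n, a, ha⟩ := hp
    obtain ⟨m, b, hb⟩ := hq
    refine ⟨n + m, t ^ m * a + t ^ n * b, ?_⟩
    have : C t ^ (n + m) * (p + q) - C (t ^ m * a + t ^ n * b) =
        C t ^ m * (C t ^ n * p - C a) + C t ^ n * (C t ^ m * q - C b) := by
      simp only [map_add, map_mul, map_pow]
      ring
    rw [this]
    exact add_mem (Ideal.mul_mem_left _ _ ha) (Ideal.mul_mem_left _ _ hb)
  | mul_X p i hp =>
    obtain ⟨n, a, ha⟩ := hp
    refine ⟨n + 1, a * x i, ?_⟩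
    have : C t ^ (n + 1) * (p * X i) - C (a * x i) =
        C t * X i * (C t ^ n * p - C a) + C a * (C t * X i - C (x i)) := by
      simp only [map_mul]
      ring
    rw [this]
    exact add_mem (Ideal.mul_mem_left _ _ ha) (Ideal.mul_mem_left _ _ (Ideal.subset_span ⟨i, rfl⟩))

/-- A regular local ring `B` that maps onto the local ring `O` of a chart of the blowup: the
localization of the polynomial ring `A[Yᵢ]` at the point defined by the values `yᵢ ∈ O`. The ring
`C` is the local ring of the corresponding point of affine space over the residue field of `A`; a
lift of a regular system of `C` completes the given one of `A` to one of `B`. Modulo the relations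
`t Yᵢ = x'ᵢ`, every element of `B` becomes an element of `A` after multiplication by a unit and a
power of `t`. -/
theorem exists_chart_model {A O : Type u} [CommRing A] [IsLocalRing A] [IsNoetherianRing A]
    [CommRing O] [IsLocalRing O] {κ ι : Type} [Fintype κ] [Fintype ι] {x : κ → A}
    (hx : IsRegularSystem x) (φ : A →+* O) [IsLocalHom φ] (y : ι → O)
    (hfrac : ∀ o : O, ∃ P Q : MvPolynomial ι A, IsUnit (MvPolynomial.eval₂ φ y Q) ∧
      o * MvPolynomial.eval₂ φ y Q = MvPolynomial.eval₂ φ y P) :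
    ∃ (B C : Type u) (_ : CommRing B) (_ : IsLocalRing B) (_ : IsNoetherianRing B)
      (_ : CommRing C) (_ : IsRegularLocalRing C) (α : A →+* B) (Y : ι → B) (q : B →+* C)
      (ψ : B →+* O), Function.Surjective ψ ∧ Function.Surjective q ∧ (∀ a, ψ (α a) = φ a) ∧
        (∀ i, ψ (Y i) = y i) ∧
        (∀ (σ : Type) [Fintype σ] (z : σ → B), IsRegularSystem (fun i => q (z i)) →
          IsRegularSystem (Sum.elim (fun i => α (x i)) z)) ∧
        (∀ (t : A) (x' : ι → A) (b : B), ∃ (n : ℕ) (a : A) (s : B), IsUnit s ∧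
          α t ^ n * (s * b) - α a ∈ Ideal.span (Set.range fun i => α t * Y i - α (x' i))) ∧
        ∀ i, y i ∈ maximalIdeal O → q (Y i) ∈ maximalIdeal C ∧ q (Y i) ∉ maximalIdeal C ^ 2 := by
  let ev : MvPolynomial ι A →+* O := MvPolynomial.eval₂Hom φ y
  let Q : Ideal (MvPolynomial ι A) := (maximalIdeal O).comap ev
  have hQ : Q.IsPrime := Ideal.comap_isPrime ev _
  let k := ResidueField A
  let evk : MvPolynomial ι k →+* ResidueField O :=
    MvPolynomial.eval₂Hom (ResidueField.map φ) (fun i => residue O (y i))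
  let Qk : Ideal (MvPolynomial ι k) := RingHom.ker evk
  have hQk : Qk.IsPrime := RingHom.ker_isPrime evk
  let red : MvPolynomial ι A →+* MvPolynomial ι k := MvPolynomial.map (residue A)
  have hred : evk.comp red = (residue O).comp ev := by
    refine MvPolynomial.ringHom_ext (fun a => ?_) (fun i => ?_)
    · simp only [evk, red, ev, RingHom.comp_apply, MvPolynomial.coe_eval₂Hom,
        MvPolynomial.map_C, MvPolynomial.eval₂_C]
      rfl
    · simp [evk, red, ev]
  have hQQ : Q = Qk.comap red := by
    ext P
    rw [Ideal.mem_comap, Ideal.mem_comap, RingHom.mem_ker]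
    have : evk (red P) = residue O (ev P) := congr($hred P)
    rw [this, residue_eq_zero_iff]
  let B := Localization.AtPrime Q
  let C := Localization.AtPrime Qk
  let q : B →+* C := Localization.localRingHom Q Qk red hQQ
  have hqa (P : MvPolynomial ι A) : q (algebraMap _ B P) = algebraMap _ C (red P) :=
    Localization.localRingHom_to_map _ _ _ _ P
  have hu (s : Q.primeCompl) : IsUnit (ev s) := by
    by_contra h
    exact s.2 h
  let ψ : B →+* O := IsLocalization.lift (M := Q.primeCompl) (g := ev) hu
  have hψ (P : MvPolynomial ι A) : ψ (algebraMap _ B P) = ev P := IsLocalization.lift_eq hu P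
  have hredsurj : Function.Surjective red := MvPolynomial.map_surjective _ residue_surjective
  have hqsurj : Function.Surjective q := by
    intro c
    obtain ⟨P, s, rfl⟩ := IsLocalization.exists_mk'_eq Qk.primeCompl c
    obtain ⟨P, rfl⟩ := hredsurj P
    obtain ⟨s', hs'⟩ := hredsurj s
    have hs : s' ∈ Q.primeCompl := fun h => by
      have h' : s' ∈ Qk.comap red := hQQ ▸ h
      rw [Ideal.mem_comap, hs'] at h'
      exact s.2 h'
    refine ⟨IsLocalization.mk' B P ⟨s', hs⟩, ?_⟩
    rw [IsLocalization.eq_mk'_iff_mul_eq, ← hs', ← hqa, ← map_mul, IsLocalization.mk'_spec, hqa]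
  have hα : algebraMap A B = (algebraMap (MvPolynomial ι A) B).comp MvPolynomial.C :=
    IsScalarTower.algebraMap_eq A (MvPolynomial ι A) B
  have hker : RingHom.ker q = (maximalIdeal A).map (algebraMap A B) := by
    have hredker : RingHom.ker red = (maximalIdeal A).map MvPolynomial.C := by
      rw [MvPolynomial.ker_map, ker_residue]
    rw [hα, ← Ideal.map_map, ← hredker]
    refine le_antisymm (fun b hb => ?_) (Ideal.map_le_iff_le_comap.mpr fun P hP => ?_)
    · obtain ⟨P, s, rfl⟩ := IsLocalization.exists_mk'_eq Q.primeCompl b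
      rw [RingHom.mem_ker] at hb
      have h1 : q (algebraMap _ B P) = 0 := by
        rw [← IsLocalization.mk'_spec B P s, map_mul, hb, zero_mul]
      rw [hqa] at h1
      have h2 : red P = 0 := by
        refine IsLocalization.injective C (M := Qk.primeCompl) ?_ (h1.trans (map_zero _).symm)
        exact Ideal.primeCompl_le_nonZeroDivisors Qk
      rw [IsLocalization.mk'_mem_map_algebraMap_iff Q.primeCompl]
      exact ⟨1, one_mem _, by rw [one_mul]; exact h2⟩
    · rw [Ideal.mem_comap, RingHom.mem_ker, hqa, RingHom.mem_ker.mp hP, map_zero]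
  have hloc : IsLocalHom (algebraMap A B) := by
    have h1 : ψ.comp (algebraMap A B) = φ := by
      refine RingHom.ext fun a => ?_
      rw [hα]
      exact (hψ _).trans (MvPolynomial.eval₂Hom_C _ _ _)
    have : IsLocalHom (ψ.comp (algebraMap A B)) := h1 ▸ inferInstance
    exact isLocalHom_of_comp (algebraMap A B) ψ
  have hflat : Module.Flat A B :=
    have : Module.Flat (MvPolynomial ι A) B := IsLocalization.flat B Q.primeCompl
    Module.Flat.trans A (MvPolynomial ι A) B
  have hBloc : IsLocalRing B := inferInstance
  have hBnoeth : IsNoetherianRing B := inferInstance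
  have hCreg : IsRegularLocalRing C := IsRegularRing.isRegularLocalRing_localization Qk
  let Y : ι → B := fun i => algebraMap (MvPolynomial ι A) B (MvPolynomial.X i)
  refine ⟨B, C, inferInstance, hBloc, hBnoeth, inferInstance, hCreg, algebraMap A B, Y, q, ψ, ?_,
    hqsurj, ?_, ?_, ?_, ?_, ?_⟩
  · intro o
    obtain ⟨P, s, hs, ho⟩ := hfrac o
    have hs' : s ∈ Q.primeCompl := fun h => (mem_maximalIdeal _).mp h hs
    refine ⟨IsLocalization.mk' B P ⟨s, hs'⟩, ?_⟩
    refine hs.mul_right_cancel ?_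
    have : ψ (algebraMap _ B s) = MvPolynomial.eval₂ φ y s := hψ s
    rw [ho, ← this, ← map_mul]
    exact (congrArg ψ (IsLocalization.mk'_spec B P ⟨s, hs'⟩)).trans (hψ P)
  · intro a
    rw [hα]
    exact (hψ _).trans (MvPolynomial.eval₂Hom_C _ _ _)
  · intro i
    exact (hψ _).trans (MvPolynomial.eval₂Hom_X' _ _ _)
  · intro σ _ z hz
    exact hx.sumElim_of_flat q hqsurj hker hz
  · intro t x' b
    obtain ⟨P, s, rfl⟩ := IsLocalization.exists_mk'_eq Q.primeCompl b
    obtain ⟨n, a, h⟩ := MvPolynomial.exists_pow_mul_sub_C_mem t x' P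
    refine ⟨n, a, algebraMap (MvPolynomial ι A) B s, IsLocalization.map_units B s, ?_⟩
    rw [IsLocalization.mk'_spec']
    have h' := Ideal.mem_map_of_mem (algebraMap (MvPolynomial ι A) B) h
    rw [Ideal.map_span, ← Set.range_comp] at h'
    have hαa (a : A) : algebraMap A B a = algebraMap (MvPolynomial ι A) B (MvPolynomial.C a) :=
      congr($hα a)
    have e1 : (fun i => algebraMap A B t * Y i - algebraMap A B (x' i)) =
        algebraMap (MvPolynomial ι A) B ∘
          fun i => MvPolynomial.C t * MvPolynomial.X i - MvPolynomial.C (x' i) := by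
      funext i
      simp only [Function.comp_apply, map_sub, map_mul, hαa, Y]
    have e2 : algebraMap A B t ^ n * algebraMap (MvPolynomial ι A) B P - algebraMap A B a =
        algebraMap (MvPolynomial ι A) B (MvPolynomial.C t ^ n * P - MvPolynomial.C a) := by
      simp only [map_sub, map_mul, map_pow, hαa]
    rw [e1, e2]
    exact h'
  · intro i hi
    change q (algebraMap _ B _) ∈ _ ∧ q (algebraMap _ B _) ∉ _
    rw [hqa, MvPolynomial.map_X]
    refine ⟨?_, MvPolynomial.algebraMap_X_notMem_maximalIdeal_sq Qk i⟩
    rw [← Localization.AtPrime.map_eq_maximalIdeal]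
    refine Ideal.mem_map_of_mem _ ?_
    rw [RingHom.mem_ker]
    change MvPolynomial.eval₂Hom _ _ _ = _
    rw [MvPolynomial.eval₂Hom_X', residue_eq_zero_iff]
    exact hi

/-- The regular local ring `B` of `exists_chart_model` maps onto the local ring `O` of the chart
with kernel generated by the relations `t Yᵢ - xᵢ`, which are part of a regular system of parameters
of `B`. Hence `O` is regular, with the parameter `t` that defines the exceptional divisor. -/
theorem IsRegularSystem.option_of_chart_model {A B O : Type u} [CommRing A] [CommRing B]
    [IsLocalRing B] [IsNoetherianRing B] [CommRing O] [IsLocalRing O]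
    {ι σ : Type} [Fintype ι] [Fintype σ] {x : Option ι → A} {φ : A →+* O}
    (hφ : Function.Injective φ) {y : ι → O} (hy : ∀ i, φ (x (some i)) = φ (x none) * y i)
    (α : A →+* B) (Y : ι → B) (ψ : B →+* O) (hψ : Function.Surjective ψ)
    (hψα : ∀ a, ψ (α a) = φ a) (hψY : ∀ i, ψ (Y i) = y i) {z : σ → B}
    (hz : IsRegularSystem (Sum.elim (fun i => α (x i)) z))
    (hfrac : ∀ b : B, ∃ (n : ℕ) (a : A) (s : B), IsUnit s ∧ α (x none) ^ n * (s * b) - α a ∈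
      Ideal.span (Set.range fun i => α (x none) * Y i - α (x (some i)))) :
    IsRegularSystem (fun o : Option σ => o.elim (φ (x none)) fun i => ψ (z i)) := by
  have h1 : IsRegularSystem (Sum.elim (fun i => α (x none) * Y i - α (x (some i)))
      (fun o : Option σ => o.elim (α (x none)) z)) := by
    refine hz.congr ?_ ?_
    · refine le_antisymm ?_ ?_
      · rw [Ideal.span_le]
        rintro _ ⟨i | _ | i, rfl⟩
        · exact sub_mem (Ideal.mul_mem_right _ _ (Ideal.subset_span ⟨Sum.inl none, rfl⟩))
            (Ideal.subset_span ⟨Sum.inl (some i), rfl⟩)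
        · exact Ideal.subset_span ⟨Sum.inl none, rfl⟩
        · exact Ideal.subset_span ⟨Sum.inr i, rfl⟩
      · rw [Ideal.span_le]
        have ht : α (x none) ∈ Ideal.span (Set.range (Sum.elim
            (fun i => α (x none) * Y i - α (x (some i)))
            (fun o : Option σ => o.elim (α (x none)) z))) :=
          Ideal.subset_span ⟨Sum.inr none, rfl⟩
        rintro _ ⟨(_ | i) | i, rfl⟩
        · exact ht
        · refine (Submodule.sub_mem_iff_right _ (Ideal.mul_mem_right (Y i) _ ht)).mp ?_
          exact Ideal.subset_span ⟨Sum.inl i, rfl⟩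
        · exact Ideal.subset_span ⟨Sum.inr (some i), rfl⟩
    · simp only [Fintype.card_sum, Fintype.card_option]
      omega
  set 𝔎 := Ideal.span (Set.range fun i => α (x none) * Y i - α (x (some i))) with h𝔎
  have : IsLocalRing (B ⧸ 𝔎) := IsRegularSystem.isLocalRing_quotient h1.span_le_maximalIdeal
  have h2 := h1.quotient
  have h3 : IsRegularSystem (fun o : Option σ => o.elim (Ideal.Quotient.mk 𝔎 (α (x none)))
      fun i => Ideal.Quotient.mk 𝔎 (z i)) := by
    convert h2 using 1
    funext o
    cases o <;> rfl
  have := h3.isDomain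
  have ht0 : Ideal.Quotient.mk 𝔎 (α (x none)) ≠ 0 := h3.ne_zero_option
  have hker : ∀ b ∈ 𝔎, ψ b = 0 := by
    intro b hb
    rw [← RingHom.mem_ker]
    refine (Ideal.span_le.mpr ?_ : 𝔎 ≤ RingHom.ker ψ) hb
    rintro _ ⟨i, rfl⟩
    rw [SetLike.mem_coe, RingHom.mem_ker, map_sub, map_mul, hψα, hψα, hψY, hy, sub_self]
  have hbij : Function.Bijective (Ideal.Quotient.lift 𝔎 ψ hker) := by
    refine ⟨?_, Ideal.Quotient.lift_surjective_of_surjective _ _ hψ⟩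
    rw [injective_iff_map_eq_zero]
    intro c hc
    obtain ⟨b, rfl⟩ := Ideal.Quotient.mk_surjective c
    rw [Ideal.Quotient.lift_mk] at hc
    obtain ⟨n, a, s, hs, h⟩ := hfrac b
    have ha : a = 0 := by
      have := hker _ h
      rw [map_sub, map_mul, map_mul, hc, hψα, mul_zero, mul_zero, zero_sub, neg_eq_zero] at this
      exact (injective_iff_map_eq_zero φ).mp hφ a this
    rw [ha, map_zero, sub_zero, ← Ideal.Quotient.eq_zero_iff_mem, map_mul, map_mul, map_pow] at h
    have hs' := hs.map (Ideal.Quotient.mk 𝔎)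
    exact (mul_eq_zero.mp ((mul_eq_zero.mp h).resolve_left (pow_ne_zero n ht0))).resolve_left
      hs'.ne_zero
  have h4 := h3.map_ringEquiv (RingEquiv.ofBijective _ hbij)
  convert h4 using 1
  funext o
  cases o
  · exact (hψα _).symm
  · rfl

/-- The local ring `O` of a point of the exceptional divisor, in the chart with coordinates
`yᵢ = xᵢ / t`, has a regular system of parameters that contains `t`, the local equation of the
exceptional divisor. Here `t` is `x none`. -/
theorem exists_isRegularSystem_chart {A O : Type u} [CommRing A] [IsLocalRing A]
    [IsNoetherianRing A] [CommRing O] [IsLocalRing O] {ι : Type} [Fintype ι] {x : Option ι → A}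
    (hx : IsRegularSystem x) (φ : A →+* O) [IsLocalHom φ] (hφ : Function.Injective φ) (y : ι → O)
    (hy : ∀ i, φ (x (some i)) = φ (x none) * y i)
    (hfrac : ∀ o : O, ∃ P Q : MvPolynomial ι A, IsUnit (MvPolynomial.eval₂ φ y Q) ∧
      o * MvPolynomial.eval₂ φ y Q = MvPolynomial.eval₂ φ y P) :
    IsNoetherianRing O ∧ ∃ (d : ℕ) (z : Fin d → O),
      IsRegularSystem (fun o : Option (Fin d) => o.elim (φ (x none)) z) := by
  obtain ⟨B, C, _, _, _, _, _, α, Y, q, ψ, hψ, hq, hψα, hψY, hsys, hcl, -⟩ :=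
    exists_chart_model hx φ y hfrac
  refine ⟨isNoetherianRing_of_surjective _ _ ψ hψ, ?_⟩
  obtain ⟨d, c, hc⟩ := IsRegularLocalRing.exists_isRegularSystem C
  choose z hz using fun i => hq (c i)
  have hz' : IsRegularSystem (fun i => q (z i)) := by simpa only [hz] using hc
  exact ⟨d, fun i => ψ (z i), IsRegularSystem.option_of_chart_model hφ hy α Y ψ hψ hψα hψY
    (hsys _ z hz') fun b => hcl _ _ b⟩

/-- At a point of the exceptional divisor where the strict transform of `xⱼ = 0` passes, both `t`
and `yⱼ = xⱼ / t` belong to a regular system of parameters. There is also a one-dimensional regular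
local ring `S₀` over `A` with uniformizer `xⱼ` and with the residue field of `O`: it is the quotient
of the ring `B` of `exists_chart_model` by all members of a regular system other than `xⱼ`. -/
theorem exists_isRegularSystem_chart_pair {A O : Type u} [CommRing A] [IsLocalRing A]
    [IsNoetherianRing A] [CommRing O] [IsLocalRing O] {ι : Type} [Fintype ι] {x : Option ι → A}
    (hx : IsRegularSystem x) (φ : A →+* O) [IsLocalHom φ] (hφ : Function.Injective φ) (y : ι → O)
    (hy : ∀ i, φ (x (some i)) = φ (x none) * y i)
    (hfrac : ∀ o : O, ∃ P Q : MvPolynomial ι A, IsUnit (MvPolynomial.eval₂ φ y Q) ∧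
      o * MvPolynomial.eval₂ φ y Q = MvPolynomial.eval₂ φ y P)
    (j : ι) (hj : y j ∈ maximalIdeal O) :
    IsNoetherianRing O ∧ ∃ (d : ℕ) (z : Fin d → O),
      IsRegularSystem (Sum.elim ![φ (x none), y j] z) ∧
      ∃ (S₀ : Type u) (_ : CommRing S₀) (_ : IsLocalRing S₀) (_ : IsNoetherianRing S₀)
        (β : A →+* S₀) (f₀ : S₀ →+* O ⧸ maximalIdeal O),
        IsRegularSystem (fun _ : Unit => β (x (some j))) ∧ Function.Surjective f₀ ∧
          ∀ a, f₀ (β a) = Ideal.Quotient.mk _ (φ a) := by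
  classical
  obtain ⟨B, C, _, _, _, _, _, α, Y, q, ψ, hψ, hq, hψα, hψY, hsys, hcl, hY⟩ :=
    exists_chart_model hx φ y hfrac
  refine ⟨isNoetherianRing_of_surjective _ _ ψ hψ, ?_⟩
  obtain ⟨d, c, hc⟩ := IsRegularLocalRing.exists_isRegularSystem_option (hY j hj).1 (hY j hj).2
  choose z' hz' using fun i => hq (c i)
  let z : Option (Fin d) → B := fun o => o.elim (Y j) z'
  have hz : IsRegularSystem (fun i => q (z i)) := by
    convert hc using 1
    funext o
    cases o
    · rfl
    · exact hz' _
  have hB := hsys _ z hz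
  have hO := IsRegularSystem.option_of_chart_model hφ hy α Y ψ hψ hψα hψY hB fun b => hcl _ _ b
  refine ⟨d, fun i => ψ (z' i), ?_, ?_⟩
  · refine hO.congr (congrArg Ideal.span (Set.ext fun o => ?_)) ?_
    · constructor
      · rintro ⟨i | i, rfl⟩
        · fin_cases i
          · exact ⟨none, rfl⟩
          · exact ⟨some none, hψY j⟩
        · exact ⟨some (some i), rfl⟩
      · rintro ⟨_ | _ | i, rfl⟩
        · exact ⟨Sum.inl 0, rfl⟩
        · exact ⟨Sum.inl 1, (hψY j).symm⟩
        · exact ⟨Sum.inr i, rfl⟩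
    · simp only [Fintype.card_sum, Fintype.card_option, Fintype.card_fin]
      omega
  · let a : {i : Option ι // i ≠ some j} ⊕ Option (Fin d) → B :=
      Sum.elim (fun i => α (x i)) z
    have ha : IsRegularSystem (Sum.elim a (fun _ : Unit => α (x (some j)))) := by
      refine hB.congr (congrArg Ideal.span (Set.ext fun o => ?_)) ?_
      · constructor
        · rintro ⟨(i | i) | i, rfl⟩
          · exact ⟨Sum.inl i, rfl⟩
          · exact ⟨Sum.inr i, rfl⟩
          · exact ⟨Sum.inl (some j), rfl⟩
        · rintro ⟨i | i, rfl⟩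
          · by_cases hi : i = some j
            · exact ⟨Sum.inr (), by rw [hi]; rfl⟩
            · exact ⟨Sum.inl (Sum.inl ⟨i, hi⟩), rfl⟩
          · exact ⟨Sum.inl (Sum.inr i), rfl⟩
      · have : Fintype.card {i : Option ι // i ≠ some j} + 1 = Fintype.card (Option ι) := by
          rw [← Fintype.card_option]
          exact Fintype.card_congr (Equiv.optionSubtypeNe (some j))
        simp only [Fintype.card_sum, Fintype.card_unit]
        omega
    have hloc : IsLocalRing (B ⧸ Ideal.span (Set.range a)) :=
      IsRegularSystem.isLocalRing_quotient ha.span_le_maximalIdeal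
    have hlift : ∀ b ∈ Ideal.span (Set.range a),
        (Ideal.Quotient.mk (maximalIdeal O)).comp ψ b = 0 := by
      intro b hb
      rw [← RingHom.mem_ker]
      refine (Ideal.span_le.mpr ?_ : Ideal.span (Set.range a) ≤ RingHom.ker _) hb
      rintro _ ⟨i | i, rfl⟩
      · change (Ideal.Quotient.mk (maximalIdeal O)) (ψ (α (x i))) = 0
        rw [hψα, Ideal.Quotient.eq_zero_iff_mem]
        have hle : (maximalIdeal A).map φ ≤ maximalIdeal O :=
          ((local_hom_TFAE φ).out 0 2).mp ‹IsLocalHom φ›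
        exact hle (Ideal.mem_map_of_mem φ (hx.mem _))
      · exact Ideal.Quotient.eq_zero_iff_mem.mpr (hO.mem (some i))
    refine ⟨B ⧸ Ideal.span (Set.range a), inferInstance, hloc, inferInstance,
      (Ideal.Quotient.mk _).comp α, Ideal.Quotient.lift _ _ hlift, ha.quotient,
      Ideal.Quotient.lift_surjective_of_surjective _ _
        (Ideal.Quotient.mk_surjective.comp hψ), fun b => ?_⟩
    rw [RingHom.comp_apply, Ideal.Quotient.lift_mk, RingHom.comp_apply, hψα]

/-! ### Points and local rings of the blowup -/

lemma AlgebraicGeometry.Scheme.topIso_inv_appTop_germ (X : Scheme.{u}) (U : X.Opens) (h : U = ⊤)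
    (x : X) :
    U.topIso.inv ≫ (X.isoOfEq h).inv.appTop ≫ X.topIso.inv.appTop ≫
      X.presheaf.germ ⊤ x trivial = X.presheaf.germ U x (h ▸ trivial) := by
  subst h
  have h1 : X.topIso.inv ≫ (⊤ : X.Opens).ι = 𝟙 X := by
    rw [← Scheme.topIso_hom, Iso.inv_hom_id]
  have h2 := congr(Scheme.Hom.appTop $h1)
  rw [Scheme.Hom.comp_appTop, Scheme.Opens.ι_appTop] at h2
  have h3 : (⊤ : X.Opens).topIso.inv ≫ X.topIso.inv.appTop = 𝟙 _ := by
    refine Eq.trans ?_ h2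
    congr 1
  have h4 : (X.isoOfEq (rfl : (⊤ : X.Opens) = ⊤)).inv = 𝟙 _ := by simp
  rw [h4]
  simp only [Scheme.Hom.id_appTop, Category.id_comp, reassoc_of% h3]

/-- On stalks, the structure morphism `Proj 𝒜 ⟶ Spec 𝒜₀` is given by `a ↦ a / 1`. -/
lemma AlgebraicGeometry.Proj.toSpecZero_appTop_germ {A σ : Type u} [CommRing A] [SetLike σ A]
    [AddSubgroupClass σ A] (𝒜 : ℕ → σ) [GradedRing 𝒜] (x : Proj 𝒜) :
    (Scheme.ΓSpecIso (.of (𝒜 0))).inv ≫ (Proj.toSpecZero 𝒜).appTop ≫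
      (Proj 𝒜).presheaf.germ ⊤ x trivial =
    CommRingCat.ofHom (HomogeneousLocalization.fromZeroRingHom 𝒜 _) ≫
      (Proj.stalkIso 𝒜 x).inv := by
  have h1 : Proj.awayToSection 𝒜 1 ≫
      (Proj 𝒜).presheaf.germ _ x (by rw [Proj.basicOpen_one]; trivial) =
      CommRingCat.ofHom (HomogeneousLocalization.mapId 𝒜 (Submonoid.powers_le.mpr (one_mem _))) ≫
        (Proj.stalkIso 𝒜 x).inv :=
    ProjectiveSpectrum.Proj.awayToSection_germ 𝒜 1 x _
  have h2 : (Proj.basicOpenToSpec 𝒜 1).appTop = (Scheme.ΓSpecIso _).hom ≫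
      Proj.awayToSection 𝒜 1 ≫ (Proj.basicOpen 𝒜 1).topIso.inv :=
    Proj.basicOpenToSpec_app_top 𝒜 1
  rw [Proj.toSpecZero]
  simp only [Scheme.Hom.comp_appTop, Category.assoc, h2]
  rw [← Scheme.ΓSpecIso_inv_naturality_assoc, Iso.inv_hom_id_assoc,
    Scheme.topIso_inv_appTop_germ, h1]
  rfl

lemma stalkIso_blowupToStalk {A : Type u} [CommRing A] (I : Ideal A)
    (x : Proj (reesGrading I)) (a : A) :
    (Proj.stalkIso (reesGrading I) x).hom (blowupToStalk I x a) =
      HomogeneousLocalization.fromZeroRingHom (reesGrading I) _ (algebraMap A _ a) := by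
  have h : (Scheme.ΓSpecIso (.of A)).inv ≫ (Proj.toSpecZero (reesGrading I) ≫
        Spec.map (CommRingCat.ofHom (algebraMap A (reesGrading I 0)))).appTop ≫
          (Proj (reesGrading I)).presheaf.germ ⊤ x trivial =
      CommRingCat.ofHom (algebraMap A (reesGrading I 0)) ≫
        CommRingCat.ofHom (R := reesGrading I 0)
          (HomogeneousLocalization.fromZeroRingHom (reesGrading I) _) ≫
            (Proj.stalkIso (reesGrading I) x).inv := by
    rw [← Proj.toSpecZero_appTop_germ, Scheme.Hom.comp_appTop]
    rw [Category.assoc, ← Scheme.ΓSpecIso_inv_naturality_assoc]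
  change (Proj.stalkIso (reesGrading I) x).hom.hom (((Scheme.ΓSpecIso (.of A)).inv ≫
    (Proj.toSpecZero (reesGrading I) ≫
      Spec.map (CommRingCat.ofHom (algebraMap A (reesGrading I 0)))).appTop ≫
        (Proj (reesGrading I)).presheaf.germ ⊤ x trivial).hom a) = _
  rw [h]
  simp

/-- A homogeneous prime of `B` comes from `Proj (B ⧸ J)` if and only if it contains `J`. -/
lemma mem_range_projQuotι {B σ : Type u} [CommRing B] [SetLike σ B] [AddSubgroupClass σ B]
    (𝒜 : ℕ → σ) [GradedRing 𝒜] (J : HomogeneousIdeal 𝒜) (x : Proj 𝒜) :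
    x ∈ Set.range (projQuotι 𝒜 J) ↔ J.toIdeal ≤ x.asHomogeneousIdeal.toIdeal := by
  constructor
  · rintro ⟨y, rfl⟩ b hb
    change Ideal.Quotient.mk J.toIdeal b ∈ y.asHomogeneousIdeal.toIdeal
    rw [Ideal.Quotient.eq_zero_iff_mem.mpr hb]
    exact zero_mem _
  · intro h
    have hx : x.asHomogeneousIdeal.toIdeal.IsPrime := x.isPrime
    have hs : Function.Surjective (Ideal.Quotient.mk J.toIdeal) := Ideal.Quotient.mk_surjective
    have hk : RingHom.ker (Ideal.Quotient.mk J.toIdeal) ≤ x.asHomogeneousIdeal.toIdeal := by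
      rwa [Ideal.mk_ker]
    have hc : ((x.asHomogeneousIdeal.toIdeal).map (Ideal.Quotient.mk J.toIdeal)).comap
        (Ideal.Quotient.mk J.toIdeal) = x.asHomogeneousIdeal.toIdeal := by
      rw [Ideal.comap_map_of_surjective' _ hs, sup_eq_left]
      exact hk
    let P : HomogeneousIdeal (quotGrading 𝒜 J) :=
      x.asHomogeneousIdeal.map (quotGradedHom 𝒜 J)
    have hP : P.toIdeal = (x.asHomogeneousIdeal.toIdeal).map (Ideal.Quotient.mk J.toIdeal) := rfl
    let y : ProjectiveSpectrum (quotGrading 𝒜 J) :=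
      { asHomogeneousIdeal := P
        isPrime := by
          rw [hP]
          exact Ideal.map_isPrime_of_surjective hs hk
        not_irrelevant_le := fun hle => x.not_irrelevant_le <| by
          refine (HomogeneousIdeal.toIdeal_irrelevant_le _).mpr ?_
          intro i hi b hb
          have h1 : Ideal.Quotient.mk J.toIdeal b ∈ P.toIdeal :=
            hle (HomogeneousIdeal.mem_irrelevant_of_mem _ hi (mk_mem_quotGrading 𝒜 J hb))
          rw [hP, ← Ideal.mem_comap, hc] at h1
          exact h1 }
    refine ⟨y, ?_⟩
    refine ProjectiveSpectrum.ext (HomogeneousIdeal.ext ?_)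
    exact hc

section

variable {A : Type u} [CommRing A] {I : Ideal A}

/-- The element `a Tᵏ` of the Rees algebra, for `a ∈ Iᵏ`. -/
noncomputable def reesMonomial (k : ℕ) {a : A} (ha : a ∈ I ^ k) : reesAlgebra I :=
  ⟨Polynomial.monomial k a, reesAlgebra.monomial_mem.mpr ha⟩

lemma reesMonomial_mem (k : ℕ) {a : A} (ha : a ∈ I ^ k) : reesMonomial k ha ∈ reesGrading I k :=
  ⟨a, rfl⟩

lemma exists_eq_reesMonomial {k : ℕ} {p : reesAlgebra I} (hp : p ∈ reesGrading I k) :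
    ∃ (a : A) (ha : a ∈ I ^ k), p = reesMonomial k ha := by
  obtain ⟨a, ha⟩ := hp
  have h : a ∈ I ^ k := by
    have := p.2
    change Polynomial.monomial k a = (p : Polynomial A) at ha
    rw [← ha] at this
    exact reesAlgebra.monomial_mem.mp this
  exact ⟨a, h, Subtype.ext ha.symm⟩

/-- The homogeneous prime ideal of the Rees algebra that is the point `x` of the blowup. -/
noncomputable def blowupPrime (x : blowup I) : Ideal (reesAlgebra I) :=
  (show ProjectiveSpectrum (reesGrading I) from x).asHomogeneousIdeal.toIdeal

instance blowupPrime.isPrime (x : blowup I) : (blowupPrime x).IsPrime :=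
  (show ProjectiveSpectrum (reesGrading I) from x).isPrime

/-- A point of the blowup omits some `a Tᵏ` with `0 < k`. -/
lemma exists_reesMonomial_notMem (x : blowup I) :
    ∃ (k : ℕ) (_ : 0 < k) (a : A) (ha : a ∈ I ^ k), reesMonomial k ha ∉ blowupPrime x := by
  by_contra! h
  refine (show ProjectiveSpectrum (reesGrading I) from x).not_irrelevant_le ?_
  refine (HomogeneousIdeal.toIdeal_irrelevant_le _).mpr ?_
  intro k hk p hp
  obtain ⟨a, ha, rfl⟩ := exists_eq_reesMonomial hp
  exact h k hk a ha

/-- The points of `V(f̄)` are the homogeneous primes of the Rees algebra that contain `I` and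
`f T`. -/
lemma mem_hyperplanePoints {f : A} (hf : f ∈ I) (x : blowup I) :
    x ∈ hyperplanePoints hf ↔
      I.map (algebraMap A (reesAlgebra I)) ≤ blowupPrime x ∧
        reesMonomial 1 (by simpa using hf : f ∈ I ^ 1) ∈ blowupPrime x := by
  have h (y : exceptionalDivisor I) : y ∈ Set.range (hyperplaneι hf) ↔
      reesMonomial 1 (by simpa using hf : f ∈ I ^ 1) ∈ blowupPrime (exceptionalDivisorι I y) := by
    refine (mem_range_projQuotι (grGrading I) (hyperplaneIdeal hf) y).trans ?_
    refine (Ideal.span_singleton_le_iff_mem _).trans ?_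
    rfl
  constructor
  · rintro ⟨y, rfl⟩
    refine ⟨?_, ?_⟩
    · exact (mem_range_projQuotι (reesGrading I) (exceptionalIdeal I) _).mp ⟨hyperplaneι hf y, rfl⟩
    · exact (h _).mp ⟨y, rfl⟩
  · rintro ⟨h1, h2⟩
    obtain ⟨y, rfl⟩ := (mem_range_projQuotι (reesGrading I) (exceptionalIdeal I) x).mpr h1
    obtain ⟨z, rfl⟩ := (h y).mpr h2
    exact ⟨z, rfl⟩

/-- The local ring of the blowup at `x` is the degree zero part of the localization of the Rees
algebra at the prime `x`. -/
noncomputable def blowupStalkEquiv (x : blowup I) : (blowup I).presheaf.stalk x ≃+*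
    HomogeneousLocalization.AtPrime (reesGrading I) (blowupPrime x) :=
  (Proj.stalkIso (reesGrading I) x).commRingCatIsoToRingEquiv

lemma blowupStalkEquiv_blowupToStalk (x : blowup I) (a : A) :
    blowupStalkEquiv x (blowupToStalk I x a) = HomogeneousLocalization.fromZeroRingHom
      (reesGrading I) (blowupPrime x).primeCompl (algebraMap A _ a) :=
  stalkIso_blowupToStalk I x a

end

section

variable {A : Type u} [CommRing A] {I : Ideal A}

/-- The fraction `a Tᵏ / s Tᵏ` of degree zero is a quotient of `a` by `s`. -/
lemma mk_mul_fromZeroRingHom (x : blowup I) {k : ℕ} {a s : A} (ha : a ∈ I ^ k)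
    (hs : s ∈ I ^ k) (hsx : reesMonomial k hs ∉ (blowupPrime x)) :
    HomogeneousLocalization.mk (𝒜 := reesGrading I)
        (x := (blowupPrime x).primeCompl)
        ⟨k, ⟨_, reesMonomial_mem k ha⟩, ⟨_, reesMonomial_mem k hs⟩, hsx⟩ *
      HomogeneousLocalization.fromZeroRingHom (reesGrading I) _ (algebraMap A _ s) =
    HomogeneousLocalization.fromZeroRingHom (reesGrading I) _ (algebraMap A _ a) := by
  refine HomogeneousLocalization.val_injective _ ?_
  rw [HomogeneousLocalization.val_mul]
  change Localization.mk _ _ * Localization.mk _ _ = Localization.mk _ _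
  rw [Localization.mk_mul, Localization.mk_eq_mk_iff, Localization.r_iff_exists]
  refine ⟨1, ?_⟩
  congr 1
  refine Subtype.ext ?_
  change (1 : Polynomial A) * (Polynomial.monomial k a * Polynomial.C s) =
    (Polynomial.monomial k s * 1) * Polynomial.C a
  rw [one_mul, mul_one, Polynomial.monomial_mul_C, Polynomial.monomial_mul_C, mul_comm]

lemma mem_maximalIdeal_mk_iff (x : blowup I) {k : ℕ} {a s : A} (ha : a ∈ I ^ k)
    (hs : s ∈ I ^ k) (hsx : reesMonomial k hs ∉ (blowupPrime x)) :
    HomogeneousLocalization.mk (𝒜 := reesGrading I)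
        (x := (blowupPrime x).primeCompl)
        ⟨k, ⟨_, reesMonomial_mem k ha⟩, ⟨_, reesMonomial_mem k hs⟩, hsx⟩ ∈
      maximalIdeal (HomogeneousLocalization.AtPrime (reesGrading I) (blowupPrime x)) ↔
    reesMonomial k ha ∈ blowupPrime x := by
  rw [mem_maximalIdeal, mem_nonunits_iff, ← HomogeneousLocalization.isUnit_iff_isUnit_val,
    HomogeneousLocalization.val_mk, Localization.mk_eq_mk', IsLocalization.AtPrime.isUnit_mk'_iff
      (Localization.AtPrime (blowupPrime x)) (blowupPrime x)]
  exact not_not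

/-- For `a, s ∈ Iᵏ` with `s Tᵏ` not in the prime of `x`, the fraction `a / s` is defined at `x`; it
vanishes at `x` exactly when `a Tᵏ` is in the prime. -/
lemma exists_mul_blowupToStalk_eq (x : blowup I) {k : ℕ} {a s : A} (ha : a ∈ I ^ k)
    (hs : s ∈ I ^ k) (hsx : reesMonomial k hs ∉ (blowupPrime x)) :
    ∃ o : (blowup I).presheaf.stalk x, o * blowupToStalk I x s = blowupToStalk I x a ∧
      (o ∈ maximalIdeal ((blowup I).presheaf.stalk x) ↔
        reesMonomial k ha ∈ (blowupPrime x)) := by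
  let e := blowupStalkEquiv x
  have he (a : A) : e (blowupToStalk I x a) = HomogeneousLocalization.fromZeroRingHom
      (reesGrading I) _ (algebraMap A _ a) := blowupStalkEquiv_blowupToStalk x a
  refine ⟨e.symm (HomogeneousLocalization.mk
    ⟨k, ⟨_, reesMonomial_mem k ha⟩, ⟨_, reesMonomial_mem k hs⟩, hsx⟩), ?_, ?_⟩
  · refine e.injective ?_
    refine (map_mul e _ _).trans ?_
    rw [he, he, e.apply_symm_apply]
    exact mk_mul_fromZeroRingHom x ha hs hsx
  · rw [← mem_maximalIdeal_mk_iff x ha hs hsx]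
    exact not_congr (MulEquiv.isUnit_map e.symm)

/-- Every germ at `x` is a fraction `a / s` with `a, s ∈ Iᵏ` and `s Tᵏ` not in the prime of `x`. -/
lemma exists_eq_fraction (x : blowup I) (o : (blowup I).presheaf.stalk x) :
    ∃ (k : ℕ) (a s : A) (_ : a ∈ I ^ k) (hs : s ∈ I ^ k),
      reesMonomial k hs ∉ blowupPrime x ∧
        o * blowupToStalk I x s = blowupToStalk I x a := by
  let e := blowupStalkEquiv x
  have he (a : A) : e (blowupToStalk I x a) = HomogeneousLocalization.fromZeroRingHom
      (reesGrading I) _ (algebraMap A _ a) := blowupStalkEquiv_blowupToStalk x a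
  obtain ⟨⟨k, ⟨p, hp⟩, ⟨q, hq⟩, hqx⟩, hc⟩ := HomogeneousLocalization.mk_surjective (e o)
  obtain ⟨a, ha, rfl⟩ := exists_eq_reesMonomial hp
  obtain ⟨s, hs, rfl⟩ := exists_eq_reesMonomial hq
  refine ⟨k, a, s, ha, hs, hqx, e.injective ?_⟩
  refine (map_mul e _ _).trans ?_
  rw [he, he, ← hc]
  exact mk_mul_fromZeroRingHom x ha hs hqx

lemma isDomain_stalk_blowup [IsDomain A] (x : blowup I) :
    IsDomain ((blowup I).presheaf.stalk x) := by
  have h1 : IsDomain (Localization (blowupPrime x).primeCompl) :=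
    IsLocalization.isDomain_localization (Ideal.primeCompl_le_nonZeroDivisors _)
  let f : HomogeneousLocalization.AtPrime (reesGrading I) (blowupPrime x) →+*
      Localization (blowupPrime x).primeCompl := algebraMap _ _
  have hf : Function.Injective f := HomogeneousLocalization.val_injective _
  let g : (blowup I).presheaf.stalk x →+* Localization (blowupPrime x).primeCompl :=
    f.comp (blowupStalkEquiv x : _ →+* _)
  have hg : Function.Injective g := hf.comp (blowupStalkEquiv x).injective
  exact hg.isDomain g

lemma blowupToStalk_injective [IsDomain A] (x : blowup I) :
    Function.Injective (blowupToStalk I x) := by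
  rw [injective_iff_map_eq_zero]
  intro a ha
  have h : HomogeneousLocalization.fromZeroRingHom (reesGrading I) (blowupPrime x).primeCompl
      (algebraMap A _ a) = 0 := by
    rw [← blowupStalkEquiv_blowupToStalk, ha, map_zero]
  have h' := congrArg HomogeneousLocalization.val h
  rw [HomogeneousLocalization.val_zero] at h'
  change Localization.mk _ _ = 0 at h'
  rw [Localization.mk_eq_mk', IsLocalization.mk'_eq_zero_iff] at h'
  obtain ⟨m, hm⟩ := h'
  have hm0 : (m : reesAlgebra I) ≠ 0 := fun h0 => m.2 (h0 ▸ zero_mem _)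
  have h0 := congrArg Subtype.val ((mul_eq_zero.mp hm).resolve_left hm0)
  exact Polynomial.C_eq_zero.mp h0
end

section

variable {A : Type u} [CommRing A] {I : Ideal A}

/-- Away from the exceptional divisor, `a Tᵏ` belongs to the prime of `x` exactly when `a` does. -/
lemma reesMonomial_mem_blowupPrime_iff (x : blowup I)
    (hx : ¬ I.map (algebraMap A (reesAlgebra I)) ≤ blowupPrime x) {k : ℕ} {a : A} (ha : a ∈ I ^ k) :
    reesMonomial k ha ∈ blowupPrime x ↔ algebraMap A (reesAlgebra I) a ∈ blowupPrime x := by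
  obtain ⟨b, hb, hbx⟩ : ∃ b ∈ I, algebraMap A (reesAlgebra I) b ∉ blowupPrime x := by
    by_contra! h
    exact hx (Ideal.map_le_iff_le_comap.mpr h)
  have key {l : ℕ} {c : A} (hc : c ∈ I ^ l) : algebraMap A (reesAlgebra I) b ^ l *
      reesMonomial l hc = algebraMap A (reesAlgebra I) c *
        reesMonomial (I := I) 1 (by simpa using hb) ^ l := by
    refine Subtype.ext ?_
    change Polynomial.C b ^ l * Polynomial.monomial l c =
      Polynomial.C c * Polynomial.monomial 1 b ^ l
    rw [Polynomial.monomial_pow, ← Polynomial.C_pow, Polynomial.C_mul_monomial,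
      Polynomial.C_mul_monomial, one_mul, mul_comm]
  have hbT : reesMonomial (I := I) 1 (by simpa using hb) ∉ blowupPrime x := by
    intro h
    obtain ⟨l, hl, c, hc, hcx⟩ := exists_reesMonomial_notMem x
    have h1 : algebraMap A (reesAlgebra I) b ^ l * reesMonomial l hc ∈ blowupPrime x := by
      rw [key]
      exact Ideal.mul_mem_left _ _ (Ideal.pow_mem_of_mem _ h l hl)
    exact (Ideal.IsPrime.mem_or_mem inferInstance h1).elim
      (fun h' => hbx (Ideal.IsPrime.mem_of_pow_mem inferInstance l h')) hcx
  constructor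
  · intro h
    have h1 := Ideal.mul_mem_left _ (algebraMap A (reesAlgebra I) b ^ k) h
    rw [key] at h1
    exact (Ideal.IsPrime.mem_or_mem inferInstance h1).resolve_right
      fun h' => hbT (Ideal.IsPrime.mem_of_pow_mem inferInstance k h')
  · intro h
    have h1 := Ideal.mul_mem_right (reesMonomial (I := I) 1 (by simpa using hb) ^ k) _ h
    rw [← key] at h1
    exact (Ideal.IsPrime.mem_or_mem inferInstance h1).resolve_left
      fun h' => hbx (Ideal.IsPrime.mem_of_pow_mem inferInstance k h')

/-- Away from the exceptional divisor, the local rings of the blowup are those of `Spec A`. -/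
lemma exists_equiv_localization_of_not_le [IsDomain A] (x : blowup I)
    (hx : ¬ I.map (algebraMap A (reesAlgebra I)) ≤ blowupPrime x) :
    ∃ (q : Ideal A) (_ : q.IsPrime)
      (e : Localization.AtPrime q ≃+* (blowup I).presheaf.stalk x),
      ∀ a, e (algebraMap A _ a) = blowupToStalk I x a := by
  let q : Ideal A := (blowupPrime x).comap (algebraMap A (reesAlgebra I))
  have hq : q.IsPrime := Ideal.comap_isPrime _ _
  have hdom := isDomain_stalk_blowup x
  let _ : Algebra A ((blowup I).presheaf.stalk x) := (blowupToStalk I x).toAlgebra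
  have hunit (s : A) (hs : s ∉ q) : IsUnit (blowupToStalk I x s) := by
    obtain ⟨o, ho, -⟩ := exists_mul_blowupToStalk_eq x (k := 0) (a := 1) (s := s) (by simp)
      (by simp) (fun h => hs ((reesMonomial_mem_blowupPrime_iff x hx _).mp h))
    rw [map_one] at ho
    exact IsUnit.of_mul_eq_one_right o ho
  have hloc : IsLocalization.AtPrime ((blowup I).presheaf.stalk x) q := by
    refine ⟨fun s => hunit s s.2, fun o => ?_, fun {a b} hab => ⟨1, ?_⟩⟩
    · obtain ⟨k, a, s, ha, hs, hsx, h⟩ := exists_eq_fraction x o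
      exact ⟨(a, ⟨s, fun h' => hsx ((reesMonomial_mem_blowupPrime_iff x hx hs).mpr h')⟩), h⟩
    · rw [blowupToStalk_injective x hab]
  refine ⟨q, hq, (IsLocalization.algEquiv q.primeCompl (Localization.AtPrime q)
    ((blowup I).presheaf.stalk x)).toRingEquiv, fun a => ?_⟩
  exact (IsLocalization.algEquiv q.primeCompl (Localization.AtPrime q)
    ((blowup I).presheaf.stalk x)).commutes a

/-- On the exceptional divisor, `A → 𝒪` is a local homomorphism. -/
lemma isLocalHom_blowupToStalk [IsLocalRing A] (x : blowup (maximalIdeal A))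
    (hx : (maximalIdeal A).map (algebraMap A (reesAlgebra (maximalIdeal A))) ≤ blowupPrime x) :
    IsLocalHom (blowupToStalk (maximalIdeal A) x) := by
  refine ⟨fun a ha => ?_⟩
  by_contra h
  obtain ⟨o, ho, hm⟩ := exists_mul_blowupToStalk_eq x (k := 0) (a := a) (s := 1) (by simp)
    (by simp) (fun h => (blowupPrime.isPrime x).ne_top ((Ideal.eq_top_iff_one _).mpr h))
  rw [map_one, mul_one] at ho
  rw [ho] at hm
  exact hm.mpr (hx (Ideal.mem_map_of_mem _ h)) ha

/-- If `I` is generated by the `yᵢ`, some `yᵢ T` does not vanish at `x`. -/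
lemma exists_reesMonomial_one_notMem {κ : Type*} {y : κ → A} (hy : Ideal.span (Set.range y) = I)
    (x : blowup I) : ∃ (i : κ) (hi : y i ∈ I ^ 1), reesMonomial 1 hi ∉ blowupPrime x := by
  by_contra! h
  have h1 (c : A) (hc : c ∈ I ^ 1) : reesMonomial 1 hc ∈ blowupPrime x := by
    have hc' : c ∈ Ideal.span (Set.range y) := by rw [hy]; simpa using hc
    induction hc' using Submodule.span_induction with
    | mem c hc' =>
      obtain ⟨i, rfl⟩ := hc'
      exact h i hc
    | zero =>
      convert zero_mem (blowupPrime x)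
      exact Subtype.ext (map_zero _)
    | add a b ha' hb' ha hb =>
      have ha'' : a ∈ I ^ 1 := by rwa [pow_one, ← hy]
      have hb'' : b ∈ I ^ 1 := by rwa [pow_one, ← hy]
      convert add_mem (ha ha'') (hb hb'')
      exact Subtype.ext (map_add _ _ _)
    | smul r a ha' ha =>
      have ha'' : a ∈ I ^ 1 := by rwa [pow_one, ← hy]
      convert Ideal.mul_mem_left _ (algebraMap A (reesAlgebra I) r) (ha ha'')
      exact Subtype.ext (Polynomial.C_mul_monomial.symm)
  obtain ⟨k, hk, c, hc, hcx⟩ := exists_reesMonomial_notMem x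
  obtain ⟨k, rfl⟩ := Nat.exists_eq_succ_of_ne_zero hk.ne'
  refine hcx ?_
  have hmem (d : A) (hd : d ∈ I ^ (k + 1)) :
      ∃ hd : d ∈ I ^ (k + 1), reesMonomial (k + 1) hd ∈ blowupPrime x := by
    rw [pow_succ'] at hd
    refine Submodule.mul_induction_on hd (fun m hm n hn => ?_) fun a b ha hb => ?_
    · refine ⟨by rw [pow_succ']; exact Ideal.mul_mem_mul hm hn, ?_⟩
      convert Ideal.mul_mem_right (reesMonomial k hn) _ (h1 m (by simpa using hm))
      refine Subtype.ext ?_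
      change Polynomial.monomial (k + 1) (m * n) = Polynomial.monomial 1 m * Polynomial.monomial k n
      rw [Polynomial.monomial_mul_monomial, add_comm]
    · obtain ⟨ha, ha'⟩ := ha
      obtain ⟨hb, hb'⟩ := hb
      refine ⟨add_mem ha hb, ?_⟩
      convert add_mem ha' hb'
      exact Subtype.ext (map_add _ _ _)
  obtain ⟨_, h⟩ := hmem c hc
  exact h

/-- If `φ(xᵢ) = φ(t) yᵢ` for generators `t, xᵢ` of `I`, then `φ(a)`, for `a ∈ Iᵏ`, is `φ(t)ᵏ` times
a polynomial in the `yᵢ`. -/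
lemma exists_eq_pow_mul_eval₂ {O : Type*} [CommRing O] {ι : Type} {x : Option ι → A}
    (hx : Ideal.span (Set.range x) = I) (φ : A →+* O) {y : ι → O}
    (hy : ∀ i, φ (x (some i)) = φ (x none) * y i) (k : ℕ) {a : A} (ha : a ∈ I ^ k) :
    ∃ P : MvPolynomial ι A, φ a = φ (x none) ^ k * MvPolynomial.eval₂ φ y P := by
  have h1 (c : A) (hc : c ∈ I) :
      ∃ P : MvPolynomial ι A, φ c = φ (x none) * MvPolynomial.eval₂ φ y P := by
    rw [← hx] at hc
    induction hc using Submodule.span_induction with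
    | mem c hc =>
      obtain ⟨_ | i, rfl⟩ := hc
      · exact ⟨1, by simp⟩
      · exact ⟨MvPolynomial.X i, by rw [MvPolynomial.eval₂_X, hy]⟩
    | zero => exact ⟨0, by simp⟩
    | add a b _ _ ha hb =>
      obtain ⟨P, hP⟩ := ha
      obtain ⟨Q, hQ⟩ := hb
      exact ⟨P + Q, by rw [map_add, hP, hQ, MvPolynomial.eval₂_add, mul_add]⟩
    | smul r a _ ha =>
      obtain ⟨P, hP⟩ := ha
      refine ⟨MvPolynomial.C r * P, ?_⟩
      rw [smul_eq_mul, map_mul, hP, MvPolynomial.eval₂_mul, MvPolynomial.eval₂_C]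
      ring
  induction k generalizing a with
  | zero => exact ⟨MvPolynomial.C a, by simp⟩
  | succ k ih =>
    rw [pow_succ'] at ha
    refine Submodule.mul_induction_on ha (fun m hm n hn => ?_) fun a b ha hb => ?_
    · obtain ⟨P, hP⟩ := h1 m hm
      obtain ⟨Q, hQ⟩ := ih hn
      refine ⟨P * Q, ?_⟩
      rw [map_mul, hP, hQ, MvPolynomial.eval₂_mul]
      ring
    · obtain ⟨P, hP⟩ := ha
      obtain ⟨Q, hQ⟩ := hb
      exact ⟨P + Q, by rw [map_add, hP, hQ, MvPolynomial.eval₂_add, mul_add]⟩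

/-- In the chart where `t T` does not vanish, there are functions `yᵢ = xᵢ / t`, and every germ is a
fraction of polynomials in them. -/
lemma exists_chart_coordinates [IsDomain A] {ι : Type} {x : Option ι → A}
    (hx : Ideal.span (Set.range x) = I) (p : blowup I) (ht : x none ∈ I ^ 1)
    (htp : reesMonomial 1 ht ∉ blowupPrime p) :
    ∃ y : ι → (blowup I).presheaf.stalk p,
      (∀ i, blowupToStalk I p (x (some i)) = blowupToStalk I p (x none) * y i) ∧
      (∀ i (hi : x (some i) ∈ I ^ 1), y i ∈ maximalIdeal ((blowup I).presheaf.stalk p) ↔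
        reesMonomial 1 hi ∈ blowupPrime p) ∧
      ∀ o, ∃ P Q : MvPolynomial ι A, IsUnit (MvPolynomial.eval₂ (blowupToStalk I p) y Q) ∧
        o * MvPolynomial.eval₂ (blowupToStalk I p) y Q =
          MvPolynomial.eval₂ (blowupToStalk I p) y P := by
  have hdom := isDomain_stalk_blowup p
  have hxi (i) : x i ∈ I ^ 1 := by
    rw [pow_one, ← hx]
    exact Ideal.subset_span ⟨i, rfl⟩
  choose y hy hym using fun i => exists_mul_blowupToStalk_eq p (hxi (some i)) ht htp
  have hy' (i) : blowupToStalk I p (x (some i)) = blowupToStalk I p (x none) * y i := by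
    rw [← hy, mul_comm]
  refine ⟨y, hy', fun i _ => hym i, fun o => ?_⟩
  have ht0 : blowupToStalk I p (x none) ≠ 0 := by
    intro h
    have h0 : x none = 0 := blowupToStalk_injective p (h.trans (map_zero _).symm)
    refine htp ?_
    convert zero_mem (blowupPrime p)
    exact Subtype.ext ((congrArg _ h0).trans (map_zero _))
  obtain ⟨k, a, s, ha, hs, hsp, h⟩ := exists_eq_fraction p o
  obtain ⟨P, hP⟩ := exists_eq_pow_mul_eval₂ hx (blowupToStalk I p) hy' k ha
  obtain ⟨Q, hQ⟩ := exists_eq_pow_mul_eval₂ hx (blowupToStalk I p) hy' k hs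
  have htk : x none ^ k ∈ I ^ k := Ideal.pow_mem_pow (by simpa using ht) k
  have htkp : reesMonomial k htk ∉ blowupPrime p := by
    have : reesMonomial k htk = reesMonomial 1 ht ^ k := by
      refine Subtype.ext ?_
      change Polynomial.monomial k (x none ^ k) = Polynomial.monomial 1 (x none) ^ k
      rw [Polynomial.monomial_pow, one_mul]
    rw [this]
    exact fun h' => htp (Ideal.IsPrime.mem_of_pow_mem inferInstance k h')
  obtain ⟨o', ho', hm⟩ := exists_mul_blowupToStalk_eq p hs htk htkp
  refine ⟨P, Q, ?_, ?_⟩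
  · have : MvPolynomial.eval₂ (blowupToStalk I p) y Q = o' := by
      refine mul_left_cancel₀ (pow_ne_zero k ht0) ?_
      rw [← hQ, ← ho', map_pow, mul_comm]
    rw [this]
    by_contra hu
    exact hsp (hm.mp hu)
  · refine mul_left_cancel₀ (pow_ne_zero k ht0) ?_
    rw [← hP, ← h, hQ]
    ring

end

/-! ### The completed local rings of the blowup -/

/-- If `x ∈ 𝔫 ∖ 𝔫²` in a regular local ring `A` and `x` lies in the prime `q`, then `x` is part of a
regular system of parameters of `A_q`: the quotient `A_q / x` is a localization of the regular ring
`A / x`. -/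
theorem IsRegularLocalRing.exists_isRegularSystem_localization_atPrime {A : Type u} [CommRing A]
    [IsRegularLocalRing A] {x : A} (hx : x ∈ maximalIdeal A) (hx2 : x ∉ maximalIdeal A ^ 2)
    (q : Ideal A) [q.IsPrime] (hxq : x ∈ q) :
    ∃ (d : ℕ) (z : Fin d → Localization.AtPrime q), IsRegularSystem
      (fun o : Option (Fin d) => o.elim (algebraMap A (Localization.AtPrime q) x) z) := by
  have hdom : IsDomain A := IsRegularLocalRing.isDomain A
  obtain ⟨d, z, hz⟩ := IsRegularLocalRing.exists_isRegularSystem_option hx hx2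
  have hspan : Ideal.span {x} ≤ q := (Ideal.span_singleton_le_iff_mem _).mpr hxq
  have : IsLocalRing (A ⧸ Ideal.span {x}) := IsRegularSystem.isLocalRing_quotient
    ((Ideal.span_singleton_le_iff_mem _).mpr hx)
  have hreg : IsRegularLocalRing (A ⧸ Ideal.span {x}) := hz.quotient_singleton.isRegularLocalRing
  let Aq := Localization.AtPrime q
  let q' : Ideal (A ⧸ Ideal.span {x}) := q.map (Ideal.Quotient.mk _)
  have hq' : q'.IsPrime := Ideal.map_isPrime_of_surjective Ideal.Quotient.mk_surjective
    (by rwa [Ideal.mk_ker])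
  have hmap : (Ideal.span {x}).map (algebraMap A Aq) = Ideal.span {algebraMap A Aq x} := by
    rw [Ideal.map_span, Set.image_singleton]
  have hsub : Algebra.algebraMapSubmonoid (A ⧸ Ideal.span {x}) q.primeCompl = q'.primeCompl := by
    have hmem (a : A) : Ideal.Quotient.mk (Ideal.span {x}) a ∈ q' ↔ a ∈ q := by
      rw [← Ideal.mem_comap, Ideal.comap_map_of_surjective' _ Ideal.Quotient.mk_surjective,
        Ideal.mk_ker, sup_eq_left.mpr hspan]
    ext c
    obtain ⟨a, rfl⟩ := Ideal.Quotient.mk_surjective c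
    refine ⟨?_, fun h => ⟨a, fun ha => h ((hmem a).mpr ha), rfl⟩⟩
    rintro ⟨b, hb, hab⟩ h
    change Ideal.Quotient.mk _ b = _ at hab
    rw [← hab] at h
    exact hb ((hmem b).mp h)
  have hloc : IsLocalization.AtPrime (Aq ⧸ (Ideal.span {x}).map (algebraMap A Aq)) q' := by
    rw [IsLocalization.AtPrime, ← hsub]
    infer_instance
  have hregq : IsRegularLocalRing (Localization.AtPrime q') :=
    IsRegularLocalRing.localization_atPrime q'
  have hxm : algebraMap A Aq x ∈ maximalIdeal Aq := by
    rw [← Localization.AtPrime.map_eq_maximalIdeal]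
    exact Ideal.mem_map_of_mem _ hxq
  let e : Localization.AtPrime q' ≃+* Aq ⧸ Ideal.span {algebraMap A Aq x} :=
    (IsLocalization.algEquiv q'.primeCompl (Localization.AtPrime q')
      (Aq ⧸ (Ideal.span {x}).map (algebraMap A Aq))).toRingEquiv.trans
        (Ideal.quotEquivOfEq hmap)
  have hregQ : IsRegularLocalRing (Aq ⧸ Ideal.span {algebraMap A Aq x}) := .of_ringEquiv e
  obtain ⟨d', c, hc⟩ :=
    IsRegularLocalRing.exists_isRegularSystem (Aq ⧸ Ideal.span {algebraMap A Aq x})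
  choose w hw using fun i => Ideal.Quotient.mk_surjective (c i)
  have hw' : IsRegularSystem
      (fun k => Ideal.Quotient.mk (Ideal.span {algebraMap A Aq x}) (w k)) := by
    simpa only [hw] using hc
  refine ⟨d', w, IsRegularSystem.option_of_quotient ?_ hxm hw'⟩
  rw [mem_nonZeroDivisors_iff_ne_zero]
  intro h0
  have hinj : Function.Injective (algebraMap A Aq) :=
    IsLocalization.injective Aq (Ideal.primeCompl_le_nonZeroDivisors q)
  exact hz.ne_zero_option (hinj (h0.trans (map_zero _).symm))

/-- A ring homomorphism from a discrete valuation ring that inverts the uniformizer extends to the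
fraction field. -/
lemma exists_fractionRing_hom {R₀ O : Type u} [CommRing R₀] [IsDomain R₀]
    [IsDiscreteValuationRing R₀] {π : R₀} (hπ : Irreducible π) [CommRing O] (τ : R₀ →+* O)
    (hτ : IsUnit (τ π)) : Nonempty (FractionRing R₀ →+* O) := by
  refine ⟨IsLocalization.lift (M := nonZeroDivisors R₀) (g := τ) fun r => ?_⟩
  obtain ⟨n, v, hv⟩ := IsDiscreteValuationRing.eq_unit_mul_pow_irreducible
    (nonZeroDivisors.ne_zero r.2) hπ
  rw [hv, map_mul, map_pow]
  exact (v.isUnit.map τ).mul (hτ.pow n)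

theorem mainTheorem5 {R₀ A : Type u} [CommRing R₀] [IsDomain R₀] [IsDiscreteValuationRing R₀]
    [PerfectField (ResidueField R₀)] (π : R₀) (hπ : Irreducible π)
    [CommRing A] [IsRegularLocalRing A] [Algebra R₀ A] (hA : IsUnramifiedOver R₀ A π)
    (x : blowup (maximalIdeal A)) :
    (x ∉ hyperplanePoints hA.mem →
      (∃ (K : Type u) (_ : Field K) (d : ℕ),
        Nonempty (completedStalk (blowup (maximalIdeal A)) x ≃+* MvPowerSeries (Fin d) K)) ∨
      (∃ (S : Type u) (_ : CommRing S) (_ : IsDomain S) (_ : IsDiscreteValuationRing S) (d : ℕ),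
        Nonempty (completedStalk (blowup (maximalIdeal A)) x ≃+* MvPowerSeries (Fin d) S))) ∧
    (x ∈ hyperplanePoints hA.mem →
      ∃ (S : Type u) (_ : CommRing S) (_ : IsDomain S) (_ : IsDiscreteValuationRing S)
        (ρ : R₀ →+* S) (d : ℕ)
        (e : completedStalk (blowup (maximalIdeal A)) x ≃+*
          MvPowerSeries (Fin d) (nodeRing S (ρ π))),
        IsAdicComplete (maximalIdeal S) S ∧ Irreducible (ρ π) ∧
        ∀ r : R₀,
          e (algebraMap _ _ (blowupToStalk (maximalIdeal A) x (algebraMap R₀ A r))) =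
            nodeRing.const S (ρ π) d (ρ r)) := by
  have hdom : IsDomain A := IsRegularLocalRing.isDomain A
  have hmax : maximalIdeal R₀ = Ideal.span {π} := hπ.maximalIdeal_eq
  let φ := blowupToStalk (maximalIdeal A) x
  have hφ : Function.Injective φ := blowupToStalk_injective x
  have hπ1 : algebraMap R₀ A π ∈ maximalIdeal A ^ 1 := by simpa using hA.mem
  obtain ⟨d, z, hz⟩ := IsRegularLocalRing.exists_isRegularSystem_option hA.mem hA.notMem_sq
  by_cases hE : (maximalIdeal A).map (algebraMap A (reesAlgebra (maximalIdeal A))) ≤ blowupPrime x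
  · have hφloc : IsLocalHom φ := isLocalHom_blowupToStalk x hE
    -- On the exceptional divisor, `hV` says whether `x` lies on the hyperplane.
    by_cases hV : reesMonomial 1 hπ1 ∈ blowupPrime x
    · refine ⟨fun h => absurd ((mem_hyperplanePoints hA.mem x).mpr ⟨hE, hV⟩) h, fun _ => ?_⟩
      obtain ⟨i₀, hi₀, hi₀x⟩ := exists_reesMonomial_one_notMem hz.span_range x
      have hne : none ≠ i₀ := by
        rintro rfl
        exact hi₀x hV
      -- Reorder the system so that the local equation of the exceptional divisor is first.
      let ε : Option {i // i ≠ i₀} ≃ Option (Fin d) := Equiv.optionSubtypeNe i₀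
      let y : Option {i // i ≠ i₀} → A :=
        (fun o : Option (Fin d) => o.elim (algebraMap R₀ A π) z) ∘ ε
      have hy : IsRegularSystem y := hz.comp_equiv ε
      let j : {i // i ≠ i₀} := ⟨none, hne⟩
      obtain ⟨u, hu, hum, hfrac⟩ := exists_chart_coordinates hy.span_range x hi₀ hi₀x
      obtain ⟨hnoeth, d', w, hw, S₀, _, _, _, β, f₀, hβ, hf₀, hf₀β⟩ :=
        exists_isRegularSystem_chart_pair hy φ hφ u hu hfrac j ((hum j hπ1).mpr hV)
      exact IsRegularSystem.exists_equiv_mvPowerSeries_nodeRing hmax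
        (β.comp (algebraMap R₀ A)) hβ (φ.comp (algebraMap R₀ A)) f₀
        (fun r => hf₀β _) hf₀ hw (hu j)
    · refine ⟨fun _ => Or.inr ?_, fun h => absurd ((mem_hyperplanePoints hA.mem x).mp h).2 hV⟩
      -- The local equation of the exceptional divisor can be taken to be `π`.
      obtain ⟨u, hu, -, hfrac⟩ := exists_chart_coordinates hz.span_range x hπ1 hV
      obtain ⟨hnoeth, d', w, hw⟩ := exists_isRegularSystem_chart hz φ hφ u hu hfrac
      exact IsRegularSystem.exists_equiv_mvPowerSeries_dvr hmax (φ.comp (algebraMap R₀ A)) hw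
  · refine ⟨fun _ => ?_, fun h => absurd ((mem_hyperplanePoints hA.mem x).mp h).1 hE⟩
    -- Off the exceptional divisor, the local ring is `A_q`.
    obtain ⟨q, hq, e, he⟩ := exists_equiv_localization_of_not_le x hE
    by_cases hπq : algebraMap R₀ A π ∈ q
    · refine Or.inr ?_
      obtain ⟨d', w, hw⟩ := IsRegularLocalRing.exists_isRegularSystem_localization_atPrime
        hA.mem hA.notMem_sq q hπq
      have hnoeth : IsNoetherianRing ((blowup (maximalIdeal A)).presheaf.stalk x) :=
        isNoetherianRing_of_ringEquiv _ e
      have hw' := hw.map_ringEquiv e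
      refine IsRegularSystem.exists_equiv_mvPowerSeries_dvr (z := fun i => e (w i)) hmax
        (φ.comp (algebraMap R₀ A)) ?_
      convert hw' using 1
      funext o
      cases o
      · exact (he _).symm
      · rfl
    · refine Or.inl ?_
      have hreg : IsRegularLocalRing (Localization.AtPrime q) :=
        IsRegularLocalRing.localization_atPrime q
      have hreg' : IsRegularLocalRing ((blowup (maximalIdeal A)).presheaf.stalk x) :=
        .of_ringEquiv e
      have hu : IsUnit ((φ.comp (algebraMap R₀ A)) π) := by
        rw [RingHom.comp_apply]
        refine (he _) ▸ (IsLocalization.map_units (Localization.AtPrime q)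
          (⟨_, hπq⟩ : q.primeCompl)).map e
      obtain ⟨i⟩ := exists_fractionRing_hom hπ (φ.comp (algebraMap R₀ A)) hu
      exact IsRegularLocalRing.exists_equiv_mvPowerSeries_field i
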